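/- Let $(M,g)$ be a compact connected smooth Riemannian manifold without boundary, of dimension $n\ge 1$, with Levi-Civita connection $\nabla$, and let $\pi:(E,\tilde g)\to M$ be a smooth Riemannian vector bundle of rank $m\ge 2$ with a smooth metric connection $\tilde\nabla$. Let $E_*$ be $E$ with the zero section removed and $\Sigma=\{\xi\in E:\|\xi\|=1\}$ the unit sphere bundle. The connection $\tilde\nabla$ splits $TE=HE\oplus VE\cong \pi^*TM\oplus\pi^*E$ into horizontal and vertical parts. Let $G=\pi^*g\oplus\pi^*\tilde g$ be the corresponding (Sasaki) metric on $E$ and $D=\pi^*\nabla\oplus\pi^*\tilde\nabla$ the corresponding (Sasaki) connection on $TE$, which is $G$-metric but in general has torsion. For $u\in C^\infty(\Sigma)$, identified with its radially constant extension to $E_*$, the radial graph of $u$ is the hypersurface $\mathcal Y=\{e^{u(\xi)}\xi:\xi\in\Sigma\}\subset E_*$. Its vertical Gaussian curvature at $\eta\in\mathcal Y\cap E_x$ is the Gaussian curvature at $\eta$ of $\mathcal Y\cap E_x$ as a hypersurface of the Euclidean space $(E_x,\tilde g_x)$, with the outward unit normal and the sign for which spheres have positive curvature. The vertical Gaussian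 curvature of $\mathcal Y$ is given by $K$ if it equals $K(\eta)$ at each $\eta\in\mathcal Y$. The graph $\mathcal Y$ is called convex if its second fundamental form $II(X,Y)=-G(D_XY,N)$, where $N$ is the outward $G$-unit normal of $\mathcal Y$, is positive semi-definite at each point, i.e. $II(X,X)\ge 0$ for all $X$ tangent to $\mathcal Y$. Let $K\in C^\infty(E_*)$ be strictly positive and constant on each fibre of $E_*\to M$. Then: 1. $u=-\dfrac{\log K}{m-1}$ is a smooth radially constant function on $E_*$, and the vertical Gaussian curvature of its radial graph is given by $K$. 2. If $K$ is constant on $E_*$, the radial graph of $u=-\dfrac{\log K}{m-1}$ is convex. 3. If $K$ is not constant on $E_*$, then no radial graph of a function $u\in C^\infty(\Sigma)$ whose vertical Gaussian curvature is given by $K$ is convex. -/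

import Mathlib

open Bundle Set Filter
open scoped Manifold ContDiff Topology

/-! ### Connections: connector and Levi-Civita condition -/

section Connection

variable
  {EB : Type*} [NormedAddCommGroup EB] [NormedSpace ℝ EB]
  {H : Type*} [TopologicalSpace H] {I : ModelWithCorners ℝ EB H}
  {M : Type*} [TopologicalSpace M] [ChartedSpace H M]
  {F : Type*} [NormedAddCommGroup F] [NormedSpace ℝ F]
  {V : M → Type*} [TopologicalSpace (TotalSpace F V)]
  [∀ x, AddCommGroup (V x)] [∀ x, Module ℝ (V x)] [∀ x, TopologicalSpace (V x)]
  [∀ x, IsTopologicalAddGroup (V x)] [∀ x, ContinuousSMul ℝ (V x)]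
  [FiberBundle F V]

/-- The connector `T_ξ V → V_x` (`x = π ξ`) of a connection `∇` on a vector bundle `V → M`. In the
fibre coordinates `y^α` given by a local frame `s_α` it is
`A ↦ (dy^β(A) + y^α Γ^β_{iα} dx^i(A)) s_β`: the first summand below is `dy^β(A) s_β`; the second is
`∇_{π_* A}` of the section `y^α(ξ) s_α` with constant coefficients through `ξ`.
Its kernel is the horizontal space `H_ξ V`, and it is the identification
`V_x ≅ T_ξ (V_x)` on vertical vectors. -/
noncomputable def connector (cov : CovariantDerivative I F V) (ξ : TotalSpace F V)
    (A : TangentSpace (I.prod 𝓘(ℝ, F)) ξ) : V ξ.proj :=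
  (trivializationAt F V ξ.proj).symm ξ.proj
      (mfderiv (I.prod 𝓘(ℝ, F)) 𝓘(ℝ, F)
        (fun η : TotalSpace F V ↦ ((trivializationAt F V ξ.proj) η).2) ξ A)
    + cov (fun y ↦ (trivializationAt F V ξ.proj).symm y ((trivializationAt F V ξ.proj) ξ).2) ξ.proj
        (mfderiv (I.prod 𝓘(ℝ, F)) I (fun η : TotalSpace F V ↦ η.proj) ξ A)

/-- Covariant derivative `∇_t s (t)` of a section `s : ℝ → V` along the curve `π ∘ s` in `M`, for
the connection induced by `∇` on the pulled back bundle. -/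
noncomputable def covDerivAlong (cov : CovariantDerivative I F V) (s : ℝ → TotalSpace F V) (t : ℝ) :
    V (s t).proj :=
  connector cov (s t) (mfderiv 𝓘(ℝ, ℝ) (I.prod 𝓘(ℝ, F)) s t (1 : ℝ))

end Connection

/-- `cov` is the Levi-Civita connection of the Riemannian manifold `M`: smooth, metric and torsion
free. -/
structure IsLeviCivita
    {EB : Type*} [NormedAddCommGroup EB] [NormedSpace ℝ EB] [FiniteDimensional ℝ EB]
    [CompleteSpace EB]
    {H : Type*} [TopologicalSpace H] {I : ModelWithCorners ℝ EB H}
    {M : Type*} [TopologicalSpace M] [ChartedSpace H M] [IsManifold I ∞ M]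
    [RiemannianBundle (fun x : M ↦ TangentSpace I x)]
    [IsContMDiffRiemannianBundle I ∞ EB (fun x : M ↦ TangentSpace I x)]
    (cov : CovariantDerivative I EB (fun x : M ↦ TangentSpace I x)) : Prop where
  smooth : CovariantDerivative.ContMDiffCovariantDerivative cov ∞
  metric : ∀ (x : M) (A : TangentSpace I x) (X Y : ∀ y : M, TangentSpace I y),
    MDifferentiableAt I (I.prod 𝓘(ℝ, EB)) (fun y ↦ (⟨y, X y⟩ : TangentBundle I M)) x →
    MDifferentiableAt I (I.prod 𝓘(ℝ, EB)) (fun y ↦ (⟨y, Y y⟩ : TangentBundle I M)) x →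
    mfderiv I 𝓘(ℝ, ℝ) (fun y ↦ inner ℝ (X y) (Y y)) x A =
      inner ℝ (cov X x A) (Y x) + inner ℝ (X x) (cov Y x A)
  torsion_free : cov.torsion = 0

/-! ### Gaussian curvature of hypersurfaces of a Euclidean space -/

section Euclidean

variable {W : Type*} [NormedAddCommGroup W] [InnerProductSpace ℝ W]

/-- Tangent vectors at `q` to a subset `S` of a Euclidean space: velocities at `q` of smooth curves
contained in `S`. -/
def tangentVectors (S : Set W) (q : W) : Set W :=
  {v | ∃ c : ℝ → W, ContDiffAt ℝ ∞ c 0 ∧ (∀ᶠ t in 𝓝 0, c t ∈ S) ∧ c 0 = q ∧ deriv c 0 = v}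

/-- `κ` is the Gaussian curvature at `p ∈ S` of the hypersurface `S` of the Euclidean space `W`,
i.e. the determinant of the Weingarten map `v ↦ d_p N (v)` of `T_p S = N(p)^⊥`, where `N` is (a
smooth extension of) the unit normal field of `S` near `p` that points away from the origin at
`p`. With this convention a sphere of radius `r` centred at the origin has curvature
`r ^ (1 - dim W)`. -/
def HasGaussianCurvatureAt (S : Set W) (p : W) (κ : ℝ) : Prop :=
  ∃ N : W → W, ContDiffAt ℝ ∞ N p ∧
    (∀ᶠ q in 𝓝 p, q ∈ S → ‖N q‖ = 1 ∧ ∀ v ∈ tangentVectors S q, inner ℝ (N q) v = 0) ∧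
    0 < inner ℝ (N p) p ∧
    LinearMap.det (((ℝ ∙ N p)ᗮ.orthogonalProjectionOnto ∘L fderiv ℝ N p ∘L (ℝ ∙ N p)ᗮ.subtypeL :
      (ℝ ∙ N p)ᗮ →L[ℝ] (ℝ ∙ N p)ᗮ) : (ℝ ∙ N p)ᗮ →ₗ[ℝ] (ℝ ∙ N p)ᗮ) = κ

end Euclidean

/-! ### Radial graphs in a Riemannian vector bundle -/

section RadialGraph

variable
  {EB : Type*} [NormedAddCommGroup EB] [NormedSpace ℝ EB]
  {H : Type*} [TopologicalSpace H] (I : ModelWithCorners ℝ EB H)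
  {M : Type*} [TopologicalSpace M] [ChartedSpace H M]
  (F : Type*) [NormedAddCommGroup F] [NormedSpace ℝ F]
  (V : M → Type*) [TopologicalSpace (TotalSpace F V)]
  [∀ x, NormedAddCommGroup (V x)] [∀ x, InnerProductSpace ℝ (V x)]
  [FiberBundle F V]

/-- `E_*`: the total space with the zero section removed. -/
def puncturedBundle : Set (TotalSpace F V) := {η | η.2 ≠ 0}

/-- `Σ`: the unit sphere bundle. -/
def unitSphereBundle : Set (TotalSpace F V) := {ξ | ‖ξ.2‖ = 1}

variable {F V}

/-- `u` is (the radially constant extension to `E_*` of) a smooth function on `Σ`. The value of `u`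
on the zero section is irrelevant. -/
structure IsRadiallyConstantSmooth (u : TotalSpace F V → ℝ) : Prop where
  smooth : ContMDiffOn (I.prod 𝓘(ℝ, F)) 𝓘(ℝ, ℝ) ∞ u (puncturedBundle F V)
  radial : ∀ (x : M) (v : V x) (t : ℝ), v ≠ 0 → 0 < t →
    u ⟨x, t • v⟩ = u ⟨x, v⟩

/-- The radial graph `{e^{u(ξ)} ξ : ξ ∈ Σ}`. -/
def radialGraph (u : TotalSpace F V → ℝ) : Set (TotalSpace F V) :=
  (fun ξ : TotalSpace F V ↦ (⟨ξ.proj, Real.exp (u ξ) • ξ.2⟩ : TotalSpace F V)) ''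
    unitSphereBundle F V

/-- The vertical Gaussian curvature of `Y ⊆ E` is given by `K`: at each `η ∈ Y ∩ E_x`, the Gaussian
curvature at `η` of the hypersurface `Y ∩ E_x` of the Euclidean space `E_x` is `K η`. -/
def HasVerticalGaussianCurvature (Y : Set (TotalSpace F V)) (K : TotalSpace F V → ℝ) : Prop :=
  ∀ η ∈ Y, HasGaussianCurvatureAt {w : V η.proj | (⟨η.proj, w⟩ : TotalSpace F V) ∈ Y} η.2 (K η)

/-- `c` is a smooth curve, defined near `0`, that lies in `Y`. -/
structure IsCurveIn (Y : Set (TotalSpace F V)) (c : ℝ → TotalSpace F V) : Prop where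
  smooth : ContMDiffAt 𝓘(ℝ, ℝ) (I.prod 𝓘(ℝ, F)) ∞ c 0
  mem : ∀ᶠ t in 𝓝 0, c t ∈ Y

/-- The velocity of a curve in `E`. -/
noncomputable def velocity (c : ℝ → TotalSpace F V) (t : ℝ) :
    TangentSpace (I.prod 𝓘(ℝ, F)) (c t) :=
  mfderiv 𝓘(ℝ, ℝ) (I.prod 𝓘(ℝ, F)) c t (1 : ℝ)

/-- `A ∈ T_p E` is tangent to `Y` at `p`: it is the velocity of a smooth curve in `Y`. -/
def IsTangentVector (Y : Set (TotalSpace F V)) (p : TotalSpace F V)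
    (A : TangentSpace (I.prod 𝓘(ℝ, F)) p) : Prop :=
  ∃ c : ℝ → TotalSpace F V, IsCurveIn I Y c ∧
    (⟨c 0, velocity I c 0⟩ : TangentBundle (I.prod 𝓘(ℝ, F)) (TotalSpace F V)) = ⟨p, A⟩

variable {I}

/-- The horizontal component `π_* A` of `A ∈ T_ξ E = H_ξ E ⊕ V_ξ E ≅ T_x M ⊕ E_x`. The vertical
component is `connector D A`. -/
noncomputable def horPart (ξ : TotalSpace F V) (A : TangentSpace (I.prod 𝓘(ℝ, F)) ξ) :
    TangentSpace I ξ.proj :=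
  mfderiv (I.prod 𝓘(ℝ, F)) I (fun η : TotalSpace F V ↦ η.proj) ξ A

variable [IsManifold I ∞ M] [RiemannianBundle (fun x : M ↦ TangentSpace I x)]

/-- The Sasaki metric `G` on `E`: horizontal and vertical spaces are orthogonal, and carry the
metrics of `T_x M` and of `E_x`. -/
noncomputable def sasakiMetric (D : CovariantDerivative I F V) (ξ : TotalSpace F V)
    (A B : TangentSpace (I.prod 𝓘(ℝ, F)) ξ) : ℝ :=
  inner ℝ (horPart ξ A) (horPart ξ B) + inner ℝ (connector D ξ A) (connector D ξ B)

/-- `N ∈ T_p E` is the unit normal to `Y` at `p`, for the metric `G`, that points outward, i.e. has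
positive scalar product with the radial vertical vector `p`. -/
structure IsOutwardUnitNormal (D : CovariantDerivative I F V) (Y : Set (TotalSpace F V))
    (p : TotalSpace F V) (N : TangentSpace (I.prod 𝓘(ℝ, F)) p) : Prop where
  unit : sasakiMetric D p N N = 1
  normal : ∀ A, IsTangentVector I Y p A → sasakiMetric D p N A = 0
  outward : 0 < inner ℝ (connector D p N) p.2

/-- Horizontal component of the covariant derivative `D_t Z (t)` of a vector field `Z : ℝ → TE` along
a curve in `E`, where `D` is the Sasaki connection. In terms of
`TE = HE ⊕ VE ≅ π^*TM ⊕ π^*E` the Sasaki connection (`D_{e_i} e_j = Γ^k_{ij} e_k`,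
`D_{e_i} e_α = Γ^β_{iα} e_β`, `D_{e_α} e_j = D_{e_α} e_β = 0` for horizontal lifts `e_i` and vertical
lifts `e_α` of local frames of `TM` and `E`) is the direct sum of the pull-backs of the
Levi-Civita connection `LC` of `M` and of the connection of `E`. -/
noncomputable def sasakiCovHor (LC : CovariantDerivative I EB (fun x : M ↦ TangentSpace I x))
    (Z : ℝ → TangentBundle (I.prod 𝓘(ℝ, F)) (TotalSpace F V)) (t : ℝ) :
    TangentSpace I (Z t).proj.proj :=
  covDerivAlong LC (fun s ↦ (⟨(Z s).proj.proj, horPart (Z s).proj (Z s).2⟩ : TangentBundle I M)) t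

/-- Vertical component of the covariant derivative `D_t Z (t)` of a vector field along a curve in
`E`, for the Sasaki connection. -/
noncomputable def sasakiCovVer (D : CovariantDerivative I F V)
    (Z : ℝ → TangentBundle (I.prod 𝓘(ℝ, F)) (TotalSpace F V)) (t : ℝ) : V (Z t).proj.proj :=
  covDerivAlong D
    (fun s ↦ (⟨(Z s).proj.proj, connector D (Z s).proj (Z s).2⟩ : TotalSpace F V)) t

/-- The value `II(ċ(0), Z(0)) = - G(D_t Z (0), N)` of the second fundamental form, with respect to
the normal `N` and the Sasaki connection, for a tangent vector field `Z` along a curve `c` that lies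
in a hypersurface. -/
noncomputable def secondFundamentalForm
    (LC : CovariantDerivative I EB (fun x : M ↦ TangentSpace I x)) (D : CovariantDerivative I F V)
    (Z : ℝ → TangentBundle (I.prod 𝓘(ℝ, F)) (TotalSpace F V))
    (N : TangentSpace (I.prod 𝓘(ℝ, F)) (Z 0).proj) : ℝ :=
  -(inner ℝ (sasakiCovHor LC Z 0) (horPart (Z 0).proj N) +
    inner ℝ (sasakiCovVer D Z 0) (connector D (Z 0).proj N))

/-- The hypersurface `Y` of `E` is convex: its second fundamental form is positive semi-definite at
each point, i.e. `II(ċ(0), ċ(0)) ≥ 0` for all smooth curves `c` in `Y`. -/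
def IsConvexHypersurface
    (LC : CovariantDerivative I EB (fun x : M ↦ TangentSpace I x)) (D : CovariantDerivative I F V)
    (Y : Set (TotalSpace F V)) : Prop :=
  ∀ c : ℝ → TotalSpace F V, IsCurveIn I Y c →
    ∀ N : TangentSpace (I.prod 𝓘(ℝ, F)) (c 0), IsOutwardUnitNormal D Y (c 0) N →
      0 ≤ secondFundamentalForm LC D (fun s ↦ ⟨c s, velocity I c s⟩) N

end RadialGraph

set_option linter.unusedSectionVars false

/-! Write `r = e^u` for the radius of a radial graph.

Assertion 1. As `K` is constant on fibres, the graph of `-log K / (m - 1)` meets each fibre in a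
round sphere of radius `K^(-1/(m-1))`, whose Gaussian curvature is `K`
(`hasGaussianCurvatureAt_sphere`, `radialGraph_log`).

Assertion 2. For constant `K` the graph is a sphere bundle of constant radius. Parallel transport of
a metric connection preserves norms, so horizontal vectors are tangent to it and its outward normal
is `l v` at `v`, vertical, with `l > 0`. Along a curve `c` in it `⟨D_t c, c⟩ = 0`; one more
derivative gives `II = l ‖D_t c‖² ≥ 0` (`isConvexHypersurface_of_const`).

Assertion 3. Let the graph be convex. Take a curve `γ` in `M` with zero acceleration at time zero
and a parallel section `σ` along it. The curve `(r(σ) / ‖σ‖) σ` lies in the graph, and at time zero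
its Sasaki acceleration is vertical, equal to `r(σ)'' σ / ‖σ‖`. Convexity therefore says `r(σ)'' ≤
0` there (`deriv_deriv_radius_nonpos`). A positive function that is concave along complete geodesics
is constant, and the proof replaces geodesics by a minimum principle on a compact space
(`horDeriv_nonneg_of_convex`). If some horizontal derivative of `r` is negative, then for a small `δ
> 0` the function `∂_h r / ‖h‖ + δ r` of a direction in the fibre and a direction `h` in the base
has a negative minimum. Since `δ r > 0`, also `∂_h r < 0` at the minimum. Along a parallel curve
that starts there, the derivative of the function at time zero is `r'' / ‖h‖ + δ r' < 0`, which is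
impossible at a minimum.

Hence all horizontal derivatives of `r` vanish, and parallel transport maps fibres of the graph
isometrically onto each other. Gaussian curvature is invariant under linear isometries and uniquely
determined by the hypersurface, so `K` is constant along curves in `M`, and constant by
connectedness (`eventually_curvature_eq`, `curvature_const_of_convex`). -/

theorem mvfderiv_clm_apply
    {EN : Type*} [NormedAddCommGroup EN] [NormedSpace ℝ EN]
    {HN : Type*} [TopologicalSpace HN] {J : ModelWithCorners ℝ EN HN}
    {N : Type*} [TopologicalSpace N] [ChartedSpace HN N]
    {F₁ F₂ : Type*} [NormedAddCommGroup F₁] [NormedSpace ℝ F₁]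
    [NormedAddCommGroup F₂] [NormedSpace ℝ F₂] {g : N → F₁ →L[ℝ] F₂} {f : N → F₁} {x : N}
    (hg : MDifferentiableAt J 𝓘(ℝ, F₁ →L[ℝ] F₂) g x) (hf : MDifferentiableAt J 𝓘(ℝ, F₁) f x)
    (A : TangentSpace J x) :
    mvfderiv J (fun y ↦ g y (f y)) x A = mvfderiv J g x A (f x) + g x (mvfderiv J f x A) := by
  have h1 := (isBoundedBilinearMap_apply (𝕜 := ℝ) (E := F₁) (F := F₂)).hasFDerivAt (g x, f x)
  have h0 : HasMFDerivAt J 𝓘(ℝ, (F₁ →L[ℝ] F₂) × F₁) (fun y ↦ (g y, f y)) x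
      ((mvfderiv J g x).prod (mvfderiv J f x)) :=
    ⟨hg.continuousAt.prodMk hf.continuousAt, hg.hasMFDerivAt.2.prodMk hf.hasMFDerivAt.2⟩
  have h2 := HasMFDerivAt.comp x h1.hasMFDerivAt h0
  have h3 : mfderiv J 𝓘(ℝ, F₂) (fun y ↦ g y (f y)) x = _ := h2.mfderiv
  rw [mvfderiv, h3, add_comm]
  rfl

/-! ### Connections and connectors in an arbitrary trivialization -/

section ConnectionCoordinates

variable
  {EB : Type*} [NormedAddCommGroup EB] [NormedSpace ℝ EB]
  {H : Type*} [TopologicalSpace H] {I : ModelWithCorners ℝ EB H}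
  {M : Type*} [TopologicalSpace M] [ChartedSpace H M] [IsManifold I 1 M]
  {F : Type*} [NormedAddCommGroup F] [NormedSpace ℝ F] [FiniteDimensional ℝ F]
  {V : M → Type*} [TopologicalSpace (TotalSpace F V)]
  [∀ x, AddCommGroup (V x)] [∀ x, Module ℝ (V x)] [∀ x, TopologicalSpace (V x)]
  [∀ x, IsTopologicalAddGroup (V x)] [∀ x, ContinuousSMul ℝ (V x)]
  [FiberBundle F V] [VectorBundle ℝ F V] [ContMDiffVectorBundle 1 F V I]
  (e : Trivialization F (TotalSpace.proj : TotalSpace F V → M)) [MemTrivializationAtlas e]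

theorem Bundle.Trivialization.mdifferentiableAt_symm_comp {f : M → F} {x : M}
    (hx : x ∈ e.baseSet) (hf : MDifferentiableAt I 𝓘(ℝ, F) f x) :
    MDifferentiableAt I (I.prod 𝓘(ℝ, F))
      (fun y ↦ (⟨y, e.symm y (f y)⟩ : TotalSpace F V)) x := by
  rw [e.mdifferentiableAt_section_iff I (fun y ↦ e.symm y (f y)) hx]
  refine hf.congr_of_eventuallyEq ?_
  filter_upwards [e.open_baseSet.mem_nhds hx] with y hy
  simp [e.apply_mk_symm hy]

variable (cov : CovariantDerivative I F V)

theorem CovariantDerivative.sum_smul_apply {ι : Type*} (s : Finset ι) {x : M} (g : ι → M → ℝ)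
    (σ : ι → ∀ y, V y) (hg : ∀ i, MDifferentiableAt I 𝓘(ℝ, ℝ) (g i) x)
    (hσ : ∀ i, MDifferentiableAt I (I.prod 𝓘(ℝ, F)) (fun y ↦ (⟨y, σ i y⟩ : TotalSpace F V)) x)
    (h : TangentSpace I x) :
    cov (fun y ↦ ∑ i ∈ s, g i y • σ i y) x h =
      ∑ i ∈ s, (g i x • cov (σ i) x h + mvfderiv I (g i) x h • σ i x) := by
  classical
  have hs (i) : MDifferentiableAt I (I.prod 𝓘(ℝ, F))
      (fun y ↦ (⟨y, g i y • σ i y⟩ : TotalSpace F V)) x := (hg i).smul_section (hσ i)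
  induction s using Finset.induction_on with
  | empty =>
    have : (fun y ↦ ∑ i ∈ (∅ : Finset ι), g i y • σ i y) = (0 : ∀ y, V y) := by ext; simp
    rw [this]; simp
  | insert a s ha ih =>
    have h1 : (fun y ↦ ∑ i ∈ insert a s, g i y • σ i y)
        = (g a • σ a : ∀ y, V y) + fun y ↦ ∑ i ∈ s, g i y • σ i y := by
      ext y; simp [Finset.sum_insert ha]
    have h2 : cov ((g a • σ a : ∀ y, V y) + fun y ↦ ∑ i ∈ s, g i y • σ i y) x =
        cov (g a • σ a) x + cov (fun y ↦ ∑ i ∈ s, g i y • σ i y) x :=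
      cov.isCovariantDerivativeOnUniv.add (hs a) (MDifferentiableAt.sum_section fun i _ ↦ hs i)
    rw [h1, h2,
      cov.isCovariantDerivativeOnUniv.leibniz (hσ a) (hg a), Finset.sum_insert ha]
    simp [ih]

/-- Leibniz rule for the section with coordinates `f` in a trivialization. -/
theorem CovariantDerivative.apply_symm_comp {f : M → F} {x : M}
    (hx : x ∈ e.baseSet) (hf : MDifferentiableAt I 𝓘(ℝ, F) f x) (h : TangentSpace I x) :
    cov (fun y ↦ e.symm y (f y)) x h =
      e.symm x (mvfderiv I f x h) + cov (fun y ↦ e.symm y (f x)) x h := by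
  set b := Module.finBasis ℝ F
  have hdec (w : F) (y : M) (hy : y ∈ e.baseSet) :
      e.symm y w = ∑ i, (b.coord i w) • e.symm y (b i) := by
    conv_lhs => rw [← b.sum_repr w]
    simp only [← e.symmL_apply (R := ℝ) hy, map_sum, map_smul, Module.Basis.coord_apply]
  have hσ (i) : MDifferentiableAt I (I.prod 𝓘(ℝ, F))
      (fun y ↦ (⟨y, e.symm y (b i)⟩ : TotalSpace F V)) x :=
    e.mdifferentiableAt_symm_comp hx mdifferentiableAt_const
  -- Leibniz rule on the frame given by the basis `b`. It is applied to `f` and to the constant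
  -- function `f x`: the two expansions differ exactly by the terms with the derivative of `f`.
  have key (f : M → F) (hf : MDifferentiableAt I 𝓘(ℝ, F) f x) :
      cov (fun y ↦ e.symm y (f y)) x h = ∑ i, (b.coord i (f x) • cov (fun y ↦ e.symm y (b i)) x h
        + b.coord i (mvfderiv I f x h) • e.symm x (b i)) := by
    have hg (i) : HasMFDerivAt I 𝓘(ℝ, ℝ) (fun y ↦ b.coord i (f y)) x
        ((b.coord i).toContinuousLinearMap ∘L (mvfderiv I f x)) := by
      have := ((b.coord i).toContinuousLinearMap.hasMFDerivAt (x := f x)).comp x hf.hasMFDerivAt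
      exact this
    rw [cov.isCovariantDerivativeOnUniv.congr_of_eventuallyEq (σ' := fun y ↦ ∑ i, b.coord i (f y) •
      e.symm y (b i)) (e.mdifferentiableAt_symm_comp hx hf) (MDifferentiableAt.sum_section fun i _ ↦
        (hg i).mdifferentiableAt.smul_section (hσ i)) univ_mem,
      cov.sum_smul_apply Finset.univ (fun i y ↦ b.coord i (f y)) _
        (fun i ↦ (hg i).mdifferentiableAt) hσ]
    · refine Finset.sum_congr rfl fun i _ ↦ ?_
      congr 2
      rw [mvfderiv, (hg i).mfderiv]
      rfl
    · filter_upwards [e.open_baseSet.mem_nhds hx] with y hy using hdec _ y hy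
  rw [key f hf, key (fun _ ↦ f x) mdifferentiableAt_const, hdec _ x hx]
  simp only [Finset.sum_add_distrib, mvfderiv_const]
  simp [add_comm]

/-- The trivialization in the definition of the connector may be replaced by any other one. -/
theorem connector_eq (ξ : TotalSpace F V) (hξ : ξ.proj ∈ e.baseSet)
    (A : TangentSpace (I.prod 𝓘(ℝ, F)) ξ) :
    connector cov ξ A =
      e.symm ξ.proj (mvfderiv (I.prod 𝓘(ℝ, F)) (fun η : TotalSpace F V ↦ (e η).2) ξ A) +
      cov (fun y ↦ e.symm y (e ξ).2) ξ.proj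
        (mfderiv (I.prod 𝓘(ℝ, F)) I (fun η : TotalSpace F V ↦ η.proj) ξ A) := by
  set e' := trivializationAt F V ξ.proj
  have hξ' : ξ.proj ∈ e'.baseSet := mem_baseSet_trivializationAt F V ξ.proj
  -- `G` is the transition function from `e` to `e'`. Its derivative appears in the first summand of
  -- the connector when `e'` is used (`h1`), and in the second summand when `e` is used (`h2`), so
  -- that the two sums agree.
  set G : M → F →L[ℝ] F := fun y ↦ (e.coordChangeL ℝ e' y : F →L[ℝ] F)
  have hG : MDifferentiableAt I 𝓘(ℝ, F →L[ℝ] F) G ξ.proj := mdifferentiableAt_coordChangeL hξ hξ'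
  have hproj : MDifferentiableAt (I.prod 𝓘(ℝ, F)) I (fun η : TotalSpace F V ↦ η.proj) ξ :=
    mdifferentiableAt_proj ..
  have he : MDifferentiableAt (I.prod 𝓘(ℝ, F)) 𝓘(ℝ, F) (fun η : TotalSpace F V ↦ (e η).2) ξ :=
    ((e.mdifferentiableAt_totalSpace_iff I (fun η ↦ η) (e.mem_source.2 hξ)).1
      mdifferentiableAt_id).2
  have hc : ContinuousAt (fun η : TotalSpace F V ↦ η.proj) ξ := hproj.continuousAt
  have hee : (fun η : TotalSpace F V ↦ (e' η).2) =ᶠ[𝓝 ξ] fun η ↦ G η.proj (e η).2 := by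
    filter_upwards [hc.preimage_mem_nhds ((e.open_baseSet.inter e'.open_baseSet).mem_nhds ⟨hξ, hξ'⟩)]
      with η hη
    simp only [G, e.coordChangeL_apply e' hη, ContinuousLinearEquiv.coe_coe]
    rw [e.symm_proj_apply η hη.1]
  set v := (e ξ).2
  set h := mfderiv (I.prod 𝓘(ℝ, F)) I (fun η : TotalSpace F V ↦ η.proj) ξ A
  have hGv : mvfderiv I (fun y ↦ G y v) ξ.proj h = mvfderiv I G ξ.proj h v := by
    rw [mvfderiv_clm_apply hG mdifferentiableAt_const, mvfderiv_const]; simp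
  have hGcomp : mvfderiv (I.prod 𝓘(ℝ, F)) (fun η : TotalSpace F V ↦ G η.proj) ξ A =
      mvfderiv I G ξ.proj h := by
    exact mfderiv_comp_apply (f := fun η : TotalSpace F V ↦ η.proj) ξ hG hproj A
  have h1 : mvfderiv (I.prod 𝓘(ℝ, F)) (fun η : TotalSpace F V ↦ (e' η).2) ξ A =
      mvfderiv I G ξ.proj h v +
        G ξ.proj (mvfderiv (I.prod 𝓘(ℝ, F)) (fun η : TotalSpace F V ↦ (e η).2) ξ A) := by
    rw [mvfderiv, hee.mfderiv_eq, ← hGcomp]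
    exact mvfderiv_clm_apply (hG.comp ξ hproj) he A
  have hsymm (w : F) (y : M) (hy : y ∈ e.baseSet ∩ e'.baseSet) :
      e'.symm y (G y w) = e.symm y w := by
    simp only [G, e.coordChangeL_apply e' hy, ContinuousLinearEquiv.coe_coe]
    exact e'.symm_apply_apply_mk hy.2 _
  have h2 : cov (fun y ↦ e.symm y v) ξ.proj h =
      e'.symm ξ.proj (mvfderiv I G ξ.proj h v) + cov (fun y ↦ e'.symm y (e' ξ).2) ξ.proj h := by
    have hGd : MDifferentiableAt I 𝓘(ℝ, F) (fun y ↦ G y v) ξ.proj :=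
      hG.clm_apply mdifferentiableAt_const
    rw [← hGv, cov.isCovariantDerivativeOnUniv.congr_of_eventuallyEq
      (σ' := fun y ↦ e'.symm y (G y v)) (e.mdifferentiableAt_symm_comp hξ mdifferentiableAt_const)
      (e'.mdifferentiableAt_symm_comp hξ' hGd) univ_mem, cov.apply_symm_comp e' hξ' hGd,
      show (e' ξ).2 = G ξ.proj v from hee.self_of_nhds]
    filter_upwards [(e.open_baseSet.inter e'.open_baseSet).mem_nhds ⟨hξ, hξ'⟩] with y hy
    exact (hsymm v y hy).symm
  rw [h2, ← add_assoc, ← hsymm _ _ ⟨hξ, hξ'⟩]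
  change e'.symm ξ.proj (mvfderiv (I.prod 𝓘(ℝ, F)) (fun η : TotalSpace F V ↦ (e' η).2) ξ A) + _ = _
  rw [h1]
  congr 1
  rw [← e'.symmL_apply (R := ℝ) hξ', ← e'.symmL_apply (R := ℝ) hξ', ← e'.symmL_apply (R := ℝ) hξ',
    map_add, add_comm]

end ConnectionCoordinates

/-- The velocity of a curve in a manifold. -/
noncomputable def curveVelocity
    {EB : Type*} [NormedAddCommGroup EB] [NormedSpace ℝ EB]
    {H : Type*} [TopologicalSpace H] (I : ModelWithCorners ℝ EB H)
    {M : Type*} [TopologicalSpace M] [ChartedSpace H M] (γ : ℝ → M) (t : ℝ) :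
    TangentSpace I (γ t) :=
  mfderiv 𝓘(ℝ, ℝ) I γ t (1 : ℝ)

theorem mvfderiv_curveVelocity
    {EB : Type*} [NormedAddCommGroup EB] [NormedSpace ℝ EB]
    {H : Type*} [TopologicalSpace H] {I : ModelWithCorners ℝ EB H}
    {M : Type*} [TopologicalSpace M] [ChartedSpace H M] {γ : ℝ → M} {t : ℝ}
    {F : Type*} [NormedAddCommGroup F] [NormedSpace ℝ F] {g : M → F}
    (hg : MDifferentiableAt I 𝓘(ℝ, F) g (γ t)) (hγ : MDifferentiableAt 𝓘(ℝ, ℝ) I γ t) :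
    HasDerivAt (fun s ↦ g (γ s)) (mvfderiv I g (γ t) (curveVelocity I γ t)) t := by
  have h : HasFDerivAt (fun s ↦ g (γ s))
      ((mvfderiv I g (γ t)).comp (mfderiv 𝓘(ℝ, ℝ) I γ t) : ℝ →L[ℝ] F) t :=
    (hg.hasMFDerivAt.comp t hγ.hasMFDerivAt).hasFDerivAt
  exact h.hasDerivAt

/-! ### Covariant derivatives along curves -/

section ConnectionCurves

variable
  {EB : Type*} [NormedAddCommGroup EB] [NormedSpace ℝ EB]
  {H : Type*} [TopologicalSpace H] {I : ModelWithCorners ℝ EB H}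
  {M : Type*} [TopologicalSpace M] [ChartedSpace H M] [IsManifold I 1 M]
  {F : Type*} [NormedAddCommGroup F] [NormedSpace ℝ F] [FiniteDimensional ℝ F]
  {V : M → Type*} [TopologicalSpace (TotalSpace F V)]
  [∀ x, AddCommGroup (V x)] [∀ x, Module ℝ (V x)] [∀ x, TopologicalSpace (V x)]
  [∀ x, IsTopologicalAddGroup (V x)] [∀ x, ContinuousSMul ℝ (V x)]
  [FiberBundle F V] [VectorBundle ℝ F V] [ContMDiffVectorBundle 1 F V I]
  (e : Trivialization F (TotalSpace.proj : TotalSpace F V → M)) [MemTrivializationAtlas e]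
  (cov : CovariantDerivative I F V)

/-- With `apply_symm_add`, this is the linearity that makes `connForm` a linear map of the fibre
coordinate. -/
theorem CovariantDerivative.apply_symm_smul {x : M} (hx : x ∈ e.baseSet) (a : ℝ) (v : F)
    (h : TangentSpace I x) :
    cov (fun y ↦ e.symm y (a • v)) x h = a • cov (fun y ↦ e.symm y v) x h := by
  have hd (w : F) := e.mdifferentiableAt_symm_comp (I := I) hx
    (mdifferentiableAt_const (c := w) (I := I) (I' := 𝓘(ℝ, F)))
  rw [cov.isCovariantDerivativeOnUniv.congr_of_eventuallyEq (σ' := a • fun y ↦ e.symm y v)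
    (hd _) (MDifferentiableAt.smul_const_section (hd v)) univ_mem,
    cov.isCovariantDerivativeOnUniv.smul_const a (hd v)]
  · rfl
  · filter_upwards [e.open_baseSet.mem_nhds hx] with y hy
    simp only [← e.symmL_apply (R := ℝ) hy, map_smul, Pi.smul_apply]

theorem CovariantDerivative.apply_symm_add {x : M} (hx : x ∈ e.baseSet) (v w : F)
    (h : TangentSpace I x) :
    cov (fun y ↦ e.symm y (v + w)) x h =
      cov (fun y ↦ e.symm y v) x h + cov (fun y ↦ e.symm y w) x h := by
  have hd (w : F) := e.mdifferentiableAt_symm_comp (I := I) hx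
    (mdifferentiableAt_const (c := w) (I := I) (I' := 𝓘(ℝ, F)))
  have := cov.isCovariantDerivativeOnUniv.add (hd v) (hd w)
  rw [cov.isCovariantDerivativeOnUniv.congr_of_eventuallyEq
    (σ' := (fun y ↦ e.symm y v) + fun y ↦ e.symm y w)
    (hd _) (mdifferentiableAt_add_section (hd v) (hd w)) univ_mem, this]
  · rfl
  · filter_upwards [e.open_baseSet.mem_nhds hx] with y hy
    simp only [← e.symmL_apply (R := ℝ) hy, map_add, Pi.add_apply]

variable {e} in
theorem Bundle.Trivialization.differentiableAt_snd_comp {S : ℝ → TotalSpace F V} {t : ℝ}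
    (ht : (S t).proj ∈ e.baseSet) (hS : MDifferentiableAt 𝓘(ℝ, ℝ) (I.prod 𝓘(ℝ, F)) S t) :
    DifferentiableAt ℝ (fun s ↦ (e (S s)).2) t :=
  ((e.mdifferentiableAt_totalSpace_iff I S (e.mem_source.2 ht)).1 hS).2.differentiableAt

/-- The covariant derivative along a curve, in an arbitrary trivialization. -/
theorem covDerivAlong_eq {S : ℝ → TotalSpace F V} {t : ℝ} (ht : (S t).proj ∈ e.baseSet)
    (hS : MDifferentiableAt 𝓘(ℝ, ℝ) (I.prod 𝓘(ℝ, F)) S t) :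
    covDerivAlong cov S t = e.symm (S t).proj (deriv (fun s ↦ (e (S s)).2) t) +
      cov (fun y ↦ e.symm y (e (S t)).2) (S t).proj (curveVelocity I (fun s ↦ (S s).proj) t) := by
  have he : MDifferentiableAt (I.prod 𝓘(ℝ, F)) 𝓘(ℝ, F) (fun η : TotalSpace F V ↦ (e η).2) (S t) :=
    ((e.mdifferentiableAt_totalSpace_iff I (fun η ↦ η) (e.mem_source.2 ht)).1
      mdifferentiableAt_id).2
  have hproj : MDifferentiableAt (I.prod 𝓘(ℝ, F)) I (fun η : TotalSpace F V ↦ η.proj) (S t) :=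
    mdifferentiableAt_proj ..
  rw [covDerivAlong, connector_eq e cov _ ht]
  congr 2
  · exact (mvfderiv_curveVelocity he hS).deriv.symm
  · exact (mfderiv_comp_apply (f := S) (g := fun η : TotalSpace F V ↦ η.proj) t hproj hS _).symm

/-- Used for second covariant derivatives: the first one is replaced by an expression that is known
near `t`. -/
theorem covDerivAlong_congr {γ : ℝ → M} {σ τ : ∀ s, V (γ s)} {t : ℝ}
    (hσ : MDifferentiableAt 𝓘(ℝ, ℝ) (I.prod 𝓘(ℝ, F)) (fun s ↦ (⟨γ s, σ s⟩ : TotalSpace F V)) t)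
    (h : ∀ᶠ s in 𝓝 t, σ s = τ s) :
    covDerivAlong cov (fun s ↦ (⟨γ s, σ s⟩ : TotalSpace F V)) t =
      covDerivAlong cov (fun s ↦ (⟨γ s, τ s⟩ : TotalSpace F V)) t := by
  have heq : (fun s ↦ (⟨γ s, σ s⟩ : TotalSpace F V)) =ᶠ[𝓝 t] fun s ↦ ⟨γ s, τ s⟩ := by
    filter_upwards [h] with s hs
    rw [hs]
  have ht : γ t ∈ (trivializationAt F V (γ t)).baseSet := mem_baseSet_trivializationAt F V (γ t)
  rw [covDerivAlong_eq (trivializationAt F V (γ t)) cov ht hσ,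
    covDerivAlong_eq (trivializationAt F V (γ t)) cov ht (hσ.congr_of_eventuallyEq heq.symm)]
  congr 2
  · exact (heq.fun_comp fun η ↦ (trivializationAt F V (γ t) η).2).deriv_eq
  · simp only [h.self_of_nhds]

/-- For a parallel `σ` this reduces to `D_t (f σ) = f' σ`, so that covariant derivatives of rescaled
parallel sections become derivatives of scalar functions. -/
theorem covDerivAlong_smul {γ : ℝ → M} {σ : ∀ s, V (γ s)} {f : ℝ → ℝ} {t : ℝ}
    (hσ : MDifferentiableAt 𝓘(ℝ, ℝ) (I.prod 𝓘(ℝ, F)) (fun s ↦ (⟨γ s, σ s⟩ : TotalSpace F V)) t)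
    (hf : DifferentiableAt ℝ f t) :
    covDerivAlong cov (fun s ↦ (⟨γ s, f s • σ s⟩ : TotalSpace F V)) t =
      deriv f t • σ t + f t • covDerivAlong cov (fun s ↦ (⟨γ s, σ s⟩ : TotalSpace F V)) t := by
  set e := trivializationAt F V (γ t)
  have ht : γ t ∈ e.baseSet := mem_baseSet_trivializationAt F V (γ t)
  obtain ⟨hγ, hσe⟩ := (e.mdifferentiableAt_totalSpace_iff I _ (e.mem_source.2 ht)).1 hσ
  have hnear : ∀ᶠ s in 𝓝 t, γ s ∈ e.baseSet :=
    hγ.continuousAt.preimage_mem_nhds (e.open_baseSet.mem_nhds ht)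
  have hlin (s) (hs : γ s ∈ e.baseSet) :
      (e (⟨γ s, f s • σ s⟩ : TotalSpace F V)).2 = f s • (e (⟨γ s, σ s⟩ : TotalSpace F V)).2 :=
    (e.linear ℝ hs).map_smul _ _
  have heq : (fun s ↦ (e (⟨γ s, f s • σ s⟩ : TotalSpace F V)).2) =ᶠ[𝓝 t]
      fun s ↦ f s • (e (⟨γ s, σ s⟩ : TotalSpace F V)).2 := by
    filter_upwards [hnear] with s hs using hlin s hs
  have hfσ : MDifferentiableAt 𝓘(ℝ, ℝ) (I.prod 𝓘(ℝ, F))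
      (fun s ↦ (⟨γ s, f s • σ s⟩ : TotalSpace F V)) t := by
    refine (e.mdifferentiableAt_totalSpace_iff I _ (e.mem_source.2 ht)).2 ⟨hγ, ?_⟩
    exact ((hf.smul hσe.differentiableAt).mdifferentiableAt).congr_of_eventuallyEq heq
  rw [covDerivAlong_eq e cov ht hfσ, covDerivAlong_eq e cov ht hσ, heq.deriv_eq,
    deriv_fun_smul hf hσe.differentiableAt]
  simp only [hlin t ht]
  rw [cov.apply_symm_smul e ht, ← e.symmL_apply (R := ℝ) ht, ← e.symmL_apply (R := ℝ) ht, map_add,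
    map_smul, map_smul]
  simp only [e.symmL_apply (R := ℝ) ht]
  rw [e.symm_apply_apply_mk ht, smul_add]
  abel

end ConnectionCurves

/-! ### Metric connections: product rule along curves -/

section Metric

variable
  {EB : Type*} [NormedAddCommGroup EB] [NormedSpace ℝ EB]
  {H : Type*} [TopologicalSpace H] {I : ModelWithCorners ℝ EB H}
  {M : Type*} [TopologicalSpace M] [ChartedSpace H M] [IsManifold I 1 M]
  {F : Type*} [NormedAddCommGroup F] [NormedSpace ℝ F] [FiniteDimensional ℝ F]
  {V : M → Type*} [TopologicalSpace (TotalSpace F V)]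
  [∀ x, NormedAddCommGroup (V x)] [∀ x, InnerProductSpace ℝ (V x)]
  [FiberBundle F V] [VectorBundle ℝ F V] [ContMDiffVectorBundle 1 F V I]
  [IsContMDiffRiemannianBundle I 1 F V]
  (cov : CovariantDerivative I F V)

/-- Compatibility of a connection with a metric, tested on all sections. -/
def CovariantDerivative.IsMetric (cov : CovariantDerivative I F V) : Prop :=
  ∀ (x : M) (A : TangentSpace I x) (X Y : ∀ y : M, V y),
    MDifferentiableAt I (I.prod 𝓘(ℝ, F)) (fun y ↦ (⟨y, X y⟩ : TotalSpace F V)) x →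
    MDifferentiableAt I (I.prod 𝓘(ℝ, F)) (fun y ↦ (⟨y, Y y⟩ : TotalSpace F V)) x →
    mvfderiv I (fun y ↦ inner ℝ (X y) (Y y)) x A =
      inner ℝ (cov X x A) (Y x) + inner ℝ (X x) (cov Y x A)

/-- Leibniz rule for the scalar product of two sections along a curve. -/
theorem CovariantDerivative.IsMetric.hasDerivAt_inner {cov : CovariantDerivative I F V}
    (hcov : cov.IsMetric) {γ : ℝ → M} {σ τ : ∀ s, V (γ s)} {t : ℝ}
    (hσ : MDifferentiableAt 𝓘(ℝ, ℝ) (I.prod 𝓘(ℝ, F)) (fun s ↦ (⟨γ s, σ s⟩ : TotalSpace F V)) t)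
    (hτ : MDifferentiableAt 𝓘(ℝ, ℝ) (I.prod 𝓘(ℝ, F)) (fun s ↦ (⟨γ s, τ s⟩ : TotalSpace F V)) t) :
    HasDerivAt (fun s ↦ inner ℝ (σ s) (τ s))
      (inner ℝ (covDerivAlong cov (fun s ↦ (⟨γ s, σ s⟩ : TotalSpace F V)) t) (τ t) +
        inner ℝ (σ t) (covDerivAlong cov (fun s ↦ (⟨γ s, τ s⟩ : TotalSpace F V)) t)) t := by
  set e := trivializationAt F V (γ t)
  set b := Module.finBasis ℝ F
  have ht : γ t ∈ e.baseSet := mem_baseSet_trivializationAt F V (γ t)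
  obtain ⟨hγ, hσe⟩ := (e.mdifferentiableAt_totalSpace_iff I _ (e.mem_source.2 ht)).1 hσ
  obtain ⟨-, hτe⟩ := (e.mdifferentiableAt_totalSpace_iff I _ (e.mem_source.2 ht)).1 hτ
  have hnear : ∀ᶠ s in 𝓝 t, γ s ∈ e.baseSet :=
    hγ.continuousAt.preimage_mem_nhds (e.open_baseSet.mem_nhds ht)
  have hdec (w : F) (y : M) (hy : y ∈ e.baseSet) :
      e.symm y w = ∑ i, (b.coord i w) • e.symm y (b i) := by
    conv_lhs => rw [← b.sum_repr w]
    simp only [← e.symmL_apply (R := ℝ) hy, map_sum, map_smul, Module.Basis.coord_apply]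
  have hd (w : F) := e.mdifferentiableAt_symm_comp (I := I) ht
    (mdifferentiableAt_const (c := w) (I := I) (I' := 𝓘(ℝ, F)))
  have hcdec (w : F) (h : TangentSpace I (γ t)) : cov (fun y ↦ e.symm y w) (γ t) h =
      ∑ i, (b.coord i w) • cov (fun y ↦ e.symm y (b i)) (γ t) h := by
    have := cov.sum_smul_apply Finset.univ (fun i _ ↦ b.coord i w) (fun i y ↦ e.symm y (b i))
      (fun i ↦ mdifferentiableAt_const) (fun i ↦ hd (b i)) h
    simp only [mvfderiv_const] at this
    rw [cov.isCovariantDerivativeOnUniv.congr_of_eventuallyEq (σ' := fun y ↦ ∑ i, b.coord i w •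
      e.symm y (b i)) (hd w) (MDifferentiableAt.sum_section fun i _ ↦
        MDifferentiableAt.smul_const_section (hd (b i))) univ_mem, this]
    · simp
    · filter_upwards [e.open_baseSet.mem_nhds ht] with y hy using hdec _ y hy
  set v := curveVelocity I γ t
  -- Metric compatibility is applied to frame fields only: `σ` and `τ` live along `γ` and need not
  -- extend to `M`.
  have hg (i j) : HasDerivAt (fun s ↦ inner ℝ (e.symm (γ s) (b i)) (e.symm (γ s) (b j)))
      (inner ℝ (cov (fun y ↦ e.symm y (b i)) (γ t) v) (e.symm (γ t) (b j)) +
        inner ℝ (e.symm (γ t) (b i)) (cov (fun y ↦ e.symm y (b j)) (γ t) v)) t := by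
    rw [← hcov (γ t) v (fun y ↦ e.symm y (b i)) (fun y ↦ e.symm y (b j)) (hd _) (hd _)]
    exact mvfderiv_curveVelocity (MDifferentiableAt.inner_bundle (hd (b i)) (hd (b j))) hγ
  have hco (i) (f : ℝ → F) (hf : DifferentiableAt ℝ f t) :
      HasDerivAt (fun s ↦ b.coord i (f s)) (b.coord i (deriv f t)) t :=
    (b.coord i).toContinuousLinearMap.hasFDerivAt.comp_hasDerivAt t hf.hasDerivAt
  have hsum := HasDerivAt.fun_sum (u := Finset.univ) fun i _ ↦
    HasDerivAt.fun_sum (u := Finset.univ) fun j _ ↦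
      ((hco i _ hσe.differentiableAt).mul (hco j _ hτe.differentiableAt)).mul (hg i j)
  refine (hsum.congr_of_eventuallyEq ?_).congr_deriv ?_
  · filter_upwards [hnear] with s hs
    conv_lhs => rw [← e.symm_apply_apply_mk hs (σ s), ← e.symm_apply_apply_mk hs (τ s),
      hdec _ _ hs, hdec (e (⟨γ s, τ s⟩ : TotalSpace F V)).2 _ hs]
    simp only [sum_inner, inner_sum, inner_smul_left, inner_smul_right, Finset.mul_sum]
    rw [Finset.sum_comm]
    refine Finset.sum_congr rfl fun i _ ↦ Finset.sum_congr rfl fun j _ ↦ ?_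
    simp; ring
  · simp only [Pi.mul_apply]
    rw [covDerivAlong_eq e cov ht hσ, covDerivAlong_eq e cov ht hτ]
    have hσt := (e.symm_apply_apply_mk ht (σ t)).symm
    have hτt := (e.symm_apply_apply_mk ht (τ t)).symm
    change _ = inner ℝ (e.symm (γ t) _ + cov _ (γ t) v) _ +
      inner ℝ _ (e.symm (γ t) _ + cov _ (γ t) v)
    -- What remains is bilinear algebra in the coordinates `a`, `c` and their derivatives `a'`,
    -- `c'`, expanded on the frame.
    generalize deriv (fun s ↦ (e (⟨γ s, σ s⟩ : TotalSpace F V)).2) t = a'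
    generalize deriv (fun s ↦ (e (⟨γ s, τ s⟩ : TotalSpace F V)).2) t = c'
    generalize (e (⟨γ t, σ t⟩ : TotalSpace F V)).2 = a at *
    generalize (e (⟨γ t, τ t⟩ : TotalSpace F V)).2 = c at *
    rw [hσt, hτt, hcdec a, hcdec c, hdec a' _ ht, hdec c' _ ht, hdec a _ ht, hdec c _ ht]
    simp only [sum_inner, inner_sum, inner_smul_left, inner_smul_right, inner_add_left,
      inner_add_right, Finset.mul_sum, conj_trivial, ← Finset.sum_add_distrib]
    rw [Finset.sum_comm]
    refine Finset.sum_congr rfl fun i _ ↦ Finset.sum_congr rfl fun j _ ↦ ?_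
    ring

end Metric

/-- Local fundamental solution of a linear ordinary differential equation. -/
theorem exists_fundamental_solution {E : Type*} [NormedAddCommGroup E] [NormedSpace ℝ E]
    [CompleteSpace E] {A : ℝ → E →L[ℝ] E} {J : Set ℝ} (hJ : IsOpen J) (h0 : (0 : ℝ) ∈ J)
    (hA : ContDiffOn ℝ ∞ A J) :
    ∃ ε > 0, Ioo (-ε) ε ⊆ J ∧ ∃ Φ : ℝ → E →L[ℝ] E, Φ 0 = ContinuousLinearMap.id ℝ E ∧
      ContDiffOn ℝ ∞ Φ (Ioo (-ε) ε) ∧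
      ∀ t ∈ Ioo (-ε) ε, HasDerivAt Φ (-(A t ∘L Φ t)) t := by
  -- Time is adjoined as a coordinate to make the equation autonomous; `hτ` shows that this
  -- coordinate of the solution is `t`.
  let f : ℝ × (E →L[ℝ] E) → ℝ × (E →L[ℝ] E) := fun p ↦ (1, -(A p.1 ∘L p.2))
  have hf : ContDiffAt ℝ 1 f (0, ContinuousLinearMap.id ℝ E) := by
    have hA0 : ContDiffAt ℝ 1 A 0 := (hA.contDiffAt (hJ.mem_nhds h0)).of_le (by norm_cast)
    have h1 : ContDiffAt ℝ 1 (fun p : ℝ × (E →L[ℝ] E) ↦ A p.1) (0, ContinuousLinearMap.id ℝ E) :=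
      ContDiffAt.comp (0, ContinuousLinearMap.id ℝ E) hA0 contDiffAt_fst
    exact contDiffAt_const.prodMk (h1.clm_comp contDiffAt_snd).neg
  obtain ⟨α, hα0, δ, hδ, hα⟩ :=
    hf.exists_forall_mem_closedBall_exists_eq_forall_mem_Ioo_hasDerivAt₀ 0
  simp only [zero_sub, zero_add] at hα
  have h1 (t) (ht : t ∈ Ioo (-δ) δ) : HasDerivAt (fun s ↦ (α s).1) 1 t :=
    (hasFDerivAt_fst (p := α t)).comp_hasDerivAt t (hα t ht)
  have h2 (t) (ht : t ∈ Ioo (-δ) δ) : HasDerivAt (fun s ↦ (α s).2) (-(A (α t).1 ∘L (α t).2)) t :=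
    (hasFDerivAt_snd (p := α t)).comp_hasDerivAt t (hα t ht)
  have hτ (t) (ht : t ∈ Ioo (-δ) δ) : (α t).1 = t := by
    have hd (t) (ht : t ∈ Ioo (-δ) δ) : HasDerivAt (fun s ↦ (α s).1 - s) 0 t := by
      simpa using (h1 t ht).fun_sub (hasDerivAt_id' t)
    have := isOpen_Ioo.is_const_of_deriv_eq_zero isPreconnected_Ioo
      (fun t ht ↦ (hd t ht).differentiableAt.differentiableWithinAt) (fun t ht ↦ (hd t ht).deriv)
      ht (show (0 : ℝ) ∈ Ioo (-δ) δ by constructor <;> linarith)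
    simp only [hα0] at this
    linarith
  obtain ⟨r, hr, hrJ⟩ := Metric.isOpen_iff.1 hJ 0 h0
  -- The factor `1 / 2` keeps the closed interval `Icc (-ε) ε` inside `J` and inside the interval of
  -- existence. The bootstrap from a solution to a smooth solution is done on `Icc`.
  set ε := min r δ / 2
  have hε : 0 < ε := by positivity
  have hεr : ε < r := by have := min_le_left r δ; have : 0 < min r δ := by positivity
                         simp only [ε]; linarith
  have hεδ : ε < δ := by have := min_le_right r δ; have : 0 < min r δ := by positivity
                         simp only [ε]; linarith
  have hIJ : Icc (-ε) ε ⊆ J := fun t ht ↦ hrJ (by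
    rw [Metric.mem_ball, dist_zero_right, Real.norm_eq_abs, abs_lt]
    constructor <;> linarith [ht.1, ht.2])
  have hIδ : Icc (-ε) ε ⊆ Ioo (-δ) δ := fun t ht ↦ ⟨by linarith [ht.1], by linarith [ht.2]⟩
  have hΦ (t) (ht : t ∈ Icc (-ε) ε) : HasDerivAt (fun s ↦ (α s).2) (-(A t ∘L (α t).2)) t := by
    have := h2 t (hIδ ht)
    rwa [hτ t (hIδ ht)] at this
  refine ⟨ε, hε, Ioo_subset_Icc_self.trans hIJ, fun s ↦ (α s).2, by simp [hα0], ?_,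
    fun t ht ↦ hΦ t (Ioo_subset_Icc_self ht)⟩
  refine (ODE.contDiffOn_enat_Icc_of_hasDerivWithinAt (n := ⊤) (f := fun t B ↦ -(A t ∘L B))
    (u := univ) ?_ (fun t ht ↦ (hΦ t ht).hasDerivWithinAt) (mapsTo_univ _ _)).mono
      Ioo_subset_Icc_self
  have hA1 : ContDiffOn ℝ ∞ (fun p : ℝ × (E →L[ℝ] E) ↦ A p.1) (Icc (-ε) ε ×ˢ univ) :=
    hA.comp contDiffOn_fst fun p hp ↦ hIJ hp.1
  exact (hA1.clm_comp contDiffOn_snd).neg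

/-! ### The connection form and parallel transport -/

section ParallelTransport

variable
  {EB : Type*} [NormedAddCommGroup EB] [NormedSpace ℝ EB] [FiniteDimensional ℝ EB]
  {H : Type*} [TopologicalSpace H] {I : ModelWithCorners ℝ EB H}
  {M : Type*} [TopologicalSpace M] [ChartedSpace H M] [IsManifold I ∞ M] [T2Space M]
  {F : Type*} [NormedAddCommGroup F] [NormedSpace ℝ F] [FiniteDimensional ℝ F]
  {V : M → Type*} [TopologicalSpace (TotalSpace F V)]
  [∀ x, AddCommGroup (V x)] [∀ x, Module ℝ (V x)] [∀ x, TopologicalSpace (V x)]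
  [∀ x, IsTopologicalAddGroup (V x)] [∀ x, ContinuousSMul ℝ (V x)]
  [FiberBundle F V] [VectorBundle ℝ F V] [ContMDiffVectorBundle ∞ F V I]
  (e : Trivialization F (TotalSpace.proj : TotalSpace F V → M)) [MemTrivializationAtlas e]
  (cov : CovariantDerivative I F V)

/-- The connection form of a connection in a trivialization. -/
noncomputable def connForm (x : M) (h : TangentSpace I x) : F →L[ℝ] F :=
  LinearMap.toContinuousLinearMap
    { toFun := fun v ↦ e.linearMapAt ℝ x (cov (fun y ↦ e.symm y v) x h)
      map_add' := fun v w ↦ by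
        by_cases hx : x ∈ e.baseSet
        · rw [cov.apply_symm_add e hx, map_add]
        · simp [e.linearMapAt_def_of_notMem hx]
      map_smul' := fun a v ↦ by
        by_cases hx : x ∈ e.baseSet
        · rw [cov.apply_symm_smul e hx, map_smul]; rfl
        · simp [e.linearMapAt_def_of_notMem hx] }

theorem connForm_apply (x : M) (h : TangentSpace I x) (v : F) :
    connForm e cov x h v = e.linearMapAt ℝ x (cov (fun y ↦ e.symm y v) x h) := rfl

theorem symm_connForm {x : M} (hx : x ∈ e.baseSet) (h : TangentSpace I x) (v : F) :
    e.symm x (connForm e cov x h v) = cov (fun y ↦ e.symm y v) x h := by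
  rw [connForm_apply, e.symm_linearMapAt hx]

/-- The coordinate form `w' + Γ(γ') w` of the covariant derivative, which turns parallelism into a
linear differential equation. -/
theorem covDerivAlong_eq_symm {S : ℝ → TotalSpace F V} {t : ℝ} (ht : (S t).proj ∈ e.baseSet)
    (hS : MDifferentiableAt 𝓘(ℝ, ℝ) (I.prod 𝓘(ℝ, F)) S t) :
    covDerivAlong cov S t = e.symm (S t).proj (deriv (fun s ↦ (e (S s)).2) t +
      connForm e cov (S t).proj (curveVelocity I (fun s ↦ (S s).proj) t) (e (S t)).2) := by
  rw [covDerivAlong_eq e cov ht hS, ← symm_connForm e cov ht]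
  simp only [← e.symmL_apply (R := ℝ) ht, map_add]

variable {cov}

/-- Smoothness of `cov` is used here for sections that are smooth on all of `M`, so the frame field
of `e` is cut off by a bump function that equals one near `x`. Locality of the connection removes
the cut-off. -/
theorem contMDiffAt_cov_symm (hcov : cov.ContMDiffCovariantDerivative ∞) {x : M}
    (hx : x ∈ e.baseSet) (v : F) :
    ContMDiffAt I (I.prod 𝓘(ℝ, EB →L[ℝ] F)) ∞
      (fun y ↦ TotalSpace.mk' (EB →L[ℝ] F) (E := fun y : M ↦ TangentSpace I y →L[ℝ] V y) y
        (cov (fun z ↦ e.symm z v) y)) x := by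
  obtain ⟨ψ, -, hψ⟩ := (SmoothBumpFunction.nhds_basis_tsupport (I := I) x).mem_iff.1
    (e.open_baseSet.mem_nhds hx)
  have hs : ContMDiffOn I (I.prod 𝓘(ℝ, F)) ∞ (fun y ↦ (⟨y, e.symm y v⟩ : TotalSpace F V))
      e.baseSet := by
    rw [e.contMDiffOn_section_baseSet_iff]
    refine contMDiffOn_const (c := v) |>.congr fun y hy ↦ ?_
    simp [e.apply_mk_symm hy]
  have hσ : ContMDiff I (I.prod 𝓘(ℝ, F)) ∞
      (fun y ↦ (⟨y, ((ψ : M → ℝ) • fun y ↦ e.symm y v) y⟩ : TotalSpace F V)) :=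
    ContMDiffOn.smul_section_of_tsupport ψ.contMDiff.contMDiffOn e.open_baseSet hψ hs
  have h1 := hcov.contMDiff.contMDiff (hσ.contMDiffOn (s := univ))
  refine (h1.contMDiffAt univ_mem).congr_of_eventuallyEq ?_
  filter_upwards [ψ.eventuallyEq_one.eventuallyEq_nhds, e.open_baseSet.mem_nhds hx] with y hy hy'
  congr 1
  refine cov.isCovariantDerivativeOnUniv.congr_of_eventuallyEq
    (e.mdifferentiableAt_symm_comp hy' mdifferentiableAt_const)
    ((hσ y).mdifferentiableAt (by simp)) univ_mem ?_
  filter_upwards [hy] with z hz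
  simp [hz]

/-- The connection form depends smoothly on the tangent vector. -/
theorem contDiffOn_connForm {n : ℕ∞} (hcov : cov.ContMDiffCovariantDerivative ∞)
    {N : Type*} [NormedAddCommGroup N] [NormedSpace ℝ N] {b : N → M}
    {X : ∀ p, TangentSpace I (b p)} {s : Set N} (hs : IsOpen s) (hb : ∀ p ∈ s, b p ∈ e.baseSet)
    (hX : ContMDiffOn 𝓘(ℝ, N) (I.prod 𝓘(ℝ, EB)) n (fun p ↦ (⟨b p, X p⟩ : TangentBundle I M)) s) :
    ContDiffOn ℝ n (fun p ↦ connForm e cov (b p) (X p)) s := by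
  rw [contDiffOn_clm_apply]
  intro v
  rw [← contMDiffOn_iff_contDiffOn]
  intro p hp
  have hXp := hX.contMDiffAt (hs.mem_nhds hp)
  have hbp : ContMDiffAt 𝓘(ℝ, N) I n b p := (contMDiffAt_totalSpace.1 hXp).1
  have h1 := ContMDiffAt.clm_bundle_apply (b := b) (v := X)
    (ϕ := fun p ↦ cov (fun z ↦ e.symm z v) (b p))
    (ContMDiffAt.comp p ((contMDiffAt_cov_symm e hcov (hb p hp) v).of_le
      (by norm_cast; exact le_top)) hbp) hXp
  refine (((e.contMDiffAt_iff (e.mem_source.2 (hb p hp))).1 h1).2.congr_of_eventuallyEq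
    ?_).contMDiffWithinAt
  filter_upwards [hs.mem_nhds hp] with q hq
  rw [connForm_apply, e.linearMapAt_apply, if_pos (hb q hq)]

theorem contMDiffOn_curveVelocity {m n : ℕ∞ω} (hmn : m + 1 ≤ n) [IsManifold I n M]
    {γ : ℝ → M} {J : Set ℝ} (hJ : IsOpen J)
    (hγ : ContMDiffOn 𝓘(ℝ, ℝ) I n γ J) :
    ContMDiffOn 𝓘(ℝ, ℝ) (I.prod 𝓘(ℝ, EB)) m
      (fun t ↦ (⟨γ t, curveVelocity I γ t⟩ : TangentBundle I M)) J := by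
  have h1 := hγ.contMDiffOn_tangentMapWithin (m := m) hmn hJ.uniqueMDiffOn
  have h2 : ContMDiff 𝓘(ℝ, ℝ) (𝓘(ℝ, ℝ).prod 𝓘(ℝ, ℝ)) m
      (fun t : ℝ ↦ (⟨t, (1 : ℝ)⟩ : TangentBundle 𝓘(ℝ, ℝ) ℝ)) :=
    contMDiff_vectorSpace_iff_contDiff.2 contDiff_const
  refine (h1.comp h2.contMDiffOn fun t ht ↦ ht).congr fun t ht ↦ ?_
  simp only [Function.comp, tangentMapWithin, curveVelocity]
  rw [mfderivWithin_of_isOpen hJ ht]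

/-- In coordinates `w' + Γ(γ') w` is `C^1` if the curve is `C^2`. This permits a second
differentiation of `⟨D_t c, c⟩`. -/
theorem mdifferentiableAt_covDerivAlong (hcov : cov.ContMDiffCovariantDerivative ∞)
    {S : ℝ → TotalSpace F V} {t : ℝ} (hS : ContMDiffAt 𝓘(ℝ, ℝ) (I.prod 𝓘(ℝ, F)) 2 S t) :
    MDifferentiableAt 𝓘(ℝ, ℝ) (I.prod 𝓘(ℝ, F))
      (fun s ↦ (⟨(S s).proj, covDerivAlong cov S s⟩ : TotalSpace F V)) t := by
  set e := trivializationAt F V (S t).proj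
  have he : (S t).proj ∈ e.baseSet := mem_baseSet_trivializationAt F V (S t).proj
  obtain ⟨J, hJ, hSJ⟩ := (contMDiffAt_iff_contMDiffOn_nhds (by simp)).1 hS
  obtain ⟨J₀, hJJ, hJo, htJ⟩ := mem_nhds_iff.1 hJ
  replace hSJ := hSJ.mono hJJ
  set γ : ℝ → M := fun s ↦ (S s).proj
  have hγ : ContMDiffOn 𝓘(ℝ, ℝ) I 2 γ J₀ := fun s hs ↦
    (contMDiffAt_totalSpace.1 (hSJ.contMDiffAt (hJo.mem_nhds hs))).1.contMDiffWithinAt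
  set J' := J₀ ∩ γ ⁻¹' e.baseSet
  have hJ' : IsOpen J' := hγ.continuousOn.isOpen_inter_preimage hJo e.open_baseSet
  have htJ' : t ∈ J' := ⟨htJ, he⟩
  have hA := contDiffOn_connForm (n := 1) e hcov (X := fun t ↦ curveVelocity I γ t) hJ'
    (fun t ht ↦ ht.2)
    ((contMDiffOn_curveVelocity (m := 1) (n := 2) (by norm_num) hJo hγ).mono inter_subset_left)
  have hw : ContDiffOn ℝ 2 (fun s ↦ (e (S s)).2) J' := by
    rw [← contMDiffOn_iff_contDiffOn]
    have hmaps : MapsTo S J' e.source := fun s hs ↦ e.mem_source.2 hs.2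
    exact ((e.contMDiffOn_iff hmaps).1 (hSJ.mono inter_subset_left)).2
  have hw' : ContDiffOn ℝ 1 (deriv fun s ↦ (e (S s)).2) J' :=
    hw.deriv_of_isOpen hJ' (by norm_num)
  have hsum := hw'.add (hA.clm_apply (hw.of_le (by norm_num)))
  refine (e.mdifferentiableAt_totalSpace_iff I
    (fun s ↦ (⟨(S s).proj, covDerivAlong cov S s⟩ : TotalSpace F V)) (e.mem_source.2 he)).2 ?_
  refine ⟨(hγ.contMDiffAt (hJo.mem_nhds htJ)).mdifferentiableAt (by simp), ?_⟩
  refine MDifferentiableAt.congr_of_eventuallyEq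
    ((hsum.contDiffAt (hJ'.mem_nhds htJ')).differentiableAt (by simp)).mdifferentiableAt ?_
  filter_upwards [hJ'.mem_nhds htJ'] with s hs
  rw [covDerivAlong_eq_symm e cov hs.2 ((hSJ.contMDiffAt (hJo.mem_nhds hs.1)).mdifferentiableAt
    (by simp)), e.apply_mk_symm hs.2]

/-- Parallel transport along a curve exists for a short time. -/
theorem exists_parallel (hcov : cov.ContMDiffCovariantDerivative ∞) {γ : ℝ → M} {J : Set ℝ}
    (hJ : IsOpen J) (h0 : (0 : ℝ) ∈ J) (hγ : ContMDiffOn 𝓘(ℝ, ℝ) I ∞ γ J) :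
    ∃ ε > 0, Ioo (-ε) ε ⊆ J ∧ ∃ P : ∀ t, V (γ 0) →ₗ[ℝ] V (γ t), (∀ v, P 0 v = v) ∧
      ∀ v, ContMDiffOn 𝓘(ℝ, ℝ) (I.prod 𝓘(ℝ, F)) ∞
          (fun t ↦ (⟨γ t, P t v⟩ : TotalSpace F V)) (Ioo (-ε) ε) ∧
        ∀ t ∈ Ioo (-ε) ε, covDerivAlong cov (fun s ↦ (⟨γ s, P s v⟩ : TotalSpace F V)) t = 0 := by
  set e := trivializationAt F V (γ 0)
  have he0 : γ 0 ∈ e.baseSet := mem_baseSet_trivializationAt F V (γ 0)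
  set J' := J ∩ γ ⁻¹' e.baseSet
  have hJ' : IsOpen J' := hγ.continuousOn.isOpen_inter_preimage hJ e.open_baseSet
  have hA := contDiffOn_connForm (n := ⊤) e hcov (X := fun t ↦ curveVelocity I γ t) hJ'
    (fun t ht ↦ ht.2) ((contMDiffOn_curveVelocity (m := ∞) (n := ∞) (by simp) hJ hγ).mono
      inter_subset_left)
  obtain ⟨ε, hε, hεJ, Φ, hΦ0, hΦs, hΦ⟩ := exists_fundamental_solution hJ' ⟨h0, he0⟩ hA
  -- Parallel transport is the fundamental solution of `w' = -Γ(γ') w`, read in the trivialization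
  -- at both ends.
  refine ⟨ε, hε, hεJ.trans inter_subset_left, fun t ↦
    ((e.symmL ℝ (γ t)).comp ((Φ t).comp (e.continuousLinearMapAt ℝ (γ 0)))).toLinearMap, ?_, ?_⟩
  · intro v
    have := e.symmL_continuousLinearMapAt (R := ℝ) he0 v
    simpa [hΦ0] using this
  intro v
  set w := e.continuousLinearMapAt ℝ (γ 0) v
  have hcoord (t) (ht : t ∈ Ioo (-ε) ε) :
      (e (⟨γ t, e.symmL ℝ (γ t) (Φ t w)⟩ : TotalSpace F V)).2 = Φ t w := by
    rw [e.symmL_apply (hεJ ht).2, e.apply_mk_symm (hεJ ht).2]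
  have hsm : ContMDiffOn 𝓘(ℝ, ℝ) (I.prod 𝓘(ℝ, F)) ∞
      (fun t ↦ (⟨γ t, e.symmL ℝ (γ t) (Φ t w)⟩ : TotalSpace F V)) (Ioo (-ε) ε) := by
    have hmaps : MapsTo (fun t ↦ (⟨γ t, e.symmL ℝ (γ t) (Φ t w)⟩ : TotalSpace F V)) (Ioo (-ε) ε)
      e.source := fun t ht ↦ e.mem_source.2 (hεJ ht).2
    rw [e.contMDiffOn_iff hmaps]
    refine ⟨hγ.mono (hεJ.trans inter_subset_left), ?_⟩
    exact (contMDiffOn_iff_contDiffOn.2 (hΦs.clm_apply contDiffOn_const)).congr hcoord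
  refine ⟨hsm, fun t ht ↦ ?_⟩
  have hnear : Ioo (-ε) ε ∈ 𝓝 t := isOpen_Ioo.mem_nhds ht
  have hd : deriv (fun s ↦ (e (⟨γ s, e.symmL ℝ (γ s) (Φ s w)⟩ : TotalSpace F V)).2) t =
      -(connForm e cov (γ t) (curveVelocity I γ t) (Φ t w)) := by
    rw [EventuallyEq.deriv_eq (f := fun s ↦ Φ s w) (by filter_upwards [hnear] using hcoord)]
    simpa using ((hΦ t ht).clm_apply (hasDerivAt_const t w)).deriv
  have h1 := covDerivAlong_eq_symm e cov (S := fun t ↦ ⟨γ t, e.symmL ℝ (γ t) (Φ t w)⟩)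
    (t := t) (hεJ ht).2 ((hsm.contMDiffAt hnear).mdifferentiableAt (by simp))
  refine h1.trans ?_
  simp only [hd, hcoord t ht]
  rw [neg_add_cancel, ← e.symmL_apply (R := ℝ) (hεJ ht).2, map_zero]

end ParallelTransport

/-! ### Gaussian curvature in Euclidean spaces: uniqueness, isometries, spheres -/

section Euclidean

variable {W : Type*} [NormedAddCommGroup W] [InnerProductSpace ℝ W] [FiniteDimensional ℝ W]

/-- The determinant of the compression of `L` to the orthogonal complement of `n`. -/
noncomputable def compressionDet (n : W) (L : W →L[ℝ] W) : ℝ :=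
  LinearMap.det (((ℝ ∙ n)ᗮ.orthogonalProjectionOnto ∘L L ∘L (ℝ ∙ n)ᗮ.subtypeL :
      (ℝ ∙ n)ᗮ →L[ℝ] (ℝ ∙ n)ᗮ) : (ℝ ∙ n)ᗮ →ₗ[ℝ] (ℝ ∙ n)ᗮ)

/-- A positive function, smooth away from the origin and positively homogeneous of degree one. -/
structure IsRadialGauge (ρ : W → ℝ) : Prop where
  contDiffOn : ContDiffOn ℝ ∞ ρ {0}ᶜ
  pos : ∀ w, w ≠ 0 → 0 < ρ w
  smul : ∀ (t : ℝ) (w : W), 0 < t → w ≠ 0 → ρ (t • w) = t * ρ w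

/-- By homogeneity, dividing the line `q + t v` by its gauge brings it back to the level set. Its
velocity becomes the projection of `v` along the radial direction. These curves suffice to determine
the normal. -/
theorem IsRadialGauge.sub_mem_tangentVectors {ρ : W → ℝ} (hρ : IsRadialGauge ρ) {q : W}
    (hq : q ≠ 0) (hq1 : ρ q = 1) (v : W) :
    v - fderiv ℝ ρ q v • q ∈ tangentVectors {w | w ≠ 0 ∧ ρ w = 1} q := by
  have hρq : ContDiffAt ℝ ∞ ρ q := hρ.contDiffOn.contDiffAt (isOpen_ne.mem_nhds hq)
  have hline : ContDiff ℝ ∞ fun t : ℝ ↦ q + t • v :=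
    contDiff_const.add (contDiff_id.smul contDiff_const)
  have hρl : ContDiffAt ℝ ∞ (fun t : ℝ ↦ ρ (q + t • v)) 0 :=
    ContDiffAt.comp (g := ρ) 0 (by simpa using hρq) hline.contDiffAt
  refine ⟨fun t ↦ (ρ (q + t • v))⁻¹ • (q + t • v), ?_, ?_, by simp [hq1], ?_⟩
  · exact (hρl.inv (by simp [hq1])).smul hline.contDiffAt
  · have : ∀ᶠ t : ℝ in 𝓝 0, q + t • v ≠ 0 :=
      hline.continuous.continuousAt.eventually_ne (by simpa using hq)
    filter_upwards [this] with t ht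
    have hp := hρ.pos _ ht
    exact ⟨smul_ne_zero (inv_ne_zero hp.ne') ht,
      by rw [hρ.smul _ _ (inv_pos.2 hp) ht, inv_mul_cancel₀ hp.ne']⟩
  · have h1 : HasDerivAt (fun t : ℝ ↦ q + t • v) v 0 := by
      simpa using ((hasDerivAt_id' (0 : ℝ)).smul_const v).const_add q
    have h2 : HasDerivAt (fun t : ℝ ↦ ρ (q + t • v)) (fderiv ℝ ρ q v) 0 := by
      have := (hρq.differentiableAt (by simp)).hasFDerivAt
      exact HasFDerivAt.comp_hasDerivAt (l := ρ) (0 : ℝ) (by simpa using this) h1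
    have h3 := ((h2.fun_inv (by simp [hq1])).smul h1).deriv
    refine h3.trans ?_
    simp [hq1, sub_eq_add_neg]

/-- The Gaussian curvature of a smooth radial graph is unique. -/
theorem IsRadialGauge.gaussianCurvature_unique {ρ : W → ℝ} (hρ : IsRadialGauge ρ) {p : W}
    (hp : p ≠ 0) (hp1 : ρ p = 1) {κ₁ κ₂ : ℝ}
    (h₁ : HasGaussianCurvatureAt {w | w ≠ 0 ∧ ρ w = 1} p κ₁)
    (h₂ : HasGaussianCurvatureAt {w | w ≠ 0 ∧ ρ w = 1} p κ₂) : κ₁ = κ₂ := by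
  obtain ⟨N₁, hN₁, hS₁, hpos₁, hdet₁⟩ := h₁
  obtain ⟨N₂, hN₂, hS₂, hpos₂, hdet₂⟩ := h₂
  have hev (N : W → W) (hN : ContDiffAt ℝ ∞ N p) (hpos : 0 < inner ℝ (N p) p) :
      ∀ᶠ q in 𝓝 p, 0 < inner ℝ (N q) q :=
    (hN.continuousAt.inner (𝕜 := ℝ) continuousAt_id).eventually (lt_mem_nhds hpos)
  -- A vector normal to the level set is the multiple of the gradient of `ρ` by its scalar product
  -- with `q`.
  have hgrad (N : W → W) (q : W) (hq : q ≠ 0) (hq1 : ρ q = 1)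
      (hN : ∀ v ∈ tangentVectors {w | w ≠ 0 ∧ ρ w = 1} q, inner ℝ (N q) v = 0) (v : W) :
      inner ℝ (N q) v = fderiv ℝ ρ q v * inner ℝ (N q) q := by
    have := hN _ (hρ.sub_mem_tangentVectors hq hq1 v)
    rw [inner_sub_right, inner_smul_right] at this
    linarith
  have hEq : ∀ᶠ q in 𝓝 p, q ≠ 0 ∧ ρ q = 1 → N₁ q = N₂ q := by
    filter_upwards [hS₁, hS₂, hev N₁ hN₁ hpos₁, hev N₂ hN₂ hpos₂] with q h1 h2 p1 p2 hq
    obtain ⟨hn1, ht1⟩ := h1 hq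
    obtain ⟨hn2, ht2⟩ := h2 hq
    have key : (inner ℝ (N₂ q) q) • N₁ q = (inner ℝ (N₁ q) q) • N₂ q := by
      refine ext_inner_right ℝ fun v ↦ ?_
      rw [real_inner_smul_left, real_inner_smul_left, hgrad N₁ q hq.1 hq.2 ht1 v,
        hgrad N₂ q hq.1 hq.2 ht2 v]
      ring
    have hnorm := congrArg norm key
    rw [norm_smul, norm_smul, hn1, hn2, mul_one, mul_one, Real.norm_of_nonneg p2.le,
      Real.norm_of_nonneg p1.le] at hnorm
    rw [hnorm] at key
    exact smul_right_injective W p1.ne' key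
  have hNp : N₁ p = N₂ p := hEq.self_of_nhds ⟨hp, hp1⟩
  obtain ⟨-, ht1⟩ := hS₁.self_of_nhds ⟨hp, hp1⟩
  -- `N₁` and `N₂` are only known to agree on the level set, so their derivatives are compared along
  -- curves in it. Tangent directions are all that the compressed determinant sees.
  have hder (v : W) (hv : inner ℝ (N₁ p) v = 0) : fderiv ℝ N₁ p v = fderiv ℝ N₂ p v := by
    have h0 : fderiv ℝ ρ p v = 0 := by
      have := hgrad N₁ p hp hp1 ht1 v
      rw [hv] at this
      exact (mul_eq_zero.1 this.symm).resolve_right hpos₁.ne'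
    obtain ⟨c, hc, hcS, hc0, hcv⟩ := hρ.sub_mem_tangentVectors hp hp1 v
    simp only [h0, zero_smul, sub_zero] at hcv
    have hcd : HasDerivAt c v 0 := hcv ▸ (hc.differentiableAt (by simp)).hasDerivAt
    have hcomp (N : W → W) (hN : ContDiffAt ℝ ∞ N p) :
        HasDerivAt (fun t ↦ N (c t)) (fderiv ℝ N p v) 0 := by
      have := (hN.differentiableAt (by simp)).hasFDerivAt
      exact HasFDerivAt.comp_hasDerivAt (l := N) (0 : ℝ) (by rwa [hc0]) hcd
    refine (hcomp N₁ hN₁).unique ((hcomp N₂ hN₂).congr_of_eventuallyEq ?_)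
    have hct : Tendsto c (𝓝 0) (𝓝 p) := hc0 ▸ hc.continuousAt
    filter_upwards [hct.eventually hEq, hcS] with t h1 h2 using h1 h2
  change compressionDet (N₁ p) (fderiv ℝ N₁ p) = κ₁ at hdet₁
  change compressionDet (N₂ p) (fderiv ℝ N₂ p) = κ₂ at hdet₂
  rw [← hdet₁, ← hdet₂, ← hNp]
  unfold compressionDet
  congr 1
  ext v
  have hv : inner ℝ (N₁ p) (v : W) = 0 := Submodule.mem_orthogonal_singleton_iff_inner_right.1 v.2
  simp [hder v hv]

variable {W' : Type*} [NormedAddCommGroup W'] [InnerProductSpace ℝ W'] [FiniteDimensional ℝ W']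

/-- `Φ` restricts to an isomorphism from the complement of `n` to that of `Φ n`, and this conjugates
the two compressions. The identity is tested against vectors of the complement, where the orthogonal
projection drops out of the inner product. -/
theorem compressionDet_conj (Φ : W ≃ₗᵢ[ℝ] W') (n : W) (L : W →L[ℝ] W) (L' : W' →L[ℝ] W')
    (hL : ∀ v, L' (Φ v) = Φ (L v)) : compressionDet (Φ n) L' = compressionDet n L := by
  have hmap : (ℝ ∙ Φ n)ᗮ = (ℝ ∙ n)ᗮ.map (Φ.toLinearEquiv : W →ₗ[ℝ] W') := by
    ext w
    rw [Submodule.mem_orthogonal_singleton_iff_inner_right, Submodule.mem_map]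
    constructor
    · intro h
      refine ⟨Φ.symm w, ?_, by simp⟩
      rw [Submodule.mem_orthogonal_singleton_iff_inner_right, ← Φ.inner_map_map]
      simpa using h
    · rintro ⟨v, hv, rfl⟩
      rw [Submodule.mem_orthogonal_singleton_iff_inner_right] at hv
      simpa using hv
  let ψ : (ℝ ∙ n)ᗮ ≃ₗ[ℝ] (ℝ ∙ Φ n)ᗮ := Φ.toLinearEquiv.ofSubmodules _ _ hmap.symm
  rw [compressionDet, compressionDet, ← LinearMap.det_conj _ ψ]
  congr 1
  refine LinearMap.ext fun w ↦ ?_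
  obtain ⟨v, rfl⟩ := ψ.surjective w
  have hψ (v : (ℝ ∙ n)ᗮ) : (ψ v : W') = Φ v := rfl
  refine ext_inner_right ℝ fun z ↦ ?_
  obtain ⟨y, rfl⟩ := ψ.surjective z
  simp only [LinearMap.comp_apply, LinearEquiv.coe_coe, LinearEquiv.symm_apply_apply,
    ContinuousLinearMap.coe_coe, ContinuousLinearMap.comp_apply, Submodule.subtypeL_apply]
  have h1 := Submodule.inner_orthogonalProjectionOnto_eq_of_mem_right (K := (ℝ ∙ n)ᗮ) y (L v)
  have h2 := Submodule.inner_orthogonalProjectionOnto_eq_of_mem_right (K := (ℝ ∙ Φ n)ᗮ) (ψ y)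
    (L' (ψ v))
  have h3 (a : (ℝ ∙ n)ᗮ) : inner ℝ (ψ a) (ψ y) = inner ℝ a y := Φ.inner_map_map _ _
  rw [h3]
  refine h2.trans (Eq.trans ?_ h1.symm)
  rw [hψ, hψ, hL, Φ.inner_map_map]

/-- Gaussian curvature is invariant under linear isometries. -/
theorem HasGaussianCurvatureAt.map {S : Set W} {p : W} {κ : ℝ}
    (h : HasGaussianCurvatureAt S p κ) (Φ : W ≃ₗᵢ[ℝ] W') :
    HasGaussianCurvatureAt (Φ.symm ⁻¹' S) (Φ p) κ := by
  obtain ⟨N, hN, hS, hpos, hdet⟩ := h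
  have hΦ : ContDiff ℝ ∞ Φ := Φ.toContinuousLinearEquiv.contDiff
  have hΦs : ContDiff ℝ ∞ Φ.symm := Φ.symm.toContinuousLinearEquiv.contDiff
  have hsp : Φ.symm (Φ p) = p := Φ.symm_apply_apply p
  refine ⟨fun q ↦ Φ (N (Φ.symm q)), ?_, ?_, ?_, ?_⟩
  · exact hΦ.contDiffAt.comp _ (ContDiffAt.comp _ (by rwa [hsp]) hΦs.contDiffAt)
  · have : Tendsto Φ.symm (𝓝 (Φ p)) (𝓝 p) := by
      simpa [hsp] using Φ.symm.continuous.tendsto (Φ p)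
    filter_upwards [this.eventually hS] with q hq hqS
    obtain ⟨h1, h2⟩ := hq hqS
    refine ⟨by simpa using h1, ?_⟩
    rintro v ⟨c, hc, hcS, hc0, hcv⟩
    have hd : HasDerivAt (fun t ↦ Φ.symm (c t)) (Φ.symm v) 0 :=
      Φ.symm.toContinuousLinearEquiv.hasFDerivAt.comp_hasDerivAt 0
        (hcv ▸ (hc.differentiableAt (by simp)).hasDerivAt)
    have h3 := h2 (Φ.symm v) ⟨fun t ↦ Φ.symm (c t), hΦs.contDiffAt.comp _ hc, hcS,
      by simp [hc0], hd.deriv⟩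
    rw [← Φ.inner_map_map] at h3
    simpa using h3
  · simpa [hsp] using hpos
  · change compressionDet (N p) (fderiv ℝ N p) = κ at hdet
    change compressionDet (Φ (N (Φ.symm (Φ p)))) (fderiv ℝ (fun q ↦ Φ (N (Φ.symm q))) (Φ p)) = κ
    rw [hsp, ← hdet]
    refine compressionDet_conj Φ _ _ _ fun v ↦ ?_
    have hNd : HasFDerivAt N (fderiv ℝ N p) (Φ.symm (Φ p)) := by
      rw [hsp]; exact (hN.differentiableAt (by simp)).hasFDerivAt
    have := (Φ.toContinuousLinearEquiv.hasFDerivAt.comp (Φ p)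
      (hNd.comp (Φ p) Φ.symm.toContinuousLinearEquiv.hasFDerivAt)).fderiv
    have h2 := congrArg (fun T : W' →L[ℝ] W' ↦ T (Φ v)) this
    refine Eq.trans h2 ?_
    simp

/-- Gaussian curvature of a round sphere centred at the origin. -/
theorem hasGaussianCurvatureAt_sphere {r : ℝ} (hr : 0 < r) {p : W} (hp : ‖p‖ = r) {m : ℕ}
    (hm : Module.finrank ℝ W = m + 1) :
    HasGaussianCurvatureAt {w : W | ‖w‖ = r} p ((r⁻¹) ^ m) := by
  have hp0 : p ≠ 0 := by rintro rfl; simp at hp; exact hr.ne hp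
  have hsq (q v : W) (hq : ‖q‖ = r) (hv : v ∈ tangentVectors {w : W | ‖w‖ = r} q) :
      inner ℝ q v = 0 := by
    obtain ⟨c, hc, hcS, hc0, rfl⟩ := hv
    have hcd := (hc.differentiableAt (by simp)).hasDerivAt
    have h1 := hcd.inner ℝ hcd
    have h2 : HasDerivAt (fun t ↦ inner ℝ (c t) (c t)) 0 0 := by
      refine (hasDerivAt_const (0 : ℝ) (r ^ 2)).congr_of_eventuallyEq ?_
      filter_upwards [hcS] with t ht
      rw [real_inner_self_eq_norm_sq, ht]
    have h3 := h1.unique h2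
    rw [hc0, real_inner_comm q] at h3
    linarith
  have hNs : ContDiffAt ℝ ∞ (fun q : W ↦ ‖q‖⁻¹ • q) p :=
    ((contDiffAt_norm ℝ hp0).inv (norm_ne_zero_iff.2 hp0)).smul contDiffAt_id
  refine ⟨fun q ↦ ‖q‖⁻¹ • q, hNs, Eventually.of_forall fun q hq ↦ ⟨?_, fun v hv ↦ ?_⟩, ?_, ?_⟩
  · rw [norm_smul, norm_inv, norm_norm, show ‖q‖ = r from hq, inv_mul_cancel₀ hr.ne']
  · rw [real_inner_smul_left, hsq q v hq hv, mul_zero]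
  · rw [real_inner_smul_left, real_inner_self_eq_norm_sq, hp]; positivity
  · set n := ‖p‖⁻¹ • p
    have hn : n ≠ 0 := smul_ne_zero (inv_ne_zero (norm_ne_zero_iff.2 hp0)) hp0
    change compressionDet n (fderiv ℝ (fun q : W ↦ ‖q‖⁻¹ • q) p) = _
    -- The norm is stationary at `p` in directions orthogonal to `p` (`h0`), so the derivative of `q
    -- ↦ q / ‖q‖` is `r⁻¹` times the identity there.
    have hop : ((ℝ ∙ n)ᗮ.orthogonalProjectionOnto ∘L (fderiv ℝ (fun q : W ↦ ‖q‖⁻¹ • q) p) ∘L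
        (ℝ ∙ n)ᗮ.subtypeL : (ℝ ∙ n)ᗮ →L[ℝ] (ℝ ∙ n)ᗮ) = r⁻¹ • ContinuousLinearMap.id ℝ _ := by
      ext v
      have hv : inner ℝ p (v : W) = 0 := by
        have := Submodule.mem_orthogonal_singleton_iff_inner_right.1 v.2
        rw [real_inner_smul_left] at this
        exact (mul_eq_zero.1 this).resolve_left (inv_ne_zero (norm_ne_zero_iff.2 hp0))
      have hnorm : HasFDerivAt (fun q : W ↦ ‖q‖⁻¹) (fderiv ℝ (fun q : W ↦ ‖q‖⁻¹) p) p :=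
        (((contDiffAt_norm ℝ hp0 (n := ∞)).inv (norm_ne_zero_iff.2 hp0)).differentiableAt
          (by simp)).hasFDerivAt
      have h0 : fderiv ℝ (fun q : W ↦ ‖q‖⁻¹) p v = 0 := by
        have hline : HasDerivAt (fun t : ℝ ↦ p + t • (v : W)) v 0 := by
          simpa using ((hasDerivAt_id' (0 : ℝ)).smul_const (v : W)).const_add p
        have h1 : HasDerivAt (fun t : ℝ ↦ ‖p + t • (v : W)‖⁻¹)
            (fderiv ℝ (fun q : W ↦ ‖q‖⁻¹) p v) 0 :=
          HasFDerivAt.comp_hasDerivAt (l := fun q : W ↦ ‖q‖⁻¹) (0 : ℝ) (by simpa using hnorm) hline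
        have h2 : HasDerivAt (fun t : ℝ ↦ ‖p + t • (v : W)‖ ^ 2) 0 0 := by
          have := hline.inner ℝ hline
          simp only [real_inner_self_eq_norm_sq] at this
          simpa [hv, real_inner_comm] using this
        have h3 : HasDerivAt (fun t : ℝ ↦ (√(‖p + t • (v : W)‖ ^ 2))⁻¹) 0 0 := by
          simpa using (h2.sqrt (by simpa using hp0)).fun_inv (by simpa using hp0)
        simp only [Real.sqrt_sq (norm_nonneg _)] at h3
        exact h1.unique h3
      have h4 := (hnorm.smul (hasFDerivAt_id p)).fderiv
      have h5 : fderiv ℝ (fun q : W ↦ ‖q‖⁻¹ • q) p v = r⁻¹ • (v : W) := by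
        have := congrArg (fun T : W →L[ℝ] W ↦ T (v : W)) h4
        refine Eq.trans this ?_
        simp [h0, hp]
      simp [h5]
    rw [compressionDet, hop]
    have : ((r⁻¹ • ContinuousLinearMap.id ℝ (ℝ ∙ n)ᗮ : (ℝ ∙ n)ᗮ →L[ℝ] (ℝ ∙ n)ᗮ) :
        (ℝ ∙ n)ᗮ →ₗ[ℝ] (ℝ ∙ n)ᗮ) = r⁻¹ • LinearMap.id := rfl
    have hfact : Fact (Module.finrank ℝ W = m + 1) := ⟨hm⟩
    rw [this, LinearMap.det_smul, LinearMap.det_id, mul_one,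
      Submodule.finrank_orthogonal_span_singleton (n := m) hn]

end Euclidean

/-! ### Fibres of radial graphs and assertion 1 -/

section RadialGraphs

variable
  {EB : Type*} [NormedAddCommGroup EB] [NormedSpace ℝ EB] [FiniteDimensional ℝ EB]
  {H : Type*} [TopologicalSpace H] {I : ModelWithCorners ℝ EB H}
  {M : Type*} [TopologicalSpace M] [ChartedSpace H M] [IsManifold I ∞ M]
  {F : Type*} [NormedAddCommGroup F] [NormedSpace ℝ F] [FiniteDimensional ℝ F]
  {V : M → Type*} [TopologicalSpace (TotalSpace F V)]
  [∀ x, NormedAddCommGroup (V x)] [∀ x, InnerProductSpace ℝ (V x)]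
  [FiberBundle F V] [VectorBundle ℝ F V] [ContMDiffVectorBundle ∞ F V I]

variable (F) in
theorem finrank_fibre (x : M) : FiniteDimensional ℝ (V x) ∧
    Module.finrank ℝ (V x) = Module.finrank ℝ F := by
  have L := ((trivializationAt F V x).continuousLinearEquivAt ℝ x
    (mem_baseSet_trivializationAt F V x)).toLinearEquiv
  exact ⟨L.symm.finiteDimensional, L.finrank_eq⟩

theorem contMDiff_fibre_inclusion (x : M) :
    ContMDiff 𝓘(ℝ, V x) (I.prod 𝓘(ℝ, F)) ∞ (fun w : V x ↦ (⟨x, w⟩ : TotalSpace F V)) := by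
  have hx := mem_baseSet_trivializationAt F V x
  set e := trivializationAt F V x
  have hsrc : ∀ w : V x, (⟨x, w⟩ : TotalSpace F V) ∈ e.source := fun w ↦ e.mem_source.2 hx
  rw [e.contMDiff_iff hsrc]
  refine ⟨contMDiff_const, ?_⟩
  refine (e.continuousLinearMapAt ℝ x).contMDiff.congr fun w ↦ ?_
  rw [e.continuousLinearMapAt_apply ℝ, e.linearMapAt_apply, if_pos hx]

variable [IsContMDiffRiemannianBundle I ∞ F V]

theorem contMDiff_normSq :
    ContMDiff (I.prod 𝓘(ℝ, F)) 𝓘(ℝ, ℝ) ∞ (fun η : TotalSpace F V ↦ inner ℝ η.2 η.2) :=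
  ContMDiff.inner_bundle (b := fun η : TotalSpace F V ↦ η.proj) contMDiff_id contMDiff_id

theorem isOpen_puncturedBundle (I : ModelWithCorners ℝ EB H) [IsManifold I ∞ M]
    [ContMDiffVectorBundle ∞ F V I] [IsContMDiffRiemannianBundle I ∞ F V] :
    IsOpen (puncturedBundle F V) := by
  have : puncturedBundle F V = {η : TotalSpace F V | inner ℝ η.2 η.2 ≠ 0} := by
    ext η; simp [puncturedBundle]
  rw [this]
  exact isOpen_ne.preimage (contMDiff_normSq (I := I)).continuous

/-- The equation of a radial graph on the fibres. -/
theorem mem_radialGraph_iff {u : TotalSpace F V → ℝ} (hu : IsRadiallyConstantSmooth I u)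
    (x : M) (w : V x) :
    (⟨x, w⟩ : TotalSpace F V) ∈ radialGraph u ↔ w ≠ 0 ∧ ‖w‖ = Real.exp (u ⟨x, w⟩) := by
  constructor
  · rintro ⟨⟨y, v⟩, hv, h⟩
    have hv' : ‖v‖ = 1 := hv
    have hv0 : v ≠ 0 := norm_ne_zero_iff.1 (by rw [hv']; exact one_ne_zero)
    simp only [TotalSpace.mk.injEq] at h
    obtain ⟨rfl, h⟩ := h
    simp only [heq_eq_eq] at h
    subst h
    refine ⟨smul_ne_zero (Real.exp_pos _).ne' hv0, ?_⟩
    rw [hu.radial y v _ hv0 (Real.exp_pos _), norm_smul, hv', mul_one, Real.norm_eq_abs,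
      abs_of_pos (Real.exp_pos _)]
  · rintro ⟨hw, h⟩
    have hpos : 0 < ‖w‖ := norm_pos_iff.2 hw
    refine ⟨⟨x, ‖w‖⁻¹ • w⟩, ?_, ?_⟩
    · change ‖‖w‖⁻¹ • w‖ = 1
      rw [norm_smul, norm_inv, norm_norm, inv_mul_cancel₀ hpos.ne']
    · simp only [hu.radial x w _ hw (inv_pos.2 hpos), ← h, smul_smul, mul_inv_cancel₀ hpos.ne',
        one_smul]

/-- This gauge has the fibre of the graph as its level set of value one (`fibre_radialGraph`), which
gives access to the uniqueness of Gaussian curvature. -/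
theorem isRadialGauge_fibre {u : TotalSpace F V → ℝ} (hu : IsRadiallyConstantSmooth I u) (x : M) :
    IsRadialGauge (fun w : V x ↦ ‖w‖ * Real.exp (-u ⟨x, w⟩)) where
  contDiffOn := by
    have h1 : ContDiffOn ℝ ∞ (fun w : V x ↦ u ⟨x, w⟩) {0}ᶜ := by
      rw [← contMDiffOn_iff_contDiffOn]
      exact hu.smooth.comp (contMDiff_fibre_inclusion x).contMDiffOn fun w hw ↦ hw
    have h2 : ContDiffOn ℝ ∞ (fun w : V x ↦ ‖w‖) {0}ᶜ := fun w hw ↦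
      (contDiffAt_norm ℝ hw).contDiffWithinAt
    exact h2.mul h1.neg.exp
  pos w hw := mul_pos (norm_pos_iff.2 hw) (Real.exp_pos _)
  smul t w ht hw := by
    rw [hu.radial x w t hw ht, norm_smul, Real.norm_of_nonneg ht.le, mul_assoc]

theorem fibre_radialGraph {u : TotalSpace F V → ℝ} (hu : IsRadiallyConstantSmooth I u) (x : M) :
    {w : V x | (⟨x, w⟩ : TotalSpace F V) ∈ radialGraph u} =
      {w | w ≠ 0 ∧ ‖w‖ * Real.exp (-u ⟨x, w⟩) = 1} := by
  ext w
  rw [mem_ofPred_eq, mem_radialGraph_iff hu, mem_ofPred_eq, Real.exp_neg,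
    mul_inv_eq_one₀ (Real.exp_pos _).ne']

/-- A positive function that is constant on fibres is the vertical Gaussian curvature of the
radial graph of `-log K / (m - 1)`. -/
theorem radialGraph_log {m : ℕ} (hm : 2 ≤ m) (hF : Module.finrank ℝ F = m)
    {K : TotalSpace F V → ℝ}
    (hK_smooth : ContMDiffOn (I.prod 𝓘(ℝ, F)) 𝓘(ℝ, ℝ) ∞ K (puncturedBundle F V))
    (hK_pos : ∀ η ∈ puncturedBundle F V, 0 < K η)
    (hK_fibre : ∀ (x : M) (v w : V x), v ≠ 0 → w ≠ 0 → K ⟨x, v⟩ = K ⟨x, w⟩) :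
    IsRadiallyConstantSmooth I (fun η ↦ -Real.log (K η) / ((m : ℝ) - 1)) ∧
      HasVerticalGaussianCurvature
        (radialGraph (fun η ↦ -Real.log (K η) / ((m : ℝ) - 1))) K := by
  have hu : IsRadiallyConstantSmooth I (fun η ↦ -Real.log (K η) / ((m : ℝ) - 1)) := by
    refine ⟨fun η hη ↦ ?_, fun x v t hv ht ↦ ?_⟩
    · have hKη := hK_smooth.contMDiffAt ((isOpen_puncturedBundle I).mem_nhds hη)
      have hg : ContDiffAt ℝ ∞ (fun a : ℝ ↦ -Real.log a / ((m : ℝ) - 1)) (K η) :=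
        ((contDiffAt_id.log (hK_pos η hη).ne').neg).div_const _
      exact (ContMDiffAt.comp η hg.contMDiffAt hKη).contMDiffWithinAt
    · simp only [hK_fibre x (t • v) v (smul_ne_zero ht.ne' hv) hv]
  refine ⟨hu, fun η hη ↦ ?_⟩
  obtain ⟨x, p⟩ := η
  obtain ⟨hp, hnorm⟩ := (mem_radialGraph_iff hu x p).1 hη
  have hm1 : (0 : ℝ) < (m : ℝ) - 1 := by
    have : (2 : ℝ) ≤ m := by exact_mod_cast hm
    linarith
  -- `K` is constant on the fibre, so the fibre of the graph is the round sphere through `p`.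
  have hS : {w : V x | (⟨x, w⟩ : TotalSpace F V) ∈
      radialGraph (fun η ↦ -Real.log (K η) / ((m : ℝ) - 1))} = {w | ‖w‖ = ‖p‖} := by
    ext w
    rw [mem_ofPred_eq, mem_radialGraph_iff hu, mem_ofPred_eq]
    constructor
    · rintro ⟨hw, h⟩
      rw [h, hnorm, hK_fibre x w p hw hp]
    · intro h
      have hw : w ≠ 0 := norm_pos_iff.1 (h ▸ norm_pos_iff.2 hp)
      exact ⟨hw, by rw [h, hnorm, hK_fibre x w p hw hp]⟩
  obtain ⟨hfd, hrank⟩ := finrank_fibre F (V := V) x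
  -- The exponent in the curvature of the sphere is its dimension `k = m - 1`, the denominator in
  -- the definition of `u`.
  obtain ⟨k, rfl⟩ : ∃ k, m = k + 1 := ⟨m - 1, by omega⟩
  have := hasGaussianCurvatureAt_sphere (norm_pos_iff.2 hp) (p := p) rfl (hrank.trans hF)
  change HasGaussianCurvatureAt {w : V x | (⟨x, w⟩ : TotalSpace F V) ∈ _} p (K ⟨x, p⟩)
  rw [hS]
  convert this using 1
  have hKp := hK_pos ⟨x, p⟩ hp
  push_cast at hm1 hnorm
  rw [add_sub_cancel_right] at hm1 hnorm
  rw [hnorm, ← Real.exp_neg, ← Real.exp_nat_mul]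
  rw [show (k : ℝ) * -(-Real.log (K ⟨x, p⟩) / k) = Real.log (K ⟨x, p⟩) by field_simp,
    Real.exp_log hKp]

end RadialGraphs

/-! ### The splitting of `TE` and horizontal lifts -/

section Splitting

variable
  {EB : Type*} [NormedAddCommGroup EB] [NormedSpace ℝ EB] [FiniteDimensional ℝ EB]
  {H : Type*} [TopologicalSpace H] {I : ModelWithCorners ℝ EB H}
  {M : Type*} [TopologicalSpace M] [ChartedSpace H M] [IsManifold I ∞ M]
  {F : Type*} [NormedAddCommGroup F] [NormedSpace ℝ F] [FiniteDimensional ℝ F]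
  {V : M → Type*} [TopologicalSpace (TotalSpace F V)]
  [∀ x, NormedAddCommGroup (V x)] [∀ x, InnerProductSpace ℝ (V x)]
  [FiberBundle F V] [VectorBundle ℝ F V] [ContMDiffVectorBundle ∞ F V I]
  (D : CovariantDerivative I F V)

theorem connector_eq_symmL (ξ : TotalSpace F V) (A : TangentSpace (I.prod 𝓘(ℝ, F)) ξ) :
    connector D ξ A = (trivializationAt F V ξ.proj).symmL ℝ ξ.proj (mvfderiv (I.prod 𝓘(ℝ, F))
        (fun η : TotalSpace F V ↦ ((trivializationAt F V ξ.proj) η).2) ξ A) +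
      D (fun y ↦ (trivializationAt F V ξ.proj).symm y ((trivializationAt F V ξ.proj) ξ).2) ξ.proj
        (mfderiv (I.prod 𝓘(ℝ, F)) I (fun η : TotalSpace F V ↦ η.proj) ξ A) := by
  have h := mem_baseSet_trivializationAt F V ξ.proj
  rw [Trivialization.symmL_apply _ h]
  exact connector_eq _ D ξ h A

/-- The identification `A ↦ (π_* A, connector A)` of `T_ξ E` with `T_x M ⊕ E_x`. -/
noncomputable def splitTangent (ξ : TotalSpace F V) :
    TangentSpace (I.prod 𝓘(ℝ, F)) ξ →ₗ[ℝ] TangentSpace I ξ.proj × V ξ.proj where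
  toFun A := (horPart ξ A, connector D ξ A)
  map_add' A B := by
    simp only [horPart, connector_eq_symmL, map_add, Prod.mk_add_mk]
    congr 1
    abel
  map_smul' a A := by
    simp only [horPart, connector_eq_symmL, map_smul, smul_add, RingHom.id_apply, Prod.smul_mk]

theorem splitTangent_apply (ξ : TotalSpace F V) (A : TangentSpace (I.prod 𝓘(ℝ, F)) ξ) :
    splitTangent D ξ A = (horPart ξ A, connector D ξ A) := rfl

/-- If the horizontal part vanishes, so does the connection term of the connector. What is left is
the derivative of the fibre coordinate, so both components of the derivative of the trivialization
vanish on `A`, and the trivialization has a differentiable local inverse. -/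
theorem splitTangent_injective (ξ : TotalSpace F V) :
    Function.Injective (splitTangent D ξ) := by
  rw [injective_iff_map_eq_zero]
  intro A hA
  set e := trivializationAt F V ξ.proj
  have hξ : ξ.proj ∈ e.baseSet := mem_baseSet_trivializationAt F V ξ.proj
  have hsrc := e.mem_source.2 hξ
  have hh : horPart ξ A = 0 := congrArg Prod.fst hA
  have hc : connector D ξ A = 0 := congrArg Prod.snd hA
  rw [horPart] at hh
  rw [connector_eq_symmL, hh, map_zero, add_zero] at hc
  have hs : mvfderiv (I.prod 𝓘(ℝ, F)) (fun η : TotalSpace F V ↦ (e η).2) ξ A = 0 := by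
    have h := congrArg (e.continuousLinearMapAt ℝ ξ.proj) hc
    rw [map_zero] at h
    exact (e.continuousLinearMapAt_symmL (R := ℝ) hξ _).symm.trans h
  have hproj : MDifferentiableAt (I.prod 𝓘(ℝ, F)) I (fun η : TotalSpace F V ↦ η.proj) ξ :=
    mdifferentiableAt_proj ..
  have he : MDifferentiableAt (I.prod 𝓘(ℝ, F)) 𝓘(ℝ, F) (fun η : TotalSpace F V ↦ (e η).2) ξ :=
    ((e.mdifferentiableAt_totalSpace_iff I (fun η ↦ η) hsrc).1 mdifferentiableAt_id).2
  have hpair : mfderiv (I.prod 𝓘(ℝ, F)) (I.prod 𝓘(ℝ, F))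
      (fun η : TotalSpace F V ↦ (η.proj, (e η).2)) ξ A = 0 := by
    rw [mfderiv_prodMk hproj he]
    exact Prod.ext hh hs
  have hsymm : MDifferentiableAt (I.prod 𝓘(ℝ, F)) (I.prod 𝓘(ℝ, F))
      (fun p : M × F ↦ (e.toOpenPartialHomeomorph.symm p : TotalSpace F V)) (ξ.proj, (e ξ).2) := by
    have := (e.contMDiffOn_symm (IB := I) (n := ∞))
    refine (this.contMDiffAt (e.open_target.mem_nhds ?_)).mdifferentiableAt (by simp)
    exact e.mem_target.2 hξ
  have hid : (fun η : TotalSpace F V ↦ e.toOpenPartialHomeomorph.symm (η.proj, (e η).2))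
      =ᶠ[𝓝 ξ] id := by
    filter_upwards [e.open_source.mem_nhds hsrc] with η hη
    have : (η.proj, (e η).2) = e η := Prod.ext (e.coe_fst hη).symm rfl
    rw [this]
    exact e.left_inv hη
  have h1 := mfderiv_comp_apply (f := fun η : TotalSpace F V ↦ (η.proj, (e η).2)) ξ hsymm
    (hproj.prodMk he) A
  rw [hpair, map_zero] at h1
  have h2 := hid.mfderiv_eq (I := I.prod 𝓘(ℝ, F)) (I' := I.prod 𝓘(ℝ, F))
  have h3 := congrArg (fun T ↦ T A) h2
  rw [mfderiv_id] at h3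
  exact h3.symm.trans h1

theorem splitTangent_bijective (ξ : TotalSpace F V) :
    Function.Bijective (splitTangent D ξ) := by
  obtain ⟨hfd, hrank⟩ := finrank_fibre F (V := V) ξ.proj
  have : FiniteDimensional ℝ (TangentSpace I ξ.proj) := inferInstanceAs (FiniteDimensional ℝ EB)
  have : FiniteDimensional ℝ (TangentSpace (I.prod 𝓘(ℝ, F)) ξ) :=
    inferInstanceAs (FiniteDimensional ℝ (EB × F))
  have h : Module.finrank ℝ (TangentSpace (I.prod 𝓘(ℝ, F)) ξ) =
      Module.finrank ℝ (TangentSpace I ξ.proj × V ξ.proj) := by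
    rw [Module.finrank_prod, hrank]
    exact Module.finrank_prod (R := ℝ) (M := EB) (M' := F)
  exact ⟨splitTangent_injective D ξ,
    (LinearMap.injective_iff_surjective_of_finrank_eq_finrank h).1 (splitTangent_injective D ξ)⟩

/-- The horizontal lift. -/
noncomputable def horLift (ξ : TotalSpace F V) (h : TangentSpace I ξ.proj) :
    TangentSpace (I.prod 𝓘(ℝ, F)) ξ :=
  (LinearEquiv.ofBijective _ (splitTangent_bijective D ξ)).symm (h, 0)

theorem horLift_smul (ξ : TotalSpace F V) (a : ℝ) (h : TangentSpace I ξ.proj) :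
    horLift D ξ (a • h) = a • horLift D ξ h := by
  rw [horLift, horLift, ← map_smul]
  simp

theorem eq_horLift {ξ : TotalSpace F V} {A : TangentSpace (I.prod 𝓘(ℝ, F)) ξ}
    {h : TangentSpace I ξ.proj} (hh : horPart ξ A = h) (hv : connector D ξ A = 0) :
    A = horLift D ξ h := by
  rw [horLift, LinearEquiv.eq_symm_apply, LinearEquiv.ofBijective_apply, splitTangent_apply, hh, hv]

theorem horPart_velocity {c : ℝ → TotalSpace F V} {t : ℝ}
    (hc : MDifferentiableAt 𝓘(ℝ, ℝ) (I.prod 𝓘(ℝ, F)) c t) :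
    horPart (c t) (velocity I c t) = curveVelocity I (fun s ↦ (c s).proj) t := by
  have hproj : MDifferentiableAt (I.prod 𝓘(ℝ, F)) I (fun η : TotalSpace F V ↦ η.proj) (c t) :=
    mdifferentiableAt_proj ..
  exact (mfderiv_comp_apply (f := c) (g := fun η : TotalSpace F V ↦ η.proj) t hproj hc _).symm

/-- Parallel sections are the horizontal curves: this is the link between parallel transport and
`horDeriv`. -/
theorem velocity_eq_horLift {c : ℝ → TotalSpace F V} {t : ℝ}
    (hc : MDifferentiableAt 𝓘(ℝ, ℝ) (I.prod 𝓘(ℝ, F)) c t) (h : covDerivAlong D c t = 0) :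
    velocity I c t = horLift D (c t) (curveVelocity I (fun s ↦ (c s).proj) t) :=
  eq_horLift D (horPart_velocity hc) h

theorem contMDiffAt_vertical {n : ℕ∞} {x : M} {c : ℝ → V x} {t : ℝ} (hc : ContDiffAt ℝ n c t) :
    ContMDiffAt 𝓘(ℝ, ℝ) (I.prod 𝓘(ℝ, F)) n (fun s ↦ (⟨x, c s⟩ : TotalSpace F V)) t :=
  ((contMDiff_fibre_inclusion x).of_le (by norm_cast; exact le_top) _).comp t hc.contMDiffAt

theorem covDerivAlong_vertical {x : M} {c : ℝ → V x} {t : ℝ} (hc : ContDiffAt ℝ 1 c t) :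
    covDerivAlong D (fun s ↦ (⟨x, c s⟩ : TotalSpace F V)) t = deriv c t := by
  have hx := mem_baseSet_trivializationAt F V x
  set e := trivializationAt F V x
  have h := covDerivAlong_eq e D (S := fun s ↦ (⟨x, c s⟩ : TotalSpace F V)) (t := t) hx
    ((contMDiffAt_vertical (n := 1) hc).mdifferentiableAt (by simp))
  refine h.trans ?_
  have h0 : curveVelocity I (fun _ : ℝ ↦ x) t = 0 := by
    rw [curveVelocity, mfderiv_const]; rfl
  have h1 : (fun s ↦ (e (⟨x, c s⟩ : TotalSpace F V)).2) =
      fun s ↦ e.continuousLinearMapAt ℝ x (c s) := by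
    ext s : 1
    rw [e.continuousLinearMapAt_apply ℝ, e.linearMapAt_apply, if_pos hx]
  have h2 : deriv (fun s ↦ e.continuousLinearMapAt ℝ x (c s)) t =
      e.continuousLinearMapAt ℝ x (deriv c t) :=
    ((e.continuousLinearMapAt ℝ x).hasFDerivAt.comp_hasDerivAt t
      (hc.differentiableAt (by simp)).hasDerivAt).deriv
  simp only [h0, h1, h2, map_zero, add_zero]
  rw [← e.symmL_apply (R := ℝ) hx, e.symmL_continuousLinearMapAt hx]

end Splitting

/-! ### Existence of outward unit normals -/

section Normal

variable
  {EB : Type*} [NormedAddCommGroup EB] [NormedSpace ℝ EB] [FiniteDimensional ℝ EB]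
  {H : Type*} [TopologicalSpace H] {I : ModelWithCorners ℝ EB H}
  {M : Type*} [TopologicalSpace M] [ChartedSpace H M] [IsManifold I ∞ M]
  [RiemannianBundle (fun x : M ↦ TangentSpace I x)]
  {F : Type*} [NormedAddCommGroup F] [NormedSpace ℝ F] [FiniteDimensional ℝ F]
  {V : M → Type*} [TopologicalSpace (TotalSpace F V)]
  [∀ x, NormedAddCommGroup (V x)] [∀ x, InnerProductSpace ℝ (V x)]
  [FiberBundle F V] [VectorBundle ℝ F V] [ContMDiffVectorBundle ∞ F V I]
  [IsContMDiffRiemannianBundle I ∞ F V]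
  (D : CovariantDerivative I F V)

/-- Every linear form on `T_ξ E` is represented by a vector, for the Sasaki metric. -/
theorem exists_sasakiMetric_eq (ξ : TotalSpace F V)
    (ℓ : TangentSpace (I.prod 𝓘(ℝ, F)) ξ →ₗ[ℝ] ℝ) :
    ∃ N, ∀ A, sasakiMetric D ξ N A = ℓ A := by
  obtain ⟨hfd, hrank⟩ := finrank_fibre F (V := V) ξ.proj
  have : FiniteDimensional ℝ (TangentSpace I ξ.proj) := inferInstanceAs (FiniteDimensional ℝ EB)
  set Ψ := LinearEquiv.ofBijective _ (splitTangent_bijective D ξ)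
  set ℓ₁ : TangentSpace I ξ.proj →ₗ[ℝ] ℝ := ℓ ∘ₗ Ψ.symm.toLinearMap ∘ₗ LinearMap.inl ℝ _ _
  set ℓ₂ : V ξ.proj →ₗ[ℝ] ℝ := ℓ ∘ₗ Ψ.symm.toLinearMap ∘ₗ LinearMap.inr ℝ _ _
  set a := (InnerProductSpace.toDual ℝ _).symm ℓ₁.toContinuousLinearMap
  set b := (InnerProductSpace.toDual ℝ _).symm ℓ₂.toContinuousLinearMap
  refine ⟨Ψ.symm (a, b), fun A ↦ ?_⟩
  have h1 : (horPart ξ (Ψ.symm (a, b)), connector D ξ (Ψ.symm (a, b))) = (a, b) :=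
    Ψ.apply_symm_apply (a, b)
  rw [Prod.mk.injEq] at h1
  rw [sasakiMetric, h1.1, h1.2, InnerProductSpace.toDual_symm_apply,
    InnerProductSpace.toDual_symm_apply]
  change ℓ (Ψ.symm (horPart ξ A, 0)) + ℓ (Ψ.symm (0, connector D ξ A)) = ℓ A
  rw [← map_add, ← map_add, Prod.mk_add_mk, add_zero, zero_add]
  exact congrArg ℓ (Ψ.symm_apply_apply A)

/-- A radial graph has an outward unit normal at each of its points. -/
theorem exists_isOutwardUnitNormal {u : TotalSpace F V → ℝ} (hu : IsRadiallyConstantSmooth I u)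
    {p : TotalSpace F V} (hp : p ∈ radialGraph u) :
    ∃ N, IsOutwardUnitNormal D (radialGraph u) p N := by
  obtain ⟨x, v⟩ := p
  obtain ⟨hv, hvu⟩ := (mem_radialGraph_iff hu x v).1 hp
  set p : TotalSpace F V := ⟨x, v⟩
  -- The graph lies in the level set `f = 1`, and the normal will be the normalized Sasaki gradient
  -- `N₀` of `f`.
  set f : TotalSpace F V → ℝ := fun η ↦ inner ℝ η.2 η.2 * Real.exp (-2 * u η)
  have hf : MDifferentiableAt (I.prod 𝓘(ℝ, F)) 𝓘(ℝ, ℝ) f p := by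
    have hup := hu.smooth.contMDiffAt
      ((isOpen_puncturedBundle I).mem_nhds (show p ∈ puncturedBundle F V from hv))
    have hg : ContDiff ℝ ∞ (fun a : ℝ ↦ Real.exp (-2 * a)) := by fun_prop
    have := (contMDiff_normSq (I := I) p).mul (hg.contMDiff.contMDiffAt.comp p hup)
    exact this.mdifferentiableAt (by simp)
  have hf1 (η : TotalSpace F V) (hη : η ∈ radialGraph u) : f η = 1 := by
    obtain ⟨y, w⟩ := η
    obtain ⟨-, hw⟩ := (mem_radialGraph_iff hu y w).1 hη
    simp only [f]
    rw [real_inner_self_eq_norm_sq, hw, ← Real.exp_nat_mul, ← Real.exp_add]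
    simp
  have hderiv (c : ℝ → TotalSpace F V) (hc : MDifferentiableAt 𝓘(ℝ, ℝ) (I.prod 𝓘(ℝ, F)) c 0) :
      ∀ q, c 0 = q → MDifferentiableAt (I.prod 𝓘(ℝ, F)) 𝓘(ℝ, ℝ) f q →
      HasDerivAt (fun s ↦ f (c s)) (mvfderiv (I.prod 𝓘(ℝ, F)) f (c 0) (velocity I c 0)) 0 := by
    rintro _ rfl hfq
    exact mvfderiv_curveVelocity hfq hc
  obtain ⟨N₀, hN₀⟩ := exists_sasakiMetric_eq D p (mvfderiv (I.prod 𝓘(ℝ, F)) f p).toLinearMap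
  -- The radial vertical vector at `p`. Along `(1 + s) v` one has `f = (1 + s)²`, with derivative
  -- `2` at zero; this shows that `N₀` is nonzero and points outward.
  have hrad : ∃ A : TangentSpace (I.prod 𝓘(ℝ, F)) p, horPart p A = 0 ∧ connector D p A = v ∧
      mvfderiv (I.prod 𝓘(ℝ, F)) f p A = 2 := by
    have hcd : ContDiff ℝ ∞ (fun s : ℝ ↦ (1 + s) • v) := by fun_prop
    have hc := contMDiffAt_vertical (I := I) (F := F) (n := ⊤) hcd.contDiffAt (t := 0)
    have hc' := hc.mdifferentiableAt (by simp)
    have hc0 : (⟨x, (1 + (0 : ℝ)) • v⟩ : TotalSpace F V) = p := by simp [p]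
    have h1 := horPart_velocity hc'
    have h2 := covDerivAlong_vertical D (F := F) (hcd.contDiffAt.of_le (by simp)) (t := 0)
    have h3 := hderiv _ hc' p hc0 hf
    have h4 : deriv (fun s : ℝ ↦ (1 + s) • v) 0 = v := by
      have : HasDerivAt (fun s : ℝ ↦ (1 + s) • v) ((1 : ℝ) • v) 0 :=
        ((hasDerivAt_id' (0 : ℝ)).const_add 1).smul_const v
      rw [this.deriv, one_smul]
    have h5 : HasDerivAt (fun s : ℝ ↦ f ⟨x, (1 + s) • v⟩) 2 0 := by
      have : HasDerivAt (fun s : ℝ ↦ (1 + s) ^ 2) 2 0 := by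
        have := ((hasDerivAt_id' (0 : ℝ)).const_add 1).fun_pow 2
        simpa using this
      refine this.congr_of_eventuallyEq ?_
      filter_upwards [isOpen_Ioi.mem_nhds (show (-1 : ℝ) < 0 by norm_num)] with s hs
      have hs' : 0 < 1 + s := by linarith [mem_Ioi.1 hs]
      have := hf1 p hp
      simp only [f, p] at this ⊢
      rw [hu.radial x v _ hv hs', inner_smul_left, inner_smul_right]
      simp only [conj_trivial]
      linear_combination (1 + s) ^ 2 * this
    have h0 : curveVelocity I (fun _ : ℝ ↦ x) (0 : ℝ) = 0 := by
      rw [curveVelocity, mfderiv_const]; rfl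
    -- The curve starts at `(1 + 0) • v`, which is not syntactically `v`. Generalizing the starting
    -- point transports the data without casts. The family `w` plays the same role for the value of
    -- the connector, with `Function.update 0 x v` as a family through `v`.
    have key : ∀ (c : ℝ → TotalSpace F V) (q : TotalSpace F V), c 0 = q →
        ∃ A : TangentSpace (I.prod 𝓘(ℝ, F)) q,
          (horPart (c 0) (velocity I c 0) = 0 → horPart q A = 0) ∧
          (∀ w : ∀ y, V y, connector D (c 0) (velocity I c 0) = w (c 0).proj →
            connector D q A = w q.proj) ∧
          mvfderiv (I.prod 𝓘(ℝ, F)) f q A =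
            mvfderiv (I.prod 𝓘(ℝ, F)) f (c 0) (velocity I c 0) := by
      rintro c _ rfl
      exact ⟨velocity I c 0, id, fun w h ↦ h, rfl⟩
    obtain ⟨A, hA1, hA2, hA3⟩ := key (fun s ↦ ⟨x, (1 + s) • v⟩) p hc0
    classical
    refine ⟨A, hA1 (h1.trans h0), ?_, hA3.trans (h3.unique h5)⟩
    have := hA2 (Function.update 0 x v) ?_
    · simpa [p] using this
    · refine (h2.trans h4).trans ?_
      simp
  obtain ⟨A, hA1, hA2, hA3⟩ := hrad
  have hNv : inner ℝ (connector D p N₀) v = 2 := by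
    have := hN₀ A
    rw [sasakiMetric, hA1, hA2, inner_zero_right, zero_add] at this
    exact this.trans hA3
  have hNN : 0 < sasakiMetric D p N₀ N₀ := by
    have h0 : connector D p N₀ ≠ 0 := by
      intro h; rw [h, inner_zero_left] at hNv; norm_num at hNv
    exact add_pos_of_nonneg_of_pos real_inner_self_nonneg (real_inner_self_pos.2 h0)
  set a := (Real.sqrt (sasakiMetric D p N₀ N₀))⁻¹
  have ha : 0 < a := inv_pos.2 (Real.sqrt_pos.2 hNN)
  have hh : horPart p (a • N₀) = a • horPart p N₀ :=
    congrArg Prod.fst (map_smul (splitTangent D p) a N₀)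
  have hc : connector D p (a • N₀) = a • connector D p N₀ :=
    congrArg Prod.snd (map_smul (splitTangent D p) a N₀)
  have hsm (B) : sasakiMetric D p (a • N₀) B = a * sasakiMetric D p N₀ B := by
    simp only [sasakiMetric, hh, hc, inner_smul_left, conj_trivial, mul_add]
  refine ⟨a • N₀, ?_, ?_, ?_⟩
  · have h1 : sasakiMetric D p (a • N₀) (a • N₀) = a * (a * sasakiMetric D p N₀ N₀) := by
      rw [hsm]
      simp only [sasakiMetric, hh, hc, inner_smul_right, mul_add]
    rw [h1]
    simp only [a]
    field_simp
    rw [Real.sq_sqrt hNN.le]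
  · intro B hB
    rw [hsm, hN₀]
    obtain ⟨c, hc, hcB⟩ := hB
    have key : ∀ (q : TangentBundle (I.prod 𝓘(ℝ, F)) (TotalSpace F V)),
        (⟨c 0, velocity I c 0⟩ : TangentBundle (I.prod 𝓘(ℝ, F)) (TotalSpace F V)) = q →
        MDifferentiableAt (I.prod 𝓘(ℝ, F)) 𝓘(ℝ, ℝ) f q.proj →
        mvfderiv (I.prod 𝓘(ℝ, F)) f q.proj q.2 = 0 := by
      rintro _ rfl hfq
      have h1 := hderiv c (hc.smooth.mdifferentiableAt (by simp)) _ rfl hfq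
      refine h1.unique ((hasDerivAt_const (0 : ℝ) (1 : ℝ)).congr_of_eventuallyEq ?_)
      filter_upwards [hc.mem] with s hs using hf1 _ hs
    have := key _ hcB hf
    exact mul_eq_zero_of_right _ this
  · rw [hc, inner_smul_left]
    exact mul_pos ha (by change 0 < inner ℝ (connector D p N₀) v; rw [hNv]; norm_num)

end Normal

/-! ### Curves in `M` with prescribed velocity and zero acceleration at one point -/

section Charts

variable
  {EB : Type*} [NormedAddCommGroup EB] [NormedSpace ℝ EB] [FiniteDimensional ℝ EB]
  {H : Type*} [TopologicalSpace H] {I : ModelWithCorners ℝ EB H}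
  {M : Type*} [TopologicalSpace M] [ChartedSpace H M] [IsManifold I ∞ M]

/-- The velocity of a curve in the chart at `x₀`. -/
theorem trivializationAt_curveVelocity {γ : ℝ → M} {t : ℝ} {x₀ : M}
    (hγ : MDifferentiableAt 𝓘(ℝ, ℝ) I γ t) (ht : γ t ∈ (chartAt H x₀).source) :
    (trivializationAt EB (TangentSpace I) x₀
      (⟨γ t, curveVelocity I γ t⟩ : TangentBundle I M)).2 =
      deriv (fun s ↦ extChartAt I x₀ (γ s)) t := by
  have hb : γ t ∈ (trivializationAt EB (TangentSpace I (M := M)) x₀).baseSet := ht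
  have h1 := mvfderiv_curveVelocity (mdifferentiableAt_extChartAt (I := I) ht) hγ
  rw [h1.deriv]
  have h2 := TangentBundle.continuousLinearMapAt_trivializationAt (I := I) ht
  have h3 := congrArg (fun T ↦ T (curveVelocity I γ t)) h2
  rw [← Trivialization.continuousLinearMapAt_apply_of_mem (R := ℝ) _ hb]
  exact h3

theorem contMDiffOn_extChartAt_symm_comp (x₀ : M) {N : Type*} [NormedAddCommGroup N]
    [NormedSpace ℝ N] {y : N → EB} {J : Set N}
    (hy : ContDiffOn ℝ ∞ y J) (hJ : MapsTo y J (extChartAt I x₀).target) :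
    ContMDiffOn 𝓘(ℝ, N) I ∞ (fun t ↦ (extChartAt I x₀).symm (y t)) J :=
  (contMDiffOn_extChartAt_symm x₀).comp hy.contMDiffOn hJ

variable [I.Boundaryless] [T2Space M]

/-- Every tangent vector is the velocity of a curve without acceleration at that point. -/
theorem exists_curve_covDerivAlong_eq_zero
    (LC : CovariantDerivative I EB (fun x : M ↦ TangentSpace I x)) (p : TangentBundle I M) :
    ∃ (γ : ℝ → M) (J : Set ℝ), IsOpen J ∧ 0 ∈ J ∧ ContMDiffOn 𝓘(ℝ, ℝ) I ∞ γ J ∧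
      (⟨γ 0, curveVelocity I γ 0⟩ : TangentBundle I M) = p ∧
      covDerivAlong LC (fun s ↦ (⟨γ s, curveVelocity I γ s⟩ : TangentBundle I M)) 0 = 0 := by
  obtain ⟨x, h⟩ := p
  set φ := extChartAt I x
  set e := trivializationAt EB (TangentSpace I (M := M)) x
  have hx : x ∈ e.baseSet := mem_baseSet_trivializationAt EB (TangentSpace I) x
  set k : EB := (e ⟨x, h⟩).2
  -- In the chart the curve is a parabola whose second derivative `a` cancels the connection term at
  -- time zero. Zero acceleration is needed at that instant only, so no geodesic equation is solved.
  set a : EB := -connForm e LC x h k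
  set y : ℝ → EB := fun t ↦ φ x + t • k + (t ^ 2 / 2) • a
  have hy : ContDiff ℝ ∞ y := by fun_prop
  have hy0 : y 0 = φ x := by simp [y]
  have hyd (t) : HasDerivAt y (k + t • a) t := by
    have h1 : HasDerivAt (fun t : ℝ ↦ t • k) ((1 : ℝ) • k) t := (hasDerivAt_id' t).smul_const k
    have h2 : HasDerivAt (fun t : ℝ ↦ (t ^ 2 / 2) • a) (t • a) t := by
      have := (((hasDerivAt_id' t).fun_pow 2).div_const 2).smul_const a
      simpa using this
    simpa using (h1.const_add (φ x)).fun_add h2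
  set J := y ⁻¹' φ.target
  have hJ : IsOpen J := (isOpen_extChartAt_target x).preimage hy.continuous
  have h0 : (0 : ℝ) ∈ J := by
    change y 0 ∈ φ.target
    rw [hy0]; exact mem_extChartAt_target x
  set γ : ℝ → M := fun t ↦ φ.symm (y t)
  have hγ : ContMDiffOn 𝓘(ℝ, ℝ) I ∞ γ J :=
    contMDiffOn_extChartAt_symm_comp x hy.contDiffOn fun t ht ↦ ht
  have hsrc (t) (ht : t ∈ J) : γ t ∈ (chartAt H x).source := by
    have := φ.map_target ht
    rwa [extChartAt_source] at this
  have hφγ (t) (ht : t ∈ J) : φ (γ t) = y t := φ.right_inv ht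
  have hvel (t) (ht : t ∈ J) :
      (e (⟨γ t, curveVelocity I γ t⟩ : TangentBundle I M)).2 = k + t • a := by
    rw [trivializationAt_curveVelocity ((hγ.contMDiffAt (hJ.mem_nhds ht)).mdifferentiableAt
      (by simp)) (hsrc t ht)]
    rw [EventuallyEq.deriv_eq (f := y) (by filter_upwards [hJ.mem_nhds ht] using hφγ)]
    exact (hyd t).deriv
  have hγ0 : γ 0 = x := by
    simp only [γ, hy0]; exact extChartAt_to_inv x
  have hstart : (⟨γ 0, curveVelocity I γ 0⟩ : TangentBundle I M) = ⟨x, h⟩ := by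
    have hmem : (⟨γ 0, curveVelocity I γ 0⟩ : TangentBundle I M) ∈ e.source :=
      e.mem_source.2 (hsrc 0 h0)
    have hmem' : (⟨x, h⟩ : TangentBundle I M) ∈ e.source := e.mem_source.2 hx
    refine e.injOn hmem hmem' (Prod.ext ?_ ?_)
    · exact (e.coe_fst hmem).trans (hγ0.trans (e.coe_fst hmem').symm)
    · exact (hvel 0 h0).trans (by simp [k])
  refine ⟨γ, J, hJ, h0, hγ, hstart, ?_⟩
  have hS := contMDiffOn_curveVelocity (m := ∞) (n := ∞) (by simp) hJ hγ
  have h1 := covDerivAlong_eq_symm e LC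
    (S := fun s ↦ (⟨γ s, curveVelocity I γ s⟩ : TangentBundle I M)) (t := 0) (hsrc 0 h0)
    ((hS.contMDiffAt (hJ.mem_nhds h0)).mdifferentiableAt (by simp))
  have h2 : deriv (fun s ↦ (e (⟨γ s, curveVelocity I γ s⟩ : TangentBundle I M)).2) 0 = a := by
    rw [EventuallyEq.deriv_eq (f := fun s : ℝ ↦ k + s • a)
      (by filter_upwards [hJ.mem_nhds h0] using hvel)]
    have := ((hasDerivAt_id' (0 : ℝ)).smul_const a).const_add k
    simpa using this.deriv
  have h3 : connForm e LC (γ 0) (curveVelocity I γ 0)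
      (e (⟨γ 0, curveVelocity I γ 0⟩ : TangentBundle I M)).2 = -a := by
    have key : ∀ q : TangentBundle I M, q = ⟨x, h⟩ → connForm e LC q.proj q.2 (e q).2 = -a := by
      rintro _ rfl
      simp [a, k]
    exact key _ hstart
  refine h1.trans ?_
  rw [h2]
  change e.symm (γ 0) (a + connForm e LC (γ 0) (curveVelocity I γ 0)
      (e (⟨γ 0, curveVelocity I γ 0⟩ : TangentBundle I M)).2) = 0
  rw [h3, add_neg_cancel, ← e.symmL_apply (R := ℝ) (hsrc 0 h0), map_zero]

end Charts

/-! ### Isometric parallel transport -/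

section MetricTransport

variable
  {EB : Type*} [NormedAddCommGroup EB] [NormedSpace ℝ EB] [FiniteDimensional ℝ EB]
  {H : Type*} [TopologicalSpace H] {I : ModelWithCorners ℝ EB H}
  {M : Type*} [TopologicalSpace M] [ChartedSpace H M] [IsManifold I ∞ M] [T2Space M]
  {F : Type*} [NormedAddCommGroup F] [NormedSpace ℝ F] [FiniteDimensional ℝ F]
  {V : M → Type*} [TopologicalSpace (TotalSpace F V)]
  [∀ x, NormedAddCommGroup (V x)] [∀ x, InnerProductSpace ℝ (V x)]
  [FiberBundle F V] [VectorBundle ℝ F V] [ContMDiffVectorBundle ∞ F V I]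
  [IsContMDiffRiemannianBundle I ∞ F V]
  {D : CovariantDerivative I F V}

/-- Parallel transport of a metric connection is isometric. -/
theorem exists_parallel_isometry (hD : D.ContMDiffCovariantDerivative ∞) (hDm : D.IsMetric)
    {γ : ℝ → M} {J : Set ℝ} (hJ : IsOpen J) (h0 : (0 : ℝ) ∈ J)
    (hγ : ContMDiffOn 𝓘(ℝ, ℝ) I ∞ γ J) :
    ∃ ε > 0, Ioo (-ε) ε ⊆ J ∧ ∃ P : ∀ t, V (γ 0) →ₗ[ℝ] V (γ t), (∀ v, P 0 v = v) ∧
      ∀ v, ContMDiffOn 𝓘(ℝ, ℝ) (I.prod 𝓘(ℝ, F)) ∞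
          (fun t ↦ (⟨γ t, P t v⟩ : TotalSpace F V)) (Ioo (-ε) ε) ∧
        (∀ t ∈ Ioo (-ε) ε, covDerivAlong D (fun s ↦ (⟨γ s, P s v⟩ : TotalSpace F V)) t = 0) ∧
        ∀ t ∈ Ioo (-ε) ε, ‖P t v‖ = ‖v‖ := by
  obtain ⟨ε, hε, hεJ, P, hP0, hP⟩ := exists_parallel hD hJ h0 hγ
  refine ⟨ε, hε, hεJ, P, hP0, fun v ↦ ⟨(hP v).1, (hP v).2, fun t ht ↦ ?_⟩⟩
  have hd (s) (hs : s ∈ Ioo (-ε) ε) : HasDerivAt (fun t ↦ inner ℝ (P t v) (P t v)) 0 s := by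
    have hm := ((hP v).1.contMDiffAt (isOpen_Ioo.mem_nhds hs)).mdifferentiableAt (by simp)
    have := hDm.hasDerivAt_inner hm hm
    rw [(hP v).2 s hs] at this
    simpa using this
  have h := isOpen_Ioo.is_const_of_deriv_eq_zero (isPreconnected_Ioo)
    (fun s hs ↦ (hd s hs).differentiableAt.differentiableWithinAt)
    (fun s hs ↦ (hd s hs).deriv) ht (show (0 : ℝ) ∈ Ioo (-ε) ε by simp [hε])
  simp only [hP0, real_inner_self_eq_norm_sq] at h
  exact (sq_eq_sq₀ (norm_nonneg _) (norm_nonneg _)).1 h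

end MetricTransport

/-! ### Sphere bundles of constant radius and assertion 2 -/

section ConstantCurvature

variable
  {EB : Type*} [NormedAddCommGroup EB] [NormedSpace ℝ EB] [FiniteDimensional ℝ EB]
  {H : Type*} [TopologicalSpace H] {I : ModelWithCorners ℝ EB H} [I.Boundaryless]
  {M : Type*} [TopologicalSpace M] [ChartedSpace H M] [IsManifold I ∞ M] [T2Space M]
  [RiemannianBundle (fun x : M ↦ TangentSpace I x)]
  {F : Type*} [NormedAddCommGroup F] [NormedSpace ℝ F] [FiniteDimensional ℝ F]
  {V : M → Type*} [TopologicalSpace (TotalSpace F V)]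
  [∀ x, NormedAddCommGroup (V x)] [∀ x, InnerProductSpace ℝ (V x)]
  [FiberBundle F V] [VectorBundle ℝ F V] [ContMDiffVectorBundle ∞ F V I]
  [IsContMDiffRiemannianBundle I ∞ F V]
  {LC : CovariantDerivative I EB (fun x : M ↦ TangentSpace I x)}
  {D : CovariantDerivative I F V}

theorem IsCurveIn.sasakiMetric_velocity {Y : Set (TotalSpace F V)} {c : ℝ → TotalSpace F V}
    (hc : IsCurveIn I Y c) {N : TangentSpace (I.prod 𝓘(ℝ, F)) (c 0)}
    (hN : ∀ A, IsTangentVector I Y (c 0) A → sasakiMetric D (c 0) N A = 0) :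
    inner ℝ (horPart (c 0) N) (curveVelocity I (fun s ↦ (c s).proj) 0) +
      inner ℝ (connector D (c 0) N) (covDerivAlong D c 0) = 0 := by
  have h := hN (velocity I c 0) ⟨c, hc, rfl⟩
  rw [sasakiMetric, horPart_velocity (hc.smooth.mdifferentiableAt (by simp))] at h
  exact h

/-- The normals of a sphere bundle are vertical. -/
theorem inner_horPart_of_sphereBundle
    (LC : CovariantDerivative I EB (fun x : M ↦ TangentSpace I x))
    (hD : D.ContMDiffCovariantDerivative ∞) (hDm : D.IsMetric)
    {Y : Set (TotalSpace F V)} {r : ℝ} (hY : ∀ (x : M) (w : V x), ‖w‖ = r → ⟨x, w⟩ ∈ Y)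
    {x : M} {v : V x} (hv : ‖v‖ = r)
    {N : TangentSpace (I.prod 𝓘(ℝ, F)) (⟨x, v⟩ : TotalSpace F V)}
    (hN : ∀ A, IsTangentVector I Y ⟨x, v⟩ A → sasakiMetric D ⟨x, v⟩ N A = 0)
    (h : TangentSpace I x) : inner ℝ (horPart ⟨x, v⟩ N) h = 0 := by
  obtain ⟨γ, J, hJ, h0, hγ, hstart, -⟩ :=
    exists_curve_covDerivAlong_eq_zero LC (⟨x, h⟩ : TangentBundle I M)
  have key : ∀ (q : TangentBundle I M), (⟨γ 0, curveVelocity I γ 0⟩ : TangentBundle I M) = q →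
      ∀ v : V q.proj, ‖v‖ = r →
      ∀ N : TangentSpace (I.prod 𝓘(ℝ, F)) (⟨q.proj, v⟩ : TotalSpace F V),
      (∀ A, IsTangentVector I Y ⟨q.proj, v⟩ A → sasakiMetric D ⟨q.proj, v⟩ N A = 0) →
      inner ℝ (horPart (⟨q.proj, v⟩ : TotalSpace F V) N) q.2 = 0 := by
    rintro _ rfl v hv N hN
    -- The parallel section through `v` keeps its norm, so it is a curve in `Y`. Its velocity has no
    -- vertical component, and normality leaves only the horizontal term.
    obtain ⟨ε, hε, hεJ, P, hP0, hP⟩ := exists_parallel_isometry hD hDm hJ h0 hγ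
    have hnear : Ioo (-ε) ε ∈ 𝓝 (0 : ℝ) := isOpen_Ioo.mem_nhds (by simp [hε])
    have hc : IsCurveIn I Y (fun t ↦ (⟨γ t, P t v⟩ : TotalSpace F V)) := by
      refine ⟨(hP v).1.contMDiffAt hnear, ?_⟩
      filter_upwards [hnear] with t ht using hY _ _ (((hP v).2.2 t ht).trans hv)
    have key' : ∀ w, P 0 v = w →
        ∀ N : TangentSpace (I.prod 𝓘(ℝ, F)) (⟨γ 0, w⟩ : TotalSpace F V),
        (∀ A, IsTangentVector I Y ⟨γ 0, w⟩ A → sasakiMetric D ⟨γ 0, w⟩ N A = 0) →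
        inner ℝ (horPart (⟨γ 0, w⟩ : TotalSpace F V) N) (curveVelocity I γ 0) = 0 := by
      rintro _ rfl N hN
      have := hc.sasakiMetric_velocity hN
      rw [(hP v).2.1 0 (by simp [hε]), inner_zero_right, add_zero] at this
      exact this
    exact key' v (hP0 v) N hN
  exact key _ hstart v hv N hN

/-- The circle `cos t v + sin t w` stays in the sphere of radius `r` in the fibre and has velocity
`w` at time zero. -/
theorem inner_connector_of_sphereBundle
    {Y : Set (TotalSpace F V)} {r : ℝ} (hY : ∀ (x : M) (w : V x), ‖w‖ = r → ⟨x, w⟩ ∈ Y)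
    {x : M} {v : V x} (hv : ‖v‖ = r)
    {N : TangentSpace (I.prod 𝓘(ℝ, F)) (⟨x, v⟩ : TotalSpace F V)}
    (hN : ∀ A, IsTangentVector I Y ⟨x, v⟩ A → sasakiMetric D ⟨x, v⟩ N A = 0)
    {w : V x} (hw : ‖w‖ = r) (hvw : inner ℝ v w = 0) :
    inner ℝ (connector D ⟨x, v⟩ N) w = 0 := by
  have hcd : ContDiff ℝ ∞ (fun t : ℝ ↦ Real.cos t • v + Real.sin t • w) :=
    (Real.contDiff_cos.smul contDiff_const).add (Real.contDiff_sin.smul contDiff_const)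
  have hc : IsCurveIn I Y (fun t ↦ (⟨x, Real.cos t • v + Real.sin t • w⟩ : TotalSpace F V)) := by
    refine ⟨contMDiffAt_vertical (n := ⊤) hcd.contDiffAt, Eventually.of_forall fun t ↦ hY _ _ ?_⟩
    have hr : 0 ≤ r := hv ▸ norm_nonneg v
    rw [← sq_eq_sq₀ (norm_nonneg _) hr, norm_add_sq_real, norm_smul, norm_smul, inner_smul_left,
      inner_smul_right, hvw, hv, hw, mul_pow, mul_pow, Real.norm_eq_abs, Real.norm_eq_abs, sq_abs,
      sq_abs]
    linear_combination r ^ 2 * Real.cos_sq_add_sin_sq t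
  have hd : deriv (fun t : ℝ ↦ Real.cos t • v + Real.sin t • w) 0 = w := by
    have := ((Real.hasDerivAt_cos 0).smul_const v).fun_add ((Real.hasDerivAt_sin 0).smul_const w)
    simpa using this.deriv
  have h2 := covDerivAlong_vertical D (F := F) (hcd.contDiffAt.of_le (by simp)) (t := 0)
  have h0 : curveVelocity I (fun _ : ℝ ↦ x) (0 : ℝ) = 0 := by
    rw [curveVelocity, mfderiv_const]; rfl
  have key : ∀ q : V x, Real.cos 0 • v + Real.sin 0 • w = q →
      ∀ N : TangentSpace (I.prod 𝓘(ℝ, F)) (⟨x, q⟩ : TotalSpace F V),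
      (∀ A, IsTangentVector I Y ⟨x, q⟩ A → sasakiMetric D ⟨x, q⟩ N A = 0) →
      inner ℝ (connector D (⟨x, q⟩ : TotalSpace F V) N) w = 0 := by
    rintro _ rfl N hN
    have := hc.sasakiMetric_velocity hN
    rw [h2, hd] at this
    simp only [h0, inner_zero_right, zero_add] at this
    exact this
  exact key v (by simp) N hN

/-- The radial graph of a constant function is convex. -/
theorem isConvexHypersurface_of_const (hD : D.ContMDiffCovariantDerivative ∞) (hDm : D.IsMetric)
    {u : TotalSpace F V → ℝ} (hu : IsRadiallyConstantSmooth I u) {a : ℝ}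
    (ha : ∀ η ∈ puncturedBundle F V, u η = a) :
    IsConvexHypersurface LC D (radialGraph u) := by
  intro c hc N hN
  have hY (x : M) (w : V x) : (⟨x, w⟩ : TotalSpace F V) ∈ radialGraph u ↔ ‖w‖ = Real.exp a := by
    rw [mem_radialGraph_iff hu]
    constructor
    · rintro ⟨hw, h⟩
      rw [h, ha ⟨x, w⟩ hw]
    · intro h
      have hw : w ≠ 0 := norm_pos_iff.1 (h ▸ Real.exp_pos a)
      exact ⟨hw, by rw [h, ha ⟨x, w⟩ hw]⟩
  have hr : 0 < Real.exp a := Real.exp_pos a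
  set r := Real.exp a
  have hc0 : ‖(c 0).2‖ = r := (hY _ _).1 hc.mem.self_of_nhds
  have hNh : horPart (c 0) N = 0 := by
    have := inner_horPart_of_sphereBundle LC hD hDm (fun x w ↦ (hY x w).2) hc0 hN.normal
      (horPart (c 0) N)
    exact inner_self_eq_zero.1 this
  set b := connector D (c 0) N
  set v := (c 0).2
  have hv0 : v ≠ 0 := norm_pos_iff.1 (hc0 ▸ hr)
  have hvv : inner ℝ v v = r ^ 2 := by rw [real_inner_self_eq_norm_sq, hc0]
  have hbv : 0 < inner ℝ b v := hN.outward
  set l := inner ℝ b v / r ^ 2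
  have hl : 0 < l := div_pos hbv (pow_pos hr 2)
  -- The component of `b` orthogonal to `v`, rescaled to length `r`, is an admissible `w` in
  -- `inner_connector_of_sphereBundle`; hence it vanishes.
  have hb : b = l • v := by
    by_contra hne
    set w := b - l • v
    have hw0 : 0 < ‖w‖ := norm_pos_iff.2 (sub_ne_zero.2 hne)
    have hvw : inner ℝ v w = 0 := by
      simp only [w, inner_sub_right, inner_smul_right, hvv, real_inner_comm b v, l]
      field_simp
      rw [real_inner_comm]; simp
    have h1 := inner_connector_of_sphereBundle (fun x w ↦ (hY x w).2) hc0 hN.normal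
      (w := (r / ‖w‖) • w) (by rw [norm_smul, Real.norm_of_nonneg (by positivity)]; field_simp)
      (by rw [inner_smul_right, hvw, mul_zero])
    rw [inner_smul_right] at h1
    have h2 : inner ℝ b w = 0 := (mul_eq_zero.1 h1).resolve_left (by positivity)
    have h3 : inner ℝ w w = 0 := by
      conv_lhs => arg 2; simp only [w]
      rw [inner_sub_left, h2, inner_smul_left, hvw]
      simp
    exact hw0.ne' (norm_eq_zero.2 (inner_self_eq_zero.1 h3))
  obtain ⟨J, hJ, hcJ⟩ := (contMDiffAt_iff_contMDiffOn_nhds (n := 2) (by simp)).1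
    (hc.smooth.of_le (by norm_cast))
  have hsm : ∀ᶠ s in 𝓝 (0 : ℝ), ContMDiffAt 𝓘(ℝ, ℝ) (I.prod 𝓘(ℝ, F)) 2 c s := by
    filter_upwards [eventually_mem_nhds_iff.2 hJ] with s hs using hcJ.contMDiffAt hs
  -- The norm is constant along `c`. Differentiating this orthogonality gives `⟨D_t D_t c, c⟩ =
  -- -‖D_t c‖²` at zero, so that `II = l ‖D_t c‖²`.
  have horth : ∀ᶠ s in 𝓝 (0 : ℝ), inner ℝ (covDerivAlong D c s) (c s).2 = 0 := by
    filter_upwards [hsm, hc.mem.eventually_nhds] with s hs hmem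
    have hd := hDm.hasDerivAt_inner (γ := fun s ↦ (c s).proj) (σ := fun s ↦ (c s).2)
      (τ := fun s ↦ (c s).2) (hs.mdifferentiableAt (by simp)) (hs.mdifferentiableAt (by simp))
    have h0 := hd.unique ((hasDerivAt_const s (r ^ 2)).congr_of_eventuallyEq (by
      filter_upwards [hmem] with s' hs'
      rw [real_inner_self_eq_norm_sq, (hY _ _).1 hs']))
    rw [real_inner_comm] at h0
    rw [real_inner_comm]
    change inner ℝ (c s).2 (covDerivAlong D c s) + inner ℝ (c s).2 (covDerivAlong D c s) = 0 at h0
    linarith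
  have hdd := hDm.hasDerivAt_inner (γ := fun s ↦ (c s).proj) (σ := fun s ↦ covDerivAlong D c s)
    (τ := fun s ↦ (c s).2) (mdifferentiableAt_covDerivAlong hD hsm.self_of_nhds)
    (hsm.self_of_nhds.mdifferentiableAt (by simp))
  have h0 := hdd.unique ((hasDerivAt_const (0 : ℝ) (0 : ℝ)).congr_of_eventuallyEq horth)
  set dd : V (c 0).proj :=
    covDerivAlong D (fun s ↦ (⟨(c s).proj, covDerivAlong D c s⟩ : TotalSpace F V)) 0
  set d : V (c 0).proj := covDerivAlong D c 0
  change inner ℝ dd v + inner ℝ d d = 0 at h0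
  change 0 ≤ -(inner ℝ _ (horPart (c 0) N) + inner ℝ dd b)
  rw [hNh, inner_zero_right, hb, inner_smul_right, zero_add]
  have h3 : 0 ≤ inner ℝ d d := real_inner_self_nonneg
  nlinarith

end ConstantCurvature

/-! ### Horizontal derivatives of functions on `E` -/

section HorizontalDerivative

variable
  {EB : Type*} [NormedAddCommGroup EB] [NormedSpace ℝ EB] [FiniteDimensional ℝ EB]
  {H : Type*} [TopologicalSpace H] {I : ModelWithCorners ℝ EB H}
  {M : Type*} [TopologicalSpace M] [ChartedSpace H M] [IsManifold I ∞ M] [T2Space M]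
  {F : Type*} [NormedAddCommGroup F] [NormedSpace ℝ F] [FiniteDimensional ℝ F]
  {V : M → Type*} [TopologicalSpace (TotalSpace F V)]
  [∀ x, NormedAddCommGroup (V x)] [∀ x, InnerProductSpace ℝ (V x)]
  [FiberBundle F V] [VectorBundle ℝ F V] [ContMDiffVectorBundle ∞ F V I]
  (D : CovariantDerivative I F V)

/-- The derivative of a function on `E` along the horizontal lift of a tangent vector of `M`. -/
noncomputable def horDeriv (f : TotalSpace F V → ℝ) (ξ : TotalSpace F V)
    (h : TangentSpace I ξ.proj) : ℝ :=
  mvfderiv (I.prod 𝓘(ℝ, F)) f ξ (horLift D ξ h)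

theorem horDeriv_smul (f : TotalSpace F V → ℝ) (ξ : TotalSpace F V) (a : ℝ)
    (h : TangentSpace I ξ.proj) : horDeriv D f ξ (a • h) = a * horDeriv D f ξ h := by
  rw [horDeriv, horLift_smul, map_smul]; rfl

variable {D}

theorem hasDerivAt_comp_parallel {f : TotalSpace F V → ℝ} {c : ℝ → TotalSpace F V} {t : ℝ}
    (hf : MDifferentiableAt (I.prod 𝓘(ℝ, F)) 𝓘(ℝ, ℝ) f (c t))
    (hc : MDifferentiableAt 𝓘(ℝ, ℝ) (I.prod 𝓘(ℝ, F)) c t) (h : covDerivAlong D c t = 0) :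
    HasDerivAt (fun s ↦ f (c s)) (horDeriv D f (c t) (curveVelocity I (fun s ↦ (c s).proj) t)) t := by
  rw [horDeriv, ← velocity_eq_horLift D hc h]
  exact mvfderiv_curveVelocity hf hc

/-- The initial vector `v` is kept apart from `σ t` because `P 0 v = v` is not a definitional
equality. -/
theorem hasDerivAt_comp_parallel_section {f : TotalSpace F V → ℝ} {γ : ℝ → M} {σ : ∀ s, V (γ s)}
    {t : ℝ} {v : V (γ t)} (hσ : σ t = v)
    (hf : MDifferentiableAt (I.prod 𝓘(ℝ, F)) 𝓘(ℝ, ℝ) f ⟨γ t, v⟩)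
    (hc : MDifferentiableAt 𝓘(ℝ, ℝ) (I.prod 𝓘(ℝ, F)) (fun s ↦ (⟨γ s, σ s⟩ : TotalSpace F V)) t)
    (h : covDerivAlong D (fun s ↦ (⟨γ s, σ s⟩ : TotalSpace F V)) t = 0) :
    HasDerivAt (fun s ↦ f ⟨γ s, σ s⟩) (horDeriv D f ⟨γ t, v⟩ (curveVelocity I γ t)) t := by
  subst hσ
  exact hasDerivAt_comp_parallel hf hc h

variable [I.Boundaryless]

/-- To prove a statement about all vectors over all tangent vectors of `M`, it suffices to consider
the start of a parallel curve. -/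
theorem forall_of_parallel (LC : CovariantDerivative I EB (fun x : M ↦ TangentSpace I x))
    [IsContMDiffRiemannianBundle I ∞ F V]
    (hD : D.ContMDiffCovariantDerivative ∞) (hDm : D.IsMetric)
    {p : ∀ x : M, V x → TangentSpace I x → Prop}
    (hp : ∀ (γ : ℝ → M) (ε : ℝ) (P : ∀ t, V (γ 0) →ₗ[ℝ] V (γ t)), 0 < ε →
      ContMDiffOn 𝓘(ℝ, ℝ) I ∞ γ (Ioo (-ε) ε) →
      covDerivAlong LC (fun s ↦ (⟨γ s, curveVelocity I γ s⟩ : TangentBundle I M)) 0 = 0 →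
      (∀ v, P 0 v = v) →
      (∀ v, ContMDiffOn 𝓘(ℝ, ℝ) (I.prod 𝓘(ℝ, F)) ∞
          (fun t ↦ (⟨γ t, P t v⟩ : TotalSpace F V)) (Ioo (-ε) ε)) →
      (∀ v, ∀ t ∈ Ioo (-ε) ε,
        covDerivAlong D (fun s ↦ (⟨γ s, P s v⟩ : TotalSpace F V)) t = 0) →
      (∀ v, ∀ t ∈ Ioo (-ε) ε, ‖P t v‖ = ‖v‖) →
      ∀ v, p (γ 0) v (curveVelocity I γ 0)) (x : M) (v : V x) (h : TangentSpace I x) :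
    p x v h := by
  obtain ⟨γ, J, hJ, h0, hγ, hstart, hacc⟩ :=
    exists_curve_covDerivAlong_eq_zero LC (⟨x, h⟩ : TangentBundle I M)
  have key : ∀ (q : TangentBundle I M), (⟨γ 0, curveVelocity I γ 0⟩ : TangentBundle I M) = q →
      ∀ v : V q.proj, p q.proj v q.2 := by
    rintro _ rfl v
    obtain ⟨ε, hε, hεJ, P, hP0, hP⟩ := exists_parallel_isometry hD hDm hJ h0 hγ
    exact hp γ ε P hε (hγ.mono hεJ) hacc hP0 (fun v ↦ (hP v).1) (fun v ↦ (hP v).2.1)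
      (fun v ↦ (hP v).2.2) v
  exact key _ hstart v

variable [IsContMDiffRiemannianBundle I ∞ F V]

/-- Parallel transport is linear, so the parallel sections through `v` and `a • v` stay proportional
and `f` takes the same values along them. -/
theorem horDeriv_radial (LC : CovariantDerivative I EB (fun x : M ↦ TangentSpace I x))
    (hD : D.ContMDiffCovariantDerivative ∞) (hDm : D.IsMetric) {f : TotalSpace F V → ℝ}
    (hf : ContMDiffOn (I.prod 𝓘(ℝ, F)) 𝓘(ℝ, ℝ) ∞ f (puncturedBundle F V))
    (hfr : ∀ (x : M) (v : V x) (t : ℝ), v ≠ 0 → 0 < t → f ⟨x, t • v⟩ = f ⟨x, v⟩)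
    {a : ℝ} (ha : 0 < a) (x : M) (v : V x) (h : TangentSpace I x) :
    v ≠ 0 → horDeriv D f ⟨x, a • v⟩ h = horDeriv D f ⟨x, v⟩ h := by
  refine forall_of_parallel LC hD hDm (p := fun x v h ↦ v ≠ 0 →
    horDeriv D f ⟨x, a • v⟩ h = horDeriv D f ⟨x, v⟩ h) ?_ x v h
  intro γ ε P hε hγ _ hP0 hPs hPd hPn v hv
  have hnear : Ioo (-ε) ε ∈ 𝓝 (0 : ℝ) := isOpen_Ioo.mem_nhds (by simp [hε])
  have hder (w : V (γ 0)) (hw : w ≠ 0) : HasDerivAt (fun s ↦ f ⟨γ s, P s w⟩)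
      (horDeriv D f ⟨γ 0, w⟩ (curveVelocity I γ 0)) 0 := by
    have hm : (⟨γ 0, w⟩ : TotalSpace F V) ∈ puncturedBundle F V := hw
    exact hasDerivAt_comp_parallel_section (hP0 w)
      ((hf.contMDiffAt ((isOpen_puncturedBundle I).mem_nhds hm)).mdifferentiableAt (by simp))
      (((hPs w).contMDiffAt hnear).mdifferentiableAt (by simp)) (hPd w 0 (by simp [hε]))
  have h1 := hder v hv
  have h2 := hder (a • v) (smul_ne_zero ha.ne' hv)
  refine h2.unique (h1.congr_of_eventuallyEq ?_)
  filter_upwards [hnear] with t ht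
  rw [map_smul]
  refine hfr _ _ _ ?_ ha
  rw [← norm_pos_iff, hPn v t ht]
  exact norm_pos_iff.2 hv

/-- The inverse of a trivialization over the chart at `x₀`. -/
theorem contMDiffOn_symm_extChartAt (e : Trivialization F (TotalSpace.proj : TotalSpace F V → M))
    [MemTrivializationAtlas e] (x₀ : M) {N : Type*} [NormedAddCommGroup N] [NormedSpace ℝ N]
    {y : N → EB} {w : N → F} {s : Set N} (hy : ContDiffOn ℝ ∞ y s) (hw : ContDiffOn ℝ ∞ w s)
    (hs : ∀ p ∈ s, y p ∈ (extChartAt I x₀).target)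
    (he : ∀ p ∈ s, (extChartAt I x₀).symm (y p) ∈ e.baseSet) :
    ContMDiffOn 𝓘(ℝ, N) (I.prod 𝓘(ℝ, F)) ∞
      (fun p ↦ (⟨(extChartAt I x₀).symm (y p), e.symm _ (w p)⟩ : TotalSpace F V)) s := by
  have hmaps : MapsTo (fun p ↦ (⟨(extChartAt I x₀).symm (y p), e.symm _ (w p)⟩ : TotalSpace F V)) s
    e.source := fun p hp ↦ e.mem_source.2 (he p hp)
  rw [e.contMDiffOn_iff hmaps]
  refine ⟨contMDiffOn_extChartAt_symm_comp x₀ hy hs, ?_⟩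
  refine hw.contMDiffOn.congr fun p hp ↦ ?_
  rw [e.apply_mk_symm (he p hp)]

/-- The horizontal derivative in coordinates. -/
theorem horDeriv_eq_fderiv (LC : CovariantDerivative I EB (fun x : M ↦ TangentSpace I x))
    (hD : D.ContMDiffCovariantDerivative ∞) (hDm : D.IsMetric) {f : TotalSpace F V → ℝ}
    (hf : ContMDiffOn (I.prod 𝓘(ℝ, F)) 𝓘(ℝ, ℝ) ∞ f (puncturedBundle F V))
    (e : Trivialization F (TotalSpace.proj : TotalSpace F V → M)) [MemTrivializationAtlas e]
    (x₀ : M) (x : M) (v : V x) (h : TangentSpace I x) : v ≠ 0 → x ∈ (chartAt H x₀).source →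
    x ∈ e.baseSet →
    DifferentiableAt ℝ (fun p : EB × F ↦ f ⟨(extChartAt I x₀).symm p.1, e.symm _ p.2⟩)
      (extChartAt I x₀ x, (e ⟨x, v⟩).2) →
    horDeriv D f ⟨x, v⟩ h =
      fderiv ℝ (fun p : EB × F ↦ f ⟨(extChartAt I x₀).symm p.1, e.symm _ p.2⟩)
        (extChartAt I x₀ x, (e ⟨x, v⟩).2)
        ((trivializationAt EB (TangentSpace I) x₀ (⟨x, h⟩ : TangentBundle I M)).2,
          -connForm e D x h (e ⟨x, v⟩).2) := by
  refine forall_of_parallel LC hD hDm (p := fun x v h ↦ v ≠ 0 → x ∈ (chartAt H x₀).source →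
    x ∈ e.baseSet →
    DifferentiableAt ℝ (fun p : EB × F ↦ f ⟨(extChartAt I x₀).symm p.1, e.symm _ p.2⟩)
      (extChartAt I x₀ x, (e ⟨x, v⟩).2) →
    horDeriv D f ⟨x, v⟩ h =
      fderiv ℝ (fun p : EB × F ↦ f ⟨(extChartAt I x₀).symm p.1, e.symm _ p.2⟩)
        (extChartAt I x₀ x, (e ⟨x, v⟩).2)
        ((trivializationAt EB (TangentSpace I) x₀ (⟨x, h⟩ : TangentBundle I M)).2,
          -connForm e D x h (e ⟨x, v⟩).2)) ?_ x v h
  intro γ ε P hε hγ _ hP0 hPs hPd hPn v hv hx hxe hfd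
  have hnear : Ioo (-ε) ε ∈ 𝓝 (0 : ℝ) := isOpen_Ioo.mem_nhds (by simp [hε])
  have hγ0 := (hγ.contMDiffAt hnear).mdifferentiableAt (by simp)
  have hc0 := ((hPs v).contMDiffAt hnear).mdifferentiableAt (by simp)
  have h1 : HasDerivAt (fun s ↦ f ⟨γ s, P s v⟩)
      (horDeriv D f ⟨γ 0, v⟩ (curveVelocity I γ 0)) 0 := by
    have hm : (⟨γ 0, v⟩ : TotalSpace F V) ∈ puncturedBundle F V := hv
    exact hasDerivAt_comp_parallel_section (hP0 v)
      ((hf.contMDiffAt ((isOpen_puncturedBundle I).mem_nhds hm)).mdifferentiableAt (by simp))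
      (((hPs v).contMDiffAt hnear).mdifferentiableAt (by simp)) (hPd v 0 (by simp [hε]))
  refine h1.unique ?_
  have hy : HasDerivAt (fun s ↦ extChartAt I x₀ (γ s))
      ((trivializationAt EB (TangentSpace I) x₀
        (⟨γ 0, curveVelocity I γ 0⟩ : TangentBundle I M)).2) 0 := by
    rw [trivializationAt_curveVelocity hγ0 hx]
    exact (mvfderiv_curveVelocity (mdifferentiableAt_extChartAt hx) hγ0).differentiableAt.hasDerivAt
  -- Parallelism in coordinates: the fibre coordinate has velocity `-Γ(h) w`, the second component
  -- of the horizontal lift of `h`.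
  have hw : HasDerivAt (fun s ↦ (e (⟨γ s, P s v⟩ : TotalSpace F V)).2)
      (-connForm e D (γ 0) (curveVelocity I γ 0) (e ⟨γ 0, v⟩).2) 0 := by
    have hd := (Trivialization.differentiableAt_snd_comp (e := e)
      (S := fun s ↦ (⟨γ s, P s v⟩ : TotalSpace F V)) hxe hc0).hasDerivAt
    have h2 := covDerivAlong_eq_symm e D (S := fun s ↦ (⟨γ s, P s v⟩ : TotalSpace F V)) (t := 0)
      hxe hc0
    rw [hPd v 0 (by simp [hε])] at h2
    simp only [hP0] at h2
    have h3 := congrArg (e.continuousLinearMapAt ℝ (γ 0)) h2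
    rw [← e.symmL_apply (R := ℝ) hxe, e.continuousLinearMapAt_symmL hxe, map_zero] at h3
    exact hd.congr_deriv (eq_neg_of_add_eq_zero_left h3.symm)
  have hcomp := HasFDerivAt.comp_hasDerivAt (l := fun p : EB × F ↦
    f ⟨(extChartAt I x₀).symm p.1, e.symm _ p.2⟩) (0 : ℝ) (by simpa only [hP0] using hfd.hasFDerivAt)
    (hy.prodMk hw)
  refine (hcomp.congr_of_eventuallyEq ?_).congr_deriv ?_
  · have hb : ∀ᶠ s in 𝓝 (0 : ℝ), γ s ∈ (chartAt H x₀).source ∩ e.baseSet :=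
      hγ0.continuousAt.preimage_mem_nhds
        (((chartAt H x₀).open_source.inter e.open_baseSet).mem_nhds ⟨hx, hxe⟩)
    filter_upwards [hb] with s hs
    have h4 : (extChartAt I x₀).symm (extChartAt I x₀ (γ s)) = γ s :=
      (extChartAt I x₀).left_inv (by rw [extChartAt_source]; exact hs.1)
    have h5 : ∀ z, z = γ s → (⟨γ s, P s v⟩ : TotalSpace F V) =
        ⟨z, e.symm z (e (⟨γ s, P s v⟩ : TotalSpace F V)).2⟩ := by
      rintro _ rfl
      rw [e.symm_apply_apply_mk hs.2]
    exact congrArg f (h5 _ h4)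
  · rfl

end HorizontalDerivative

/-! ### Existence of a minimum of the horizontal slope -/

section Minimum

variable
  {EB : Type*} [NormedAddCommGroup EB] [NormedSpace ℝ EB] [FiniteDimensional ℝ EB]
  {H : Type*} [TopologicalSpace H] {I : ModelWithCorners ℝ EB H} [I.Boundaryless]
  {M : Type*} [TopologicalSpace M] [ChartedSpace H M] [IsManifold I ∞ M] [T2Space M]
  [RiemannianBundle (fun x : M ↦ TangentSpace I x)]
  [IsContMDiffRiemannianBundle I ∞ EB (fun x : M ↦ TangentSpace I x)]
  {F : Type*} [NormedAddCommGroup F] [NormedSpace ℝ F] [FiniteDimensional ℝ F]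
  {V : M → Type*} [TopologicalSpace (TotalSpace F V)]
  [∀ x, NormedAddCommGroup (V x)] [∀ x, InnerProductSpace ℝ (V x)]
  [FiberBundle F V] [VectorBundle ℝ F V] [ContMDiffVectorBundle ∞ F V I]
  [IsContMDiffRiemannianBundle I ∞ F V]
  (D : CovariantDerivative I F V)

/-- The horizontal derivative of `f` per unit length, plus a multiple of `f`. -/
noncomputable def horSlope (f : TotalSpace F V → ℝ) (δ : ℝ) (x : M) (v : V x)
    (h : TangentSpace I x) : ℝ :=
  horDeriv D f ⟨x, v⟩ h / ‖h‖ + δ * f ⟨x, v⟩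

variable {D}

/-- Invariance under positive scaling of `v` and `h` makes the slope a function of directions, to
which compactness applies. -/
theorem horSlope_smul (LC : CovariantDerivative I EB (fun x : M ↦ TangentSpace I x))
    (hD : D.ContMDiffCovariantDerivative ∞) (hDm : D.IsMetric) {f : TotalSpace F V → ℝ}
    (hf : ContMDiffOn (I.prod 𝓘(ℝ, F)) 𝓘(ℝ, ℝ) ∞ f (puncturedBundle F V))
    (hfr : ∀ (x : M) (v : V x) (t : ℝ), v ≠ 0 → 0 < t → f ⟨x, t • v⟩ = f ⟨x, v⟩) (δ : ℝ)
    {a b : ℝ} (ha : 0 < a) (hb : 0 < b) {x : M} {v : V x} (hv : v ≠ 0) (h : TangentSpace I x) :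
    horSlope D f δ x (a • v) (b • h) = horSlope D f δ x v h := by
  rw [horSlope, horSlope, hfr x v a hv ha]
  congr 1
  rw [horDeriv_radial LC hD hDm hf hfr ha x v (b • h) hv, norm_smul, Real.norm_of_nonneg hb.le]
  have := horDeriv_smul D f ⟨x, v⟩ b h
  rw [this, mul_div_mul_left _ _ hb.ne']

/-- Over a neighbourhood of each point, `horSlope` is bounded below by one of its values. -/
theorem exists_horSlope_le_of_nhds [Nontrivial EB] [Nontrivial F]
    (LC : CovariantDerivative I EB (fun x : M ↦ TangentSpace I x))
    (hD : D.ContMDiffCovariantDerivative ∞) (hDm : D.IsMetric) {f : TotalSpace F V → ℝ}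
    (hf : ContMDiffOn (I.prod 𝓘(ℝ, F)) 𝓘(ℝ, ℝ) ∞ f (puncturedBundle F V))
    (hfr : ∀ (x : M) (v : V x) (t : ℝ), v ≠ 0 → 0 < t → f ⟨x, t • v⟩ = f ⟨x, v⟩) (δ : ℝ)
    (x₀ : M) :
    ∃ U ∈ 𝓝 x₀, ∃ (x' : M) (v' : V x') (h' : TangentSpace I x'), v' ≠ 0 ∧ h' ≠ 0 ∧
      ∀ x ∈ U, ∀ (v : V x) (h : TangentSpace I x), v ≠ 0 → h ≠ 0 →
        horSlope D f δ x' v' h' ≤ horSlope D f δ x v h := by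
  set φ := extChartAt I x₀
  set e := trivializationAt F V x₀
  set e' := trivializationAt EB (TangentSpace I (M := M)) x₀
  set O : Set EB := φ.target ∩ φ.symm ⁻¹' e.baseSet
  have hO : IsOpen O := (continuousOn_extChartAt_symm x₀).isOpen_inter_preimage
    (isOpen_extChartAt_target x₀) e.open_baseSet
  have hsrc (y) (hy : y ∈ O) : φ.symm y ∈ (chartAt H x₀).source := by
    have := φ.map_target hy.1
    rwa [extChartAt_source] at this
  have hbase (y) (hy : y ∈ O) : φ.symm y ∈ e'.baseSet := hsrc y hy
  have hx₀ : φ x₀ ∈ O := ⟨mem_extChartAt_target x₀, by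
    change φ.symm (φ x₀) ∈ e.baseSet
    rw [extChartAt_to_inv x₀]; exact mem_baseSet_trivializationAt F V x₀⟩
  have hsymm0 (y) (hy : y ∈ O) (w : F) (hw : w ≠ 0) : e.symm (φ.symm y) w ≠ 0 := by
    intro h
    have h1 := congrArg (e.continuousLinearMapAt ℝ (φ.symm y)) h
    rw [← e.symmL_apply (R := ℝ) hy.2, e.continuousLinearMapAt_symmL hy.2, map_zero] at h1
    exact hw h1
  have hsymm0' (y) (hy : y ∈ O) (k : EB) (hk : k ≠ 0) : e'.symm (φ.symm y) k ≠ 0 := by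
    intro h
    have h1 := congrArg (e'.continuousLinearMapAt ℝ (φ.symm y)) h
    rw [← e'.symmL_apply (R := ℝ) (hbase y hy), e'.continuousLinearMapAt_symmL (hbase y hy),
      map_zero] at h1
    exact hk h1
  set g : EB × F → ℝ := fun p ↦ f ⟨φ.symm p.1, e.symm _ p.2⟩
  set O₂ : Set (EB × F) := O ×ˢ {0}ᶜ
  have hO₂ : IsOpen O₂ := hO.prod isOpen_compl_singleton
  have hg : ContDiffOn ℝ ∞ g O₂ := by
    rw [← contMDiffOn_iff_contDiffOn]
    exact hf.comp (contMDiffOn_symm_extChartAt e x₀ contDiffOn_fst contDiffOn_snd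
      (fun p hp ↦ hp.1.1) fun p hp ↦ hp.1.2) fun p hp ↦ hsymm0 _ hp.1 _ hp.2
  have hX : ContMDiffOn 𝓘(ℝ, EB × EB) (I.prod 𝓘(ℝ, EB)) ∞
      (fun p : EB × EB ↦ (⟨φ.symm p.1, e'.symm _ p.2⟩ : TangentBundle I M)) (O ×ˢ univ) :=
    contMDiffOn_symm_extChartAt e' x₀ contDiffOn_fst contDiffOn_snd
      (fun p hp ↦ hp.1.1) fun p hp ↦ hbase _ hp.1
  have hΓ : ContDiffOn ℝ ∞ (fun p : EB × EB ↦ connForm e D (φ.symm p.1) (e'.symm _ p.2))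
      (O ×ˢ univ) :=
    contDiffOn_connForm (n := ⊤) e hD (X := fun p : EB × EB ↦ e'.symm (φ.symm p.1) p.2)
      (hO.prod isOpen_univ) (fun p hp ↦ hp.1.2) hX
  have hnorm : ContinuousOn (fun p : EB × EB ↦ ‖e'.symm (φ.symm p.1) p.2‖) (O ×ˢ univ) := by
    have h1 : ContMDiffOn 𝓘(ℝ, EB × EB) 𝓘(ℝ, ℝ) ∞ (fun p : EB × EB ↦
        inner ℝ (e'.symm (φ.symm p.1) p.2) (e'.symm (φ.symm p.1) p.2)) (O ×ˢ univ) :=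
      ContMDiffOn.inner_bundle hX hX
    refine (Real.continuous_sqrt.comp_continuousOn h1.continuousOn).congr fun p _ ↦ ?_
    simp only [Function.comp, real_inner_self_eq_norm_sq, Real.sqrt_sq (norm_nonneg _)]
  -- The coordinate formula for the horizontal derivative shows that the slope is continuous away
  -- from zero vectors.
  have hslope (p : EB × F × EB) (hp : p ∈ O ×ˢ ({0}ᶜ ×ˢ {0}ᶜ)) :
      horSlope D f δ (φ.symm p.1) (e.symm _ p.2.1) (e'.symm _ p.2.2) =
      fderiv ℝ g (p.1, p.2.1)
        (p.2.2, -connForm e D (φ.symm p.1) (e'.symm _ p.2.2) p.2.1) /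
        ‖e'.symm (φ.symm p.1) p.2.2‖ + δ * g (p.1, p.2.1) := by
    have hr : φ (φ.symm p.1) = p.1 := φ.right_inv hp.1.1
    have hw : (e (⟨φ.symm p.1, e.symm _ p.2.1⟩ : TotalSpace F V)).2 = p.2.1 := by
      rw [e.apply_mk_symm hp.1.2]
    have hk : (e' (⟨φ.symm p.1, e'.symm _ p.2.2⟩ : TangentBundle I M)).2 = p.2.2 := by
      rw [e'.apply_mk_symm (hbase _ hp.1)]
    have h1 := horDeriv_eq_fderiv LC hD hDm hf e x₀ (φ.symm p.1) (e.symm _ p.2.1)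
      (e'.symm _ p.2.2) (hsymm0 _ hp.1 _ hp.2.1) (hsrc _ hp.1) hp.1.2 (by
        rw [hw, hr]
        exact (hg.contDiffAt (hO₂.mem_nhds ⟨hp.1, hp.2.1⟩)).differentiableAt (by simp))
    rw [hw, hr, hk] at h1
    rw [horSlope, h1]
  have hcont : ContinuousOn (fun p : EB × F × EB ↦
      horSlope D f δ (φ.symm p.1) (e.symm _ p.2.1) (e'.symm _ p.2.2))
      (O ×ˢ ({0}ᶜ ×ˢ {0}ᶜ)) := by
    refine ContinuousOn.congr ?_ hslope
    have m1 : MapsTo (fun p : EB × F × EB ↦ (p.1, p.2.1)) (O ×ˢ ({0}ᶜ ×ˢ {0}ᶜ)) O₂ :=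
      fun p hp ↦ ⟨hp.1, hp.2.1⟩
    have m2 : MapsTo (fun p : EB × F × EB ↦ (p.1, p.2.2)) (O ×ˢ ({0}ᶜ ×ˢ {0}ᶜ)) (O ×ˢ univ) :=
      fun p hp ↦ ⟨hp.1, trivial⟩
    have c1 : Continuous (fun p : EB × F × EB ↦ (p.1, p.2.1)) := by fun_prop
    have c2 : Continuous (fun p : EB × F × EB ↦ (p.1, p.2.2)) := by fun_prop
    have k1 := (hg.continuousOn_fderiv_of_isOpen hO₂ (by simp)).comp c1.continuousOn m1
    have k2 := hΓ.continuousOn.comp c2.continuousOn m2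
    have k3 := hnorm.comp c2.continuousOn m2
    have k4 := hg.continuousOn.comp c1.continuousOn m1
    have k5 : ContinuousOn (fun p : EB × F × EB ↦ p.2.1) (O ×ˢ ({0}ᶜ ×ˢ {0}ᶜ)) := by fun_prop
    have k6 : ContinuousOn (fun p : EB × F × EB ↦ p.2.2) (O ×ˢ ({0}ᶜ ×ˢ {0}ᶜ)) := by fun_prop
    refine ((k1.clm_apply (k6.prodMk (k2.clm_apply k5).neg)).div k3 fun p hp ↦ ?_).add
      (continuousOn_const.mul k4)
    exact norm_ne_zero_iff.2 (hsymm0' _ hp.1 _ hp.2.2)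
  obtain ⟨ρ, hρ, hρO⟩ := Metric.nhds_basis_closedBall.mem_iff.1 (hO.mem_nhds hx₀)
  -- The spheres are those of the model spaces, not of the fibres. By scaling invariance they
  -- represent all directions, and `C` is visibly compact.
  set C : Set (EB × F × EB) :=
    Metric.closedBall (φ x₀) ρ ×ˢ (Metric.sphere 0 1 ×ˢ Metric.sphere 0 1)
  have hC : IsCompact C :=
    (isCompact_closedBall _ _).prod ((isCompact_sphere _ _).prod (isCompact_sphere _ _))
  have hCO : C ⊆ O ×ˢ ({0}ᶜ ×ˢ {0}ᶜ) := by
    rintro ⟨y, w, k⟩ ⟨hy, hw, hk⟩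
    exact ⟨hρO hy, ne_zero_of_mem_unit_sphere ⟨w, hw⟩, ne_zero_of_mem_unit_sphere ⟨k, hk⟩⟩
  have hCne : C.Nonempty := (Metric.nonempty_closedBall.2 hρ.le).prod
    ((NormedSpace.sphere_nonempty.2 zero_le_one).prod (NormedSpace.sphere_nonempty.2 zero_le_one))
  obtain ⟨⟨y', w', k'⟩, hp', hmin⟩ := hC.exists_isMinOn hCne (hcont.mono hCO)
  refine ⟨φ.source ∩ φ ⁻¹' Metric.closedBall (φ x₀) ρ, ?_, φ.symm y', e.symm _ w', e'.symm _ k',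
    hsymm0 _ (hCO hp').1 _ (hCO hp').2.1, hsymm0' _ (hCO hp').1 _ (hCO hp').2.2, ?_⟩
  · exact inter_mem (extChartAt_source_mem_nhds x₀)
      ((continuousAt_extChartAt x₀).preimage_mem_nhds (Metric.closedBall_mem_nhds _ hρ))
  rintro x ⟨hx, hxρ⟩
  obtain ⟨y, hy, rfl⟩ : ∃ y ∈ Metric.closedBall (φ x₀) ρ, x = φ.symm y :=
    ⟨φ x, hxρ, (φ.left_inv hx).symm⟩
  intro v h hv hh
  have hyO := hρO hy
  set w := (e (⟨φ.symm y, v⟩ : TotalSpace F V)).2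
  set k := (e' (⟨φ.symm y, h⟩ : TangentBundle I M)).2
  have hvw : e.symm (φ.symm y) w = v := e.symm_apply_apply_mk hyO.2 v
  have hhk : e'.symm (φ.symm y) k = h := e'.symm_apply_apply_mk (hbase y hyO) h
  have hw : 0 < ‖w‖ := norm_pos_iff.2 fun h0 ↦ hv (by
    rw [← hvw, h0, ← e.symmL_apply (R := ℝ) hyO.2, map_zero])
  have hk : 0 < ‖k‖ := norm_pos_iff.2 fun h0 ↦ hh (by
    rw [← hhk, h0, ← e'.symmL_apply (R := ℝ) (hbase y hyO), map_zero])
  have hmem : (y, ‖w‖⁻¹ • w, ‖k‖⁻¹ • k) ∈ C := by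
    refine ⟨hy, ?_, ?_⟩ <;> simp [norm_smul, hw.ne', hk.ne']
  have h1 := hmin hmem
  simp only [mem_ofPred_eq] at h1
  have h2 : e.symm (φ.symm y) (‖w‖⁻¹ • w) = ‖w‖⁻¹ • v := by
    rw [← e.symmL_apply (R := ℝ) hyO.2, map_smul, e.symmL_apply (R := ℝ) hyO.2, hvw]
  have h3 : e'.symm (φ.symm y) (‖k‖⁻¹ • k) = ‖k‖⁻¹ • h := by
    rw [← e'.symmL_apply (R := ℝ) (hbase y hyO), map_smul, e'.symmL_apply (R := ℝ) (hbase y hyO),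
      hhk]
  rw [h2, h3, horSlope_smul LC hD hDm hf hfr δ (inv_pos.2 hw) (inv_pos.2 hk) hv] at h1
  exact h1

/-- On a compact manifold `horSlope` attains its minimum. -/
theorem exists_horSlope_le [CompactSpace M] [Nonempty M] [Nontrivial EB] [Nontrivial F]
    (LC : CovariantDerivative I EB (fun x : M ↦ TangentSpace I x))
    (hD : D.ContMDiffCovariantDerivative ∞) (hDm : D.IsMetric) {f : TotalSpace F V → ℝ}
    (hf : ContMDiffOn (I.prod 𝓘(ℝ, F)) 𝓘(ℝ, ℝ) ∞ f (puncturedBundle F V))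
    (hfr : ∀ (x : M) (v : V x) (t : ℝ), v ≠ 0 → 0 < t → f ⟨x, t • v⟩ = f ⟨x, v⟩) (δ : ℝ) :
    ∃ (x' : M) (v' : V x') (h' : TangentSpace I x'), v' ≠ 0 ∧ h' ≠ 0 ∧
      ∀ (x : M) (v : V x) (h : TangentSpace I x), v ≠ 0 → h ≠ 0 →
        horSlope D f δ x' v' h' ≤ horSlope D f δ x v h := by
  choose U hU x' v' h' hv' hh' hmin using
    exists_horSlope_le_of_nhds LC hD hDm hf hfr δ
  obtain ⟨t, ht⟩ := CompactSpace.elim_nhds_subcover U hU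
  have hne : t.Nonempty := by
    obtain ⟨x⟩ := ‹Nonempty M›
    have : x ∈ ⋃ y ∈ t, U y := by rw [ht]; trivial
    simp only [mem_iUnion] at this
    obtain ⟨y, hy, -⟩ := this
    exact ⟨y, hy⟩
  obtain ⟨z, hz, hzmin⟩ := t.exists_min_image (fun z ↦ horSlope D f δ (x' z) (v' z) (h' z)) hne
  refine ⟨x' z, v' z, h' z, hv' z, hh' z, fun x v h hv hh ↦ ?_⟩
  have : x ∈ ⋃ y ∈ t, U y := by rw [ht]; trivial
  simp only [mem_iUnion] at this
  obtain ⟨y, hy, hxy⟩ := this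
  exact (hzmin y hy).trans (hmin y x hxy v h hv hh)

end Minimum

/-! ### Convex radial graphs and assertion 3 -/

section NonconstantCurvature

variable
  {EB : Type*} [NormedAddCommGroup EB] [NormedSpace ℝ EB] [FiniteDimensional ℝ EB]
  {H : Type*} [TopologicalSpace H] {I : ModelWithCorners ℝ EB H} [I.Boundaryless]
  {M : Type*} [TopologicalSpace M] [ChartedSpace H M] [IsManifold I ∞ M] [T2Space M]
  [RiemannianBundle (fun x : M ↦ TangentSpace I x)]
  [IsContMDiffRiemannianBundle I ∞ EB (fun x : M ↦ TangentSpace I x)]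
  {F : Type*} [NormedAddCommGroup F] [NormedSpace ℝ F] [FiniteDimensional ℝ F]
  {V : M → Type*} [TopologicalSpace (TotalSpace F V)]
  [∀ x, NormedAddCommGroup (V x)] [∀ x, InnerProductSpace ℝ (V x)]
  [FiberBundle F V] [VectorBundle ℝ F V] [ContMDiffVectorBundle ∞ F V I]
  [IsContMDiffRiemannianBundle I ∞ F V]
  {LC : CovariantDerivative I EB (fun x : M ↦ TangentSpace I x)}
  {D : CovariantDerivative I F V}

/-- Compatibility of a connection on the tangent bundle with the Riemannian metric. -/
abbrev CovariantDerivative.IsRiemannian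
    (LC : CovariantDerivative I EB (fun x : M ↦ TangentSpace I x)) : Prop :=
  @CovariantDerivative.IsMetric EB _ _ H _ I M _ _ EB _ _ (fun x : M ↦ TangentSpace I x) _
    (fun _ ↦ inferInstance) (fun _ ↦ inferInstance) _ LC

theorem CovariantDerivative.IsRiemannian.hasDerivAt_inner (hLC : LC.IsRiemannian) {γ : ℝ → M}
    {σ τ : ∀ s, TangentSpace I (γ s)} {t : ℝ}
    (hσ : MDifferentiableAt 𝓘(ℝ, ℝ) (I.prod 𝓘(ℝ, EB)) (fun s ↦ (⟨γ s, σ s⟩ : TangentBundle I M)) t)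
    (hτ : MDifferentiableAt 𝓘(ℝ, ℝ) (I.prod 𝓘(ℝ, EB))
      (fun s ↦ (⟨γ s, τ s⟩ : TangentBundle I M)) t) :
    HasDerivAt (fun s ↦ inner ℝ (σ s) (τ s))
      (inner ℝ (covDerivAlong LC (fun s ↦ (⟨γ s, σ s⟩ : TangentBundle I M)) t) (τ t) +
        inner ℝ (σ t) (covDerivAlong LC (fun s ↦ (⟨γ s, τ s⟩ : TangentBundle I M)) t)) t := by
  have : IsContMDiffRiemannianBundle I 1 EB (fun x : M ↦ TangentSpace I x) := inferInstance
  exact CovariantDerivative.IsMetric.hasDerivAt_inner hLC hσ hτ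

theorem contMDiffAt_smul_along {n : ℕ∞} {γ : ℝ → M} {σ : ∀ s, V (γ s)} {f : ℝ → ℝ} {t : ℝ}
    (hσ : ContMDiffAt 𝓘(ℝ, ℝ) (I.prod 𝓘(ℝ, F)) n (fun s ↦ (⟨γ s, σ s⟩ : TotalSpace F V)) t)
    (hf : ContDiffAt ℝ n f t) :
    ContMDiffAt 𝓘(ℝ, ℝ) (I.prod 𝓘(ℝ, F)) n (fun s ↦ (⟨γ s, f s • σ s⟩ : TotalSpace F V)) t := by
  have : ContMDiffVectorBundle n F V I := .of_le (n := ∞) (by norm_cast; exact le_top)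
  set e := trivializationAt F V (γ t)
  have ht : γ t ∈ e.baseSet := mem_baseSet_trivializationAt F V (γ t)
  have h1 : (⟨γ t, σ t⟩ : TotalSpace F V) ∈ e.source := e.mem_source.2 ht
  have h2 : (⟨γ t, f t • σ t⟩ : TotalSpace F V) ∈ e.source := e.mem_source.2 ht
  obtain ⟨hγ, hσe⟩ :=
    (e.contMDiffAt_iff (f := fun s ↦ (⟨γ s, σ s⟩ : TotalSpace F V)) h1).1 hσ
  refine (e.contMDiffAt_iff (f := fun s ↦ (⟨γ s, f s • σ s⟩ : TotalSpace F V)) h2).2 ⟨hγ, ?_⟩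
  refine ((hf.smul hσe.contDiffAt).contMDiffAt).congr_of_eventuallyEq ?_
  filter_upwards [hγ.continuousAt.preimage_mem_nhds (e.open_baseSet.mem_nhds ht)] with s hs
  exact (e.linear ℝ hs).map_smul _ _

theorem IsRadiallyConstantSmooth.contMDiffOn_exp {u : TotalSpace F V → ℝ}
    (hu : IsRadiallyConstantSmooth I u) :
    ContMDiffOn (I.prod 𝓘(ℝ, F)) 𝓘(ℝ, ℝ) ∞ (fun η ↦ Real.exp (u η)) (puncturedBundle F V) :=
  Real.contDiff_exp.contMDiff.comp_contMDiffOn hu.smooth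

/-- Along a parallel curve over a curve without acceleration, the radius of a convex radial graph
is concave to second order. -/
theorem deriv_deriv_radius_nonpos {u : TotalSpace F V → ℝ} (hu : IsRadiallyConstantSmooth I u)
    (hconv : IsConvexHypersurface LC D (radialGraph u)) {γ : ℝ → M} {σ : ∀ t, V (γ t)} {ε ℓ : ℝ}
    (hε : 0 < ε) (hℓ : 0 < ℓ) (hγ : ContMDiffOn 𝓘(ℝ, ℝ) I ∞ γ (Ioo (-ε) ε))
    (hacc : covDerivAlong LC (fun s ↦ (⟨γ s, curveVelocity I γ s⟩ : TangentBundle I M)) 0 = 0)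
    (hσ : ContMDiffOn 𝓘(ℝ, ℝ) (I.prod 𝓘(ℝ, F)) ∞
      (fun t ↦ (⟨γ t, σ t⟩ : TotalSpace F V)) (Ioo (-ε) ε))
    (hpar : ∀ t ∈ Ioo (-ε) ε, covDerivAlong D (fun s ↦ (⟨γ s, σ s⟩ : TotalSpace F V)) t = 0)
    (hn : ∀ t ∈ Ioo (-ε) ε, ‖σ t‖ = ℓ) :
    deriv (deriv fun t ↦ Real.exp (u ⟨γ t, σ t⟩)) 0 ≤ 0 := by
  have h0 : (0 : ℝ) ∈ Ioo (-ε) ε := by simp [hε]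
  have hnear : Ioo (-ε) ε ∈ 𝓝 (0 : ℝ) := isOpen_Ioo.mem_nhds h0
  have hσ0 (t) (ht : t ∈ Ioo (-ε) ε) : σ t ≠ 0 := norm_pos_iff.1 (by rw [hn t ht]; exact hℓ)
  set r : ℝ → ℝ := fun t ↦ Real.exp (u ⟨γ t, σ t⟩)
  have hr : ContDiffOn ℝ ∞ r (Ioo (-ε) ε) := by
    rw [← contMDiffOn_iff_contDiffOn]
    exact hu.contMDiffOn_exp.comp hσ fun t ht ↦ hσ0 t ht
  have hrd : ContDiffOn ℝ ∞ (deriv r) (Ioo (-ε) ε) := hr.deriv_of_isOpen isOpen_Ioo (by simp)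
  -- The parallel section, of norm `ℓ`, rescaled so that it lies in the graph.
  set c : ℝ → TotalSpace F V := fun t ↦ ⟨γ t, (r t / ℓ) • σ t⟩
  have hcs (t) (ht : t ∈ Ioo (-ε) ε) : ContMDiffAt 𝓘(ℝ, ℝ) (I.prod 𝓘(ℝ, F)) ∞ c t :=
    contMDiffAt_smul_along (n := ⊤) (hσ.contMDiffAt (isOpen_Ioo.mem_nhds ht))
      ((hr.contDiffAt (isOpen_Ioo.mem_nhds ht)).div_const ℓ)
  have hrpos (t) : 0 < r t / ℓ := div_pos (Real.exp_pos _) hℓ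
  have hc : IsCurveIn I (radialGraph u) c := by
    refine ⟨hcs 0 h0, ?_⟩
    filter_upwards [hnear] with t ht
    rw [mem_radialGraph_iff hu]
    refine ⟨smul_ne_zero (hrpos t).ne' (hσ0 t ht), ?_⟩
    rw [hu.radial _ _ _ (hσ0 t ht) (hrpos t), norm_smul, hn t ht, Real.norm_of_nonneg (hrpos t).le,
      div_mul_cancel₀ _ hℓ.ne']
  obtain ⟨N, hN⟩ := exists_isOutwardUnitNormal D hu hc.mem.self_of_nhds
  have hII := hconv c hc N hN
  have hmd (t) (ht : t ∈ Ioo (-ε) ε) :=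
    (hσ.contMDiffAt (isOpen_Ioo.mem_nhds ht)).mdifferentiableAt (by simp)
  -- As `σ` is parallel, only the scalar factor is differentiated, here and once more in `hver`. The
  -- horizontal acceleration of `c` is the acceleration of `γ`, zero at time zero (`hhor`).
  have hDc (t) (ht : t ∈ Ioo (-ε) ε) : covDerivAlong D c t = (deriv r t / ℓ) • σ t := by
    have h1 := covDerivAlong_smul D (hmd t ht) (f := fun s ↦ r s / ℓ)
      (((hr.contDiffAt (isOpen_Ioo.mem_nhds ht)).div_const ℓ).differentiableAt (by simp))
    rw [hpar t ht, smul_zero, add_zero, deriv_div_const] at h1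
    exact h1
  have hσ' : MDifferentiableAt 𝓘(ℝ, ℝ) (I.prod 𝓘(ℝ, F))
      (fun s ↦ (⟨γ s, (deriv r s / ℓ) • σ s⟩ : TotalSpace F V)) 0 :=
    (contMDiffAt_smul_along (n := ⊤) (hσ.contMDiffAt hnear)
      ((hrd.contDiffAt hnear).div_const ℓ)).mdifferentiableAt (by simp)
  have hver : covDerivAlong D (fun s ↦ (⟨γ s, covDerivAlong D c s⟩ : TotalSpace F V)) 0 =
      (deriv (deriv r) 0 / ℓ) • σ 0 := by
    refine (covDerivAlong_congr D (σ := fun s ↦ (deriv r s / ℓ) • σ s)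
      (τ := fun s ↦ covDerivAlong D c s) hσ'
      (by filter_upwards [hnear] with t ht using (hDc t ht).symm)).symm.trans ?_
    have h1 := covDerivAlong_smul D (hmd 0 h0) (f := fun s ↦ deriv r s / ℓ)
      (((hrd.contDiffAt hnear).div_const ℓ).differentiableAt (by simp))
    rw [hpar 0 h0, smul_zero, add_zero, deriv_div_const] at h1
    exact h1
  have hvel : MDifferentiableAt 𝓘(ℝ, ℝ) (I.prod 𝓘(ℝ, EB))
      (fun s ↦ (⟨γ s, curveVelocity I γ s⟩ : TangentBundle I M)) 0 :=
    ((contMDiffOn_curveVelocity (m := ∞) (n := ∞) (by simp) isOpen_Ioo hγ).contMDiffAt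
      hnear).mdifferentiableAt (by simp)
  have hhor : covDerivAlong LC
      (fun s ↦ (⟨γ s, horPart (c s) (velocity I c s)⟩ : TangentBundle I M)) 0 = 0 := by
    rw [← hacc]
    refine (covDerivAlong_congr LC (σ := fun s ↦ curveVelocity I γ s)
      (τ := fun s ↦ horPart (c s) (velocity I c s)) hvel ?_).symm
    filter_upwards [hnear] with t ht
    exact (horPart_velocity ((hcs t ht).mdifferentiableAt (by simp))).symm
  change 0 ≤ -(inner ℝ (covDerivAlong LC
      (fun s ↦ (⟨γ s, horPart (c s) (velocity I c s)⟩ : TangentBundle I M)) 0) (horPart (c 0) N) +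
    inner ℝ (covDerivAlong D (fun s ↦ (⟨γ s, covDerivAlong D c s⟩ : TotalSpace F V)) 0)
      (connector D (c 0) N)) at hII
  rw [hhor, hver, inner_zero_left, zero_add, inner_smul_left, conj_trivial] at hII
  -- Outwardness fixes the sign: the vertical part of `N` has positive scalar product with `σ 0`, so
  -- `II ≥ 0` forces the second derivative to be nonpositive.
  have hout : 0 < inner ℝ (connector D (c 0) N) ((r 0 / ℓ) • σ 0) := hN.outward
  rw [inner_smul_right, real_inner_comm] at hout
  have hpos := (mul_pos_iff_of_pos_left (hrpos 0)).1 hout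
  by_contra! hcon
  have := mul_pos (div_pos hcon hℓ) hpos
  linarith

theorem nontrivial_of_fibre {x : M} {v : V x} (hv : v ≠ 0) : Nontrivial F := by
  have L := ((trivializationAt F V x).continuousLinearEquivAt ℝ x
    (mem_baseSet_trivializationAt F V x)).toLinearEquiv
  exact ⟨L v, 0, fun h ↦ hv (L.map_eq_zero_iff.1 h)⟩

/-- The radius of a convex radial graph over a compact manifold does not decrease in any horizontal
direction. -/
theorem horDeriv_nonneg_of_convex [CompactSpace M] [Nonempty M]
    (hLC : LC.IsRiemannian) (hD : D.ContMDiffCovariantDerivative ∞) (hDm : D.IsMetric)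
    {u : TotalSpace F V → ℝ} (hu : IsRadiallyConstantSmooth I u)
    (hconv : IsConvexHypersurface LC D (radialGraph u)) {x : M} {v : V x} (hv : v ≠ 0)
    (h : TangentSpace I x) : 0 ≤ horDeriv D (fun η ↦ Real.exp (u η)) ⟨x, v⟩ h := by
  by_contra! hneg
  set f : TotalSpace F V → ℝ := fun η ↦ Real.exp (u η)
  have hf := hu.contMDiffOn_exp
  have hfpos (η) : 0 < f η := Real.exp_pos _
  have hfr (x : M) (v : V x) (t : ℝ) (hv : v ≠ 0) (ht : 0 < t) : f ⟨x, t • v⟩ = f ⟨x, v⟩ := by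
    simp only [f, hu.radial x v t hv ht]
  have hh : h ≠ 0 := by
    rintro rfl
    have := horDeriv_smul D f ⟨x, v⟩ 0 (0 : TangentSpace I x)
    rw [zero_smul, zero_mul] at this
    exact hneg.ne this
  have : Nontrivial EB := ⟨h, 0, hh⟩
  have : Nontrivial F := nontrivial_of_fibre hv
  have hhn : 0 < ‖h‖ := norm_pos_iff.2 hh
  set s := horDeriv D f ⟨x, v⟩ h / ‖h‖
  have hs : s < 0 := div_neg_of_neg_of_pos hneg hhn
  -- With this `δ` the slope at the given point is `s / 2`, still negative.
  set δ := -s / (2 * f ⟨x, v⟩)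
  have hδ : 0 < δ := div_pos (by linarith) (mul_pos two_pos (hfpos _))
  obtain ⟨x', v', h', hv', hh', hmin⟩ := exists_horSlope_le LC hD hDm hf hfr δ
  have hslope : horSlope D f δ x' v' h' < 0 := by
    refine (hmin x v h hv hh).trans_lt ?_
    have h1 : δ * f ⟨x, v⟩ = -s / 2 := by
      have := (hfpos ⟨x, v⟩).ne'
      simp only [δ]; field_simp
    change s + δ * f ⟨x, v⟩ < 0
    linarith
  -- At the minimum the slope is negative while `δ f` is positive, so the horizontal derivative
  -- itself is negative.
  have hneg' : horDeriv D f ⟨x', v'⟩ h' < 0 := by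
    have h1 := mul_pos hδ (hfpos ⟨x', v'⟩)
    rw [horSlope] at hslope
    have h2 : horDeriv D f ⟨x', v'⟩ h' / ‖h'‖ < 0 := by linarith
    by_contra! hcon
    exact h2.not_ge (div_nonneg hcon (norm_nonneg _))
  refine forall_of_parallel LC hD hDm (p := fun x' v' h' ↦ v' ≠ 0 → h' ≠ 0 →
    horDeriv D f ⟨x', v'⟩ h' < 0 → (∀ (x : M) (v : V x) (h : TangentSpace I x), v ≠ 0 → h ≠ 0 →
        horSlope D f δ x' v' h' ≤ horSlope D f δ x v h) → False) ?_ x' v' h' hv' hh' hneg' hmin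
  intro γ ε P hε hγ hacc hP0 hPs hPd hPn v hv hh hneg hmin
  have h0 : (0 : ℝ) ∈ Ioo (-ε) ε := by simp [hε]
  have hnear : Ioo (-ε) ε ∈ 𝓝 (0 : ℝ) := isOpen_Ioo.mem_nhds h0
  have hP (t) (ht : t ∈ Ioo (-ε) ε) : P t v ≠ 0 := by
    rw [← norm_pos_iff, hPn v t ht]; exact norm_pos_iff.2 hv
  set r : ℝ → ℝ := fun t ↦ f ⟨γ t, P t v⟩
  have hr : ContDiffOn ℝ ∞ r (Ioo (-ε) ε) := by
    rw [← contMDiffOn_iff_contDiffOn]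
    exact hf.comp (hPs v) fun t ht ↦ hP t ht
  have hrd : ContDiffOn ℝ ∞ (deriv r) (Ioo (-ε) ε) := hr.deriv_of_isOpen isOpen_Ioo (by simp)
  have hrh (t) (ht : t ∈ Ioo (-ε) ε) :
      deriv r t = horDeriv D f ⟨γ t, P t v⟩ (curveVelocity I γ t) := by
    have hm : (⟨γ t, P t v⟩ : TotalSpace F V) ∈ puncturedBundle F V := hP t ht
    exact (hasDerivAt_comp_parallel_section rfl
      ((hf.contMDiffAt ((isOpen_puncturedBundle I).mem_nhds hm)).mdifferentiableAt (by simp))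
      (((hPs v).contMDiffAt (isOpen_Ioo.mem_nhds ht)).mdifferentiableAt (by simp))
      (hPd v t ht)).deriv
  have hd0 : deriv r 0 < 0 := by
    rw [hrh 0 h0, hP0]; exact hneg
  have hdd : deriv (deriv r) 0 ≤ 0 :=
    deriv_deriv_radius_nonpos hu hconv hε (norm_pos_iff.2 hv) hγ hacc (hPs v) (hPd v) (hPn v)
  have hvel : MDifferentiableAt 𝓘(ℝ, ℝ) (I.prod 𝓘(ℝ, EB))
      (fun s ↦ (⟨γ s, curveVelocity I γ s⟩ : TangentBundle I M)) 0 :=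
    ((contMDiffOn_curveVelocity (m := ∞) (n := ∞) (by simp) isOpen_Ioo hγ).contMDiffAt
      hnear).mdifferentiableAt (by simp)
  set n : ℝ → ℝ := fun t ↦ ‖curveVelocity I γ t‖
  have hn0 : 0 < n 0 := norm_pos_iff.2 hh
  -- The speed is stationary at zero, because the acceleration vanishes there and the connection is
  -- metric.
  have hn : HasDerivAt n 0 0 := by
    have h1 := hLC.hasDerivAt_inner hvel hvel
    rw [hacc, inner_zero_left, inner_zero_right, add_zero] at h1
    have h2 := h1.sqrt (by rw [real_inner_self_eq_norm_sq]; exact (pow_pos hn0 2).ne')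
    rw [zero_div] at h2
    refine h2.congr_of_eventuallyEq (Eventually.of_forall fun t ↦ ?_)
    simp only [n, real_inner_self_eq_norm_sq, Real.sqrt_sq (norm_nonneg _)]
  -- `g` is the slope along the parallel curve, with a local minimum at zero. Yet its derivative
  -- there is `r'' / n + δ r'`, where the first term is at most zero and the second is negative
  -- thanks to `δ > 0`.
  set g : ℝ → ℝ := fun t ↦ deriv r t / n t + δ * r t
  have hg (t) (ht : t ∈ Ioo (-ε) ε) :
      g t = horSlope D f δ (γ t) (P t v) (curveVelocity I γ t) := by
    simp only [g, hrh t ht, horSlope, n, r]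
  have hgmin : IsLocalMin g 0 := by
    filter_upwards [hnear, hn.continuousAt.eventually_ne hn0.ne'] with t ht htn
    rw [hg t ht, hg 0 h0, hP0]
    exact hmin _ _ _ (hP t ht) (norm_ne_zero_iff.1 htn)
  have hgd : HasDerivAt g ((deriv (deriv r) 0 * n 0 - deriv r 0 * 0) / n 0 ^ 2 + δ * deriv r 0) 0 :=
    (((hrd.contDiffAt hnear).differentiableAt (by simp)).hasDerivAt.fun_div hn hn0.ne').fun_add
      (((hr.contDiffAt hnear).differentiableAt (by simp)).hasDerivAt.const_mul δ)
  have hz := hgmin.hasDerivAt_eq_zero hgd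
  have h1 : (deriv (deriv r) 0 * n 0 - deriv r 0 * 0) / n 0 ^ 2 ≤ 0 := by
    rw [mul_zero, sub_zero]
    exact div_nonpos_of_nonpos_of_nonneg (mul_nonpos_of_nonpos_of_nonneg hdd hn0.le) (by positivity)
  have h2 := mul_neg_of_pos_of_neg hδ hd0
  linarith

/-- The horizontal derivative is odd in `h`, so the inequality for `h` and `-h` gives equality. -/
theorem horDeriv_eq_zero_of_convex [CompactSpace M] [Nonempty M]
    (hLC : LC.IsRiemannian) (hD : D.ContMDiffCovariantDerivative ∞) (hDm : D.IsMetric)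
    {u : TotalSpace F V → ℝ} (hu : IsRadiallyConstantSmooth I u)
    (hconv : IsConvexHypersurface LC D (radialGraph u)) {x : M} {v : V x} (hv : v ≠ 0)
    (h : TangentSpace I x) : horDeriv D (fun η ↦ Real.exp (u η)) ⟨x, v⟩ h = 0 := by
  have h1 := horDeriv_nonneg_of_convex hLC hD hDm hu hconv hv h
  have h2 := horDeriv_nonneg_of_convex hLC hD hDm hu hconv hv ((-1 : ℝ) • h)
  have h3 := horDeriv_smul D (fun η ↦ Real.exp (u η)) ⟨x, v⟩ (-1) h
  rw [h3] at h2
  linarith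

/-- If the radius is constant along parallel curves, so is the vertical Gaussian curvature. -/
theorem eventually_curvature_eq (hD : D.ContMDiffCovariantDerivative ∞) (hDm : D.IsMetric)
    {u : TotalSpace F V → ℝ} (hu : IsRadiallyConstantSmooth I u)
    (hzero : ∀ (x : M) (v : V x) (h : TangentSpace I x), v ≠ 0 →
      horDeriv D (fun η ↦ Real.exp (u η)) ⟨x, v⟩ h = 0)
    {K : TotalSpace F V → ℝ} (hK : HasVerticalGaussianCurvature (radialGraph u) K)
    (hK_fibre : ∀ (x : M) (v w : V x), v ≠ 0 → w ≠ 0 → K ⟨x, v⟩ = K ⟨x, w⟩)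
    {γ : ℝ → M} {J : Set ℝ} (hJ : IsOpen J) (h0 : (0 : ℝ) ∈ J)
    (hγ : ContMDiffOn 𝓘(ℝ, ℝ) I ∞ γ J) :
    ∀ᶠ t in 𝓝 (0 : ℝ), ∀ (v : V (γ 0)) (w : V (γ t)), v ≠ 0 → w ≠ 0 →
      K ⟨γ t, w⟩ = K ⟨γ 0, v⟩ := by
  obtain ⟨ε, hε, hεJ, P, hP0, hP⟩ := exists_parallel_isometry hD hDm hJ h0 hγ
  have h0ε : (0 : ℝ) ∈ Ioo (-ε) ε := by simp [hε]
  filter_upwards [isOpen_Ioo.mem_nhds h0ε] with t ht v w hv hw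
  have hne (s) (hs : s ∈ Ioo (-ε) ε) (v) (hv : v ≠ 0) : P s v ≠ 0 := by
    rw [← norm_pos_iff, (hP v).2.2 s hs]; exact norm_pos_iff.2 hv
  have hconst (v : V (γ 0)) (hv : v ≠ 0) : u ⟨γ t, P t v⟩ = u ⟨γ 0, v⟩ := by
    have hd (s) (hs : s ∈ Ioo (-ε) ε) :
        HasDerivAt (fun s ↦ Real.exp (u ⟨γ s, P s v⟩)) 0 s := by
      have hm : (⟨γ s, P s v⟩ : TotalSpace F V) ∈ puncturedBundle F V := hne s hs v hv
      have := hasDerivAt_comp_parallel_section (D := D) (f := fun η ↦ Real.exp (u η)) rfl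
        ((hu.contMDiffOn_exp.contMDiffAt
          ((isOpen_puncturedBundle I).mem_nhds hm)).mdifferentiableAt (by simp))
        (((hP v).1.contMDiffAt (isOpen_Ioo.mem_nhds hs)).mdifferentiableAt (by simp))
        ((hP v).2.1 s hs)
      rwa [hzero _ _ _ (hne s hs v hv)] at this
    have h1 := isOpen_Ioo.is_const_of_deriv_eq_zero isPreconnected_Ioo
      (fun s hs ↦ (hd s hs).differentiableAt.differentiableWithinAt)
      (fun s hs ↦ (hd s hs).deriv) ht h0ε
    simp only [hP0] at h1
    exact Real.exp_injective h1
  obtain ⟨hfd0, hr0⟩ := finrank_fibre F (V := V) (γ 0)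
  obtain ⟨hfdt, hrt⟩ := finrank_fibre F (V := V) (γ t)
  -- Fibres have equal dimension, so the isometric map `P t` is invertible. By `hconst` it carries
  -- the fibre of the graph over `γ 0` onto the one over `γ t`.
  set Φ : V (γ 0) ≃ₗᵢ[ℝ] V (γ t) :=
    LinearIsometry.toLinearIsometryEquiv ⟨P t, fun v ↦ (hP v).2.2 t ht⟩ (hr0.trans hrt.symm)
  have hΦ (v) : Φ v = P t v := rfl
  have hmem (v : V (γ 0)) : (⟨γ t, Φ v⟩ : TotalSpace F V) ∈ radialGraph u ↔
      (⟨γ 0, v⟩ : TotalSpace F V) ∈ radialGraph u := by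
    rw [mem_radialGraph_iff hu, mem_radialGraph_iff hu, Φ.norm_map]
    refine and_congr (by simp) Iff.rfl |>.trans (and_congr_right fun hv ↦ ?_)
    rw [hΦ, hconst v hv]
  have hset : Φ.symm ⁻¹' {w | (⟨γ 0, w⟩ : TotalSpace F V) ∈ radialGraph u} =
      {w | (⟨γ t, w⟩ : TotalSpace F V) ∈ radialGraph u} := by
    ext w
    have := hmem (Φ.symm w)
    rw [Φ.apply_symm_apply] at this
    exact this.symm
  have hvn : 0 < ‖v‖ := norm_pos_iff.2 hv
  have ha : 0 < Real.exp (u ⟨γ 0, v⟩) / ‖v‖ := div_pos (Real.exp_pos _) hvn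
  -- The point of the graph on the ray through `v`.
  set p : V (γ 0) := (Real.exp (u ⟨γ 0, v⟩) / ‖v‖) • v
  have hp0 : p ≠ 0 := smul_ne_zero ha.ne' hv
  have hp : (⟨γ 0, p⟩ : TotalSpace F V) ∈ radialGraph u := by
    rw [mem_radialGraph_iff hu]
    refine ⟨hp0, ?_⟩
    rw [hu.radial _ _ _ hv ha, norm_smul, Real.norm_of_nonneg ha.le, div_mul_cancel₀ _ hvn.ne']
  have hq := (hmem p).2 hp
  have hq0 : Φ p ≠ 0 := hne t ht p hp0
  have k1 := (hK _ hp).map Φ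
  have k2 := hK _ hq
  change HasGaussianCurvatureAt
    (Φ.symm ⁻¹' {w | (⟨γ 0, w⟩ : TotalSpace F V) ∈ radialGraph u}) (Φ p) (K ⟨γ 0, p⟩) at k1
  change HasGaussianCurvatureAt
    {w | (⟨γ t, w⟩ : TotalSpace F V) ∈ radialGraph u} (Φ p) (K ⟨γ t, Φ p⟩) at k2
  rw [hset, fibre_radialGraph hu] at k1
  rw [fibre_radialGraph hu] at k2
  have hq1 : Φ p ∈ {w : V (γ t) | w ≠ 0 ∧ ‖w‖ * Real.exp (-u ⟨γ t, w⟩) = 1} := by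
    rw [← fibre_radialGraph hu]; exact hq
  -- Constancy on fibres moves the claim to `Φ p` and `p`, where `k1` and `k2` are two curvatures of
  -- one hypersurface at one point.
  rw [hK_fibre _ w (Φ p) hw hq0, hK_fibre _ v p hv hp0]
  exact (isRadialGauge_fibre hu (γ t)).gaussianCurvature_unique hq0 hq1.2 k2 k1

/-- The vertical Gaussian curvature of a convex radial graph, if constant on fibres, is constant. -/
theorem curvature_const_of_convex [CompactSpace M] [ConnectedSpace M] [Nontrivial F]
    (hLC : LC.IsRiemannian) (hD : D.ContMDiffCovariantDerivative ∞) (hDm : D.IsMetric)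
    {u : TotalSpace F V → ℝ} (hu : IsRadiallyConstantSmooth I u)
    (hconv : IsConvexHypersurface LC D (radialGraph u))
    {K : TotalSpace F V → ℝ} (hK : HasVerticalGaussianCurvature (radialGraph u) K)
    (hK_fibre : ∀ (x : M) (v w : V x), v ≠ 0 → w ≠ 0 → K ⟨x, v⟩ = K ⟨x, w⟩) :
    ∃ a : ℝ, ∀ η ∈ puncturedBundle F V, K η = a := by
  have hnt (x : M) : ∃ v : V x, v ≠ 0 := by
    have L := ((trivializationAt F V x).continuousLinearEquivAt ℝ x
      (mem_baseSet_trivializationAt F V x)).toLinearEquiv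
    have : Nontrivial (V x) := L.symm.injective.nontrivial
    exact exists_ne 0
  -- `K` descends to a function `κ` on `M`; the choice of `ν` does not matter, as `K` is constant on
  -- fibres.
  choose ν hν using hnt
  set κ : M → ℝ := fun x ↦ K ⟨x, ν x⟩
  have hcurve {γ : ℝ → M} {J : Set ℝ} (hJ : IsOpen J) (hJc : IsPreconnected J)
      (hγ : ContMDiffOn 𝓘(ℝ, ℝ) I ∞ γ J) {s t : ℝ} (hs : s ∈ J) (ht : t ∈ J) :
      κ (γ s) = κ (γ t) := by
    have hd (a) (ha : a ∈ J) : HasDerivAt (fun s ↦ κ (γ s)) 0 a := by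
      have hshift : ContDiff ℝ ∞ (fun s : ℝ ↦ a + s) := by fun_prop
      have h1 := eventually_curvature_eq hD hDm hu
        (fun x v h hv ↦ horDeriv_eq_zero_of_convex hLC hD hDm hu hconv hv h) hK hK_fibre
        (γ := fun s ↦ γ (a + s)) (hJ.preimage hshift.continuous)
        (by simpa using ha) (hγ.comp hshift.contMDiff.contMDiffOn fun s hs ↦ hs)
      have h2 : Tendsto (fun s ↦ s - a) (𝓝 a) (𝓝 0) := by
        have : Continuous fun s : ℝ ↦ s - a := by fun_prop
        simpa using this.tendsto a
      refine (hasDerivAt_const a (κ (γ a))).congr_of_eventuallyEq ?_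
      filter_upwards [h2.eventually h1] with s hs
      have h3 := hs (ν _) (ν _) (hν _) (hν _)
      change κ (γ (a + (s - a))) = κ (γ (a + 0)) at h3
      rwa [add_sub_cancel, add_zero] at h3
    exact hJ.is_const_of_deriv_eq_zero hJc
      (fun a ha ↦ (hd a ha).differentiableAt.differentiableWithinAt)
      (fun a ha ↦ (hd a ha).deriv) hs ht
  -- Points near `x₀` are joined to `x₀` by a segment in the chart, and `κ` is constant along smooth
  -- curves.
  have hloc : IsLocallyConstant κ := by
    rw [IsLocallyConstant.iff_eventually_eq]
    intro x₀
    set φ := extChartAt I x₀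
    obtain ⟨ρ, hρ, hρφ⟩ := Metric.mem_nhds_iff.1 (extChartAt_target_mem_nhds (I := I) x₀)
    filter_upwards [extChartAt_source_mem_nhds (I := I) x₀,
      (continuousAt_extChartAt (I := I) x₀).preimage_mem_nhds (Metric.ball_mem_nhds _ hρ)]
      with x hx hxρ
    set y : ℝ → EB := fun t ↦ AffineMap.lineMap (φ x₀) (φ x) t
    have hy : ContDiff ℝ ∞ y := by
      simp only [y, AffineMap.lineMap_apply_module']; fun_prop
    set J := y ⁻¹' Metric.ball (φ x₀) ρ
    have hJ : IsOpen J := Metric.isOpen_ball.preimage hy.continuous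
    have hJc : IsPreconnected J :=
      ((convex_ball (φ x₀) ρ).affine_preimage (AffineMap.lineMap (φ x₀) (φ x))).isPreconnected
    have h0 : (0 : ℝ) ∈ J := by
      simp [J, y, hρ]
    have h1 : (1 : ℝ) ∈ J := by
      change y 1 ∈ Metric.ball (φ x₀) ρ
      simp only [y, AffineMap.lineMap_apply_one]; exact hxρ
    have h := hcurve hJ hJc (contMDiffOn_extChartAt_symm_comp x₀ hy.contDiffOn
      fun t ht ↦ hρφ ht) h1 h0
    simp only [y, AffineMap.lineMap_apply_one, AffineMap.lineMap_apply_zero] at h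
    rwa [φ.left_inv hx, extChartAt_to_inv x₀] at h
  obtain ⟨x₁⟩ : Nonempty M := inferInstance
  refine ⟨κ x₁, ?_⟩
  rintro ⟨x, v⟩ hv
  rw [hK_fibre x v (ν x) hv (hν x)]
  exact hloc.apply_eq_of_preconnectedSpace x x₁

end NonconstantCurvature

/-! ### The three assertions together -/

theorem theorem1 {n m : ℕ} (hm : 2 ≤ m)
    {M : Type*} [TopologicalSpace M] [ChartedSpace (EuclideanSpace ℝ (Fin n)) M]
    [IsManifold (𝓡 n) ∞ M] [T2Space M] [CompactSpace M] [ConnectedSpace M]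
    [RiemannianBundle (fun x : M ↦ TangentSpace (𝓡 n) x)]
    [IsContMDiffRiemannianBundle (𝓡 n) ∞ (EuclideanSpace ℝ (Fin n))
      (fun x : M ↦ TangentSpace (𝓡 n) x)]
    {V : M → Type*} [TopologicalSpace (TotalSpace (EuclideanSpace ℝ (Fin m)) V)]
    [∀ x, NormedAddCommGroup (V x)] [∀ x, InnerProductSpace ℝ (V x)]
    [FiberBundle (EuclideanSpace ℝ (Fin m)) V] [VectorBundle ℝ (EuclideanSpace ℝ (Fin m)) V]
    [ContMDiffVectorBundle ∞ (EuclideanSpace ℝ (Fin m)) V (𝓡 n)]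
    [IsContMDiffRiemannianBundle (𝓡 n) ∞ (EuclideanSpace ℝ (Fin m)) V]
    (LC : CovariantDerivative (𝓡 n) (EuclideanSpace ℝ (Fin n))
      (fun x : M ↦ TangentSpace (𝓡 n) x)) (hLC : IsLeviCivita LC)
    (D : CovariantDerivative (𝓡 n) (EuclideanSpace ℝ (Fin m)) V)
    (hD_smooth : CovariantDerivative.ContMDiffCovariantDerivative D ∞)
    (hD_metric : D.IsMetricCompatible)
    (K : TotalSpace (EuclideanSpace ℝ (Fin m)) V → ℝ)
    (hK_smooth : ContMDiffOn ((𝓡 n).prod 𝓘(ℝ, EuclideanSpace ℝ (Fin m))) 𝓘(ℝ, ℝ) ∞ K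
      (puncturedBundle (EuclideanSpace ℝ (Fin m)) V))
    (hK_pos : ∀ η ∈ puncturedBundle (EuclideanSpace ℝ (Fin m)) V, 0 < K η)
    (hK_fibre : ∀ (x : M) (v w : V x), v ≠ 0 → w ≠ 0 → K ⟨x, v⟩ = K ⟨x, w⟩) :
    (IsRadiallyConstantSmooth (𝓡 n) (fun η ↦ -Real.log (K η) / ((m : ℝ) - 1)) ∧
      HasVerticalGaussianCurvature
        (radialGraph (fun η ↦ -Real.log (K η) / ((m : ℝ) - 1))) K) ∧
    ((∃ a : ℝ, ∀ η ∈ puncturedBundle (EuclideanSpace ℝ (Fin m)) V, K η = a) →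
      IsConvexHypersurface LC D (radialGraph (fun η ↦ -Real.log (K η) / ((m : ℝ) - 1)))) ∧
    ((¬ ∃ a : ℝ, ∀ η ∈ puncturedBundle (EuclideanSpace ℝ (Fin m)) V, K η = a) →
      ∀ u : TotalSpace (EuclideanSpace ℝ (Fin m)) V → ℝ,
        IsRadiallyConstantSmooth (𝓡 n) u →
        HasVerticalGaussianCurvature (radialGraph u) K →
        ¬ IsConvexHypersurface LC D (radialGraph u)) := by
  -- Compatibility is provided for vector fields; `Function.update 0 x A` is a field with value `A`
  -- at `x`.
  have hDm : D.IsMetric := fun x A X Y hX hY ↦ by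
    classical
    have := hD_metric.mvfderiv_inner_eq (Function.update 0 x A) hX hY
    simpa using this
  have hLCm : LC.IsRiemannian := hLC.metric
  have hF : Module.finrank ℝ (EuclideanSpace ℝ (Fin m)) = m := finrank_euclideanSpace_fin
  have : Nontrivial (EuclideanSpace ℝ (Fin m)) :=
    Module.nontrivial_of_finrank_pos (R := ℝ) (by rw [hF]; omega)
  have h1 := radialGraph_log (I := 𝓡 n) hm hF hK_smooth hK_pos hK_fibre
  refine ⟨h1, ?_, fun hne u hu hK hconv ↦ hne
    (curvature_const_of_convex hLCm hD_smooth hDm hu hconv hK hK_fibre)⟩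
  rintro ⟨a, ha⟩
  exact isConvexHypersurface_of_const hD_smooth hDm h1.1 (a := -Real.log a / ((m : ℝ) - 1))
    fun η hη ↦ by rw [ha η hη]
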